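/- Let $K$ be a number field with ring of integers $\mathcal O$, and let $\mathbb A_f$ be its ring of finite adeles, $\hat{\mathcal O}\subset\mathbb A_f$ the subring of integral adeles. Let $K^*_+$ be the group of elements of $K^*$ that are positive in every real embedding of $K$, $\mathcal O^*_+=\mathcal O^*\cap K^*_+$, and let $\overline{\mathcal O^*_+}$ be the closure of $\mathcal O^*_+$ in $\mathbb A_f^*$. For $x\in K^*$ let $N_K(x)$ be the absolute norm of the fractional ideal $x\mathcal O$. Put $$P_{\mathcal O}^+=\left\{\begin{pmatrix}1&y\\0&x\end{pmatrix}: y\in\mathcal O,\ x\in\mathcal O^*_+\right\}\subset P_K^+=\left\{\begin{pmatrix}1&y\\0&x\end{pmatrix}: y\in K,\ x\in K^*_+\right\}.$$ For a subgroup $\Gamma$ of a group $G$, the pair $\Gamma\subset G$ is called a Hecke pair if every double coset $\Gamma g\Gamma$ is a finite union of right cosets $\Gamma l$ and a finite union of left cosets $r\Gamma$. In this case put $\Delta(g)=\dfrac{[\Gamma:\Gamma\cap g\Gamma g^{-1}]}{[g\Gamma g^{-1}:\Gamma\cap g\Gamma g^{-1}]}$, let $\mathcal H(G,\Gamma)$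 be the space of finitely supported functions on $\Gamma\backslash G/\Gamma$, acting on $\ell^2(\Gamma\backslash G)$ by $(f\xi)(g)=\sum_{h\in\Gamma\backslash G}f(gh^{-1})\xi(h)$, let $[g]\in\mathcal H(G,\Gamma)$ be the characteristic function of $\Gamma g\Gamma$, and let $C^*_r(G,\Gamma)$ be the norm closure of $\mathcal H(G,\Gamma)$ in $B(\ell^2(\Gamma\backslash G))$. Then $P_{\mathcal O}^+\subset P_K^+$ is a Hecke pair, every element of $\mathcal H(P_K^+,P_{\mathcal O}^+)$ acts by a bounded operator, there is an action $\tau$ of $\mathbb R$ on $C^*_r(P_K^+,P_{\mathcal O}^+)$ by $*$-automorphisms, pointwise norm continuous, with $\tau_t([g])=\Delta(g)^{-it}[g]$ for all $g\in P_K^+$, and the following holds. Let $K^*_+/\mathcal O^*_+$ act on $C_0(\mathbb A_f/\overline{\mathcal O^*_+})$ by $\alpha_x(f)=f(x^{-1}\,\cdot\,)$, and let $A=C_0(\mathbb A_f/\overline{\mathcal O^*_+})\rtimes_\alpha(K^*_+/\mathcal O^*_+)$ be the (full) C$^*$-crossed product by this discrete group, with canonical unitaries $u_x$ implementing $\alpha$.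 There is an action $\sigma$ of $\mathbb R$ on $A$ by $*$-automorphisms, pointwise norm continuous, with $$\sigma_t(fu_x)=N_K(x)^{it}fu_x\qquad\text{for } f\in C_0(\mathbb A_f/\overline{\mathcal O^*_+}),\ x\in K^*_+/\mathcal O^*_+,\ t\in\mathbb R.$$ The characteristic function $p=\mathbf 1_{\hat{\mathcal O}/\overline{\mathcal O^*_+}}$ belongs to $C_0(\mathbb A_f/\overline{\mathcal O^*_+})$, and there is a $*$-isomorphism $$\varphi:\ C^*_r(P_K^+,P_{\mathcal O}^+)\ \longrightarrow\ pAp$$ such that $\varphi(\tau_t(a))=\sigma_t(\varphi(a))$ for all $t\in\mathbb R$ and all $a\in C^*_r(P_K^+,P_{\mathcal O}^+)$. -/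

import Mathlib

open scoped ENNReal ZeroAtInfty

noncomputable section

namespace HeckeBC

universe u

/-! ## Hecke pairs and their reduced C*-algebras -/

section Hecke

variable {G : Type u} [Group G] (Γ : Subgroup G)

/-- The set `Γ \ G` of right cosets `Γ g`. -/
abbrev RightCosets : Type u := Quotient (QuotientGroup.rightRel Γ)

/-- The right coset `Γ g`. -/
abbrev rightCoset (g : G) : RightCosets Γ := Quotient.mk (QuotientGroup.rightRel Γ) g

/-- `Γ ⊂ G` is a Hecke pair if every double coset `Γ g Γ` is a finite union of right cosets
`Γ l` and a finite union of left cosets `r Γ`. -/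
def IsHeckePair : Prop :=
  ∀ g : G,
    ((rightCoset Γ) '' DoubleCoset.doubleCoset g (Γ : Set G) (Γ : Set G)).Finite ∧
    ((QuotientGroup.mk : G → G ⧸ Γ) '' DoubleCoset.doubleCoset g (Γ : Set G) (Γ : Set G)).Finite

/-- The modular function `Δ(g) = [Γ : Γ ∩ gΓg⁻¹] / [gΓg⁻¹ : Γ ∩ gΓg⁻¹]` of a Hecke pair.
Here `H.relIndex L` is the index `[L : H ∩ L]`. -/
def modularFunction (g : G) : ℝ :=
  ((Γ.map (MulAut.conj g).toMonoidHom).relIndex Γ : ℝ) /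
    (Γ.relIndex (Γ.map (MulAut.conj g).toMonoidHom) : ℝ)

/-- The vector space `H(G, Γ)` of finitely supported functions on `Γ \ G / Γ`. -/
abbrev HeckeAlgebra : Type u := DoubleCoset.Quotient (Γ : Set G) (Γ : Set G) →₀ ℂ

/-- `[g] ∈ H(G, Γ)`, the characteristic function of the double coset `Γ g Γ`. -/
def doubleCosetFunction (g : G) : HeckeAlgebra Γ :=
  Finsupp.single (DoubleCoset.mk Γ Γ g) 1

/-- The Hilbert space `ℓ²(Γ \ G)`. -/
abbrev CosetL2 : Type u := lp (fun _ : RightCosets Γ => ℂ) 2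

/-- The bounded operator `T` on `ℓ²(Γ \ G)` is the operator by which `f ∈ H(G, Γ)` acts:
`(f ξ)(g) = ∑_{h ∈ Γ \ G} f (g h⁻¹) ξ(h)`.  The summand does not depend on the choice of the
representative `h` of a right coset, because `f` is a function of double cosets. -/
def IsHeckeOperator (f : HeckeAlgebra Γ) (T : CosetL2 Γ →L[ℂ] CosetL2 Γ) : Prop :=
  ∀ (ξ : CosetL2 Γ) (g : G),
    HasSum (fun c : RightCosets Γ => f (DoubleCoset.mk Γ Γ (g * (Quotient.out c)⁻¹)) * ξ c)
      (T ξ (rightCoset Γ g))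

/-- The reduced Hecke C*-algebra: the norm closure of `H(G, Γ)` in its representation on
`ℓ²(Γ \ G)`.  For a Hecke pair the operators of the elements of `H(G, Γ)` are already closed under
linear combinations, products (convolution) and adjoints (`f^*(g) = conj (f g⁻¹)`), so that `adjoin`
adds nothing. -/
def reducedHeckeAlgebra : NonUnitalStarSubalgebra ℂ (CosetL2 Γ →L[ℂ] CosetL2 Γ) :=
  (NonUnitalStarAlgebra.adjoin ℂ
    {T : CosetL2 Γ →L[ℂ] CosetL2 Γ | ∃ f : HeckeAlgebra Γ, IsHeckeOperator Γ f T}).topologicalClosure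

end Hecke

/-! ## One-parameter actions -/

/-- A (pointwise norm continuous) action of `ℝ` by `*`-automorphisms. -/
structure IsRealAction {A : Type*} [NonUnitalRing A] [Module ℂ A] [Star A] [TopologicalSpace A]
    (τ : ℝ → (A ≃⋆ₐ[ℂ] A)) : Prop where
  zero : ∀ a, τ 0 a = a
  add : ∀ s t a, τ (s + t) a = τ s (τ t a)
  continuous : ∀ a, Continuous fun t => τ t a

/-- The canonical action of `ℝ` on the reduced Hecke C*-algebra: the action determined by
`[g] ↦ Δ(g)^{-it} [g]`. -/
structure IsHeckeDynamics {G : Type u} [Group G] (Γ : Subgroup G)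
    (τ : ℝ → (reducedHeckeAlgebra Γ ≃⋆ₐ[ℂ] reducedHeckeAlgebra Γ)) : Prop where
  isRealAction : IsRealAction τ
  apply_doubleCoset : ∀ (t : ℝ) (g : G) (a : reducedHeckeAlgebra Γ),
    IsHeckeOperator Γ (doubleCosetFunction Γ g) a →
      τ t a = ((modularFunction Γ g : ℂ) ^ (-(Complex.I * t))) • a

/-! ## The crossed product of `C₀(X)` by a discrete group -/

section Crossed

variable {X G : Type u} [TopologicalSpace X] [Group G] [MulAction G X] [ContinuousConstSMul G X]

/-- The action `α_g(f) = f(g⁻¹ ·)` on `C₀(X)`. -/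
def translate (g : G) (f : C₀(X, ℂ)) : C₀(X, ℂ) :=
  f.comp (Homeomorph.smul (g⁻¹ : G) : X ≃ₜ X).toCocompactMap

variable (X G) in
/-- A covariant representation of `(C₀(X), G, α)` on a Hilbert space. -/
structure CovariantRep : Type (u + 1) where
  /-- The Hilbert space. -/
  H : Type u
  [normed : NormedAddCommGroup H]
  [inner : InnerProductSpace ℂ H]
  [complete : CompleteSpace H]
  /-- The representation of `C₀(X)`. -/
  π : C₀(X, ℂ) →⋆ₙₐ[ℂ] (H →L[ℂ] H)
  /-- The unitary representation of `G`. -/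
  U : G →* unitary (H →L[ℂ] H)
  covariant : ∀ (g : G) (f : C₀(X, ℂ)),
    (U g : H →L[ℂ] H) * π f * star (U g : H →L[ℂ] H) = π (translate g f)

attribute [instance] CovariantRep.normed CovariantRep.inner CovariantRep.complete

variable (X G) in
/-- The C*-algebra of bounded families of operators, indexed by all covariant representations. -/
def UniversalOperators : Type (u + 1) :=
  lp (fun ρ : CovariantRep X G => ρ.H →L[ℂ] ρ.H) ∞

instance : NonUnitalCStarAlgebra (UniversalOperators X G) :=
  inferInstanceAs (NonUnitalCStarAlgebra (lp (fun ρ : CovariantRep X G => ρ.H →L[ℂ] ρ.H) ∞))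

/-- The element `f u_g`, which is `π(f) U(g)` in the covariant representation `(π, U)`. -/
def monomial (f : C₀(X, ℂ)) (g : G) : UniversalOperators X G :=
  ⟨fun ρ => ρ.π f * (ρ.U g : ρ.H →L[ℂ] ρ.H), by
    refine memℓp_infty ⟨‖f‖, ?_⟩
    rintro _ ⟨ρ, rfl⟩
    change ‖ρ.π f * (ρ.U g : ρ.H →L[ℂ] ρ.H)‖ ≤ ‖f‖
    rw [CStarRing.norm_mul_coe_unitary]
    exact NonUnitalStarAlgHom.norm_apply_le ρ.π f⟩

variable (X G) in
/-- The (full) crossed product `C₀(X) ⋊_α G` by the discrete group `G`: the completion of the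
`*`-algebra of finite sums `∑ f_g u_g` in the norm `sup ‖∑ π(f_g) U(g)‖` over all covariant
representations, realised as the closure of that `*`-algebra in the universal covariant
representation. -/
def crossedProduct : NonUnitalStarSubalgebra ℂ (UniversalOperators X G) :=
  (NonUnitalStarAlgebra.adjoin ℂ
    {T | ∃ (f : C₀(X, ℂ)) (g : G), T = monomial f g}).topologicalClosure

theorem monomial_mem_crossedProduct (f : C₀(X, ℂ)) (g : G) :
    monomial f g ∈ crossedProduct X G :=
  NonUnitalStarSubalgebra.le_topologicalClosure _
    (NonUnitalStarAlgebra.subset_adjoin ℂ _ ⟨f, g, rfl⟩)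

/-- The element `f u_g` of the crossed product. -/
def crossedMonomial (f : C₀(X, ℂ)) (g : G) : crossedProduct X G :=
  ⟨monomial f g, monomial_mem_crossedProduct f g⟩

end Crossed

/-- The corner `p A p = {a ∈ A | p a = a = a p}` defined by a projection `p`. -/
def corner {A : Type*} [NonUnitalRing A] [Module ℂ A] [IsScalarTower ℂ A A] [SMulCommClass ℂ A A]
    [StarRing A] [StarModule ℂ A] (p : A) (hp : IsStarProjection p) :
    NonUnitalStarSubalgebra ℂ A where
  carrier := {a | p * a = a ∧ a * p = a}
  add_mem' := by
    rintro a b ⟨ha, ha'⟩ ⟨hb, hb'⟩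
    exact ⟨by rw [mul_add, ha, hb], by rw [add_mul, ha', hb']⟩
  zero_mem' := ⟨mul_zero p, zero_mul p⟩
  mul_mem' := by
    rintro a b ⟨ha, _⟩ ⟨_, hb'⟩
    exact ⟨by rw [← mul_assoc, ha], by rw [mul_assoc, hb']⟩
  smul_mem' := by
    rintro c a ⟨ha, ha'⟩
    exact ⟨by rw [mul_smul_comm, ha], by rw [smul_mul_assoc, ha']⟩
  star_mem' := by
    rintro a ⟨ha, ha'⟩
    have hs : star p = p := hp.isSelfAdjoint
    exact ⟨by conv_lhs => rw [← hs, ← star_mul, ha'],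
      by conv_lhs => rw [← hs, ← star_mul, ha]⟩

/-! ## The arithmetic objects -/

section Arithmetic

open IsDedekindDomain HeightOneSpectrum NumberField
open scoped nonZeroDivisors

variable (K : Type u) [Field K]

/-- `K^*_+`: the elements of `K^*` that are positive in every real embedding. -/
def totallyPositive : Subgroup Kˣ where
  carrier := {x | ∀ φ : K →+* ℝ, 0 < φ x}
  one_mem' φ := by simp
  mul_mem' := fun {x y} hx hy φ => by
    simpa using mul_pos (hx φ) (hy φ)
  inv_mem' := fun {x} hx φ => by simpa using hx φ

/-- `O^*_+`: the totally positive units of the ring of integers, as a subgroup of `K^*_+`. -/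
def totallyPositiveUnits : Subgroup (totallyPositive K) :=
  (Units.map (algebraMap (𝓞 K) K).toMonoidHom).range.subgroupOf (totallyPositive K)

/-- The group `P_K^+` of the matrices `(1, y; 0, x)` with `y ∈ K` and `x ∈ K^*_+`. -/
@[ext]
structure AxbGroup where
  /-- The upper right entry. -/
  y : K
  /-- The lower right entry. -/
  x : totallyPositive K

namespace AxbGroup

variable {K}

/-- The matrix `(1, y; 0, x)`. -/
def toMatrix (g : AxbGroup K) : Matrix (Fin 2) (Fin 2) K := !![1, g.y; 0, ((g.x : Kˣ) : K)]

instance : One (AxbGroup K) := ⟨⟨0, 1⟩⟩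

instance : Mul (AxbGroup K) := ⟨fun g h => ⟨h.y + g.y * ((h.x : Kˣ) : K), g.x * h.x⟩⟩

instance : Inv (AxbGroup K) := ⟨fun g => ⟨-(g.y * ((g.x⁻¹ : Kˣ) : K)), g.x⁻¹⟩⟩

@[simp] theorem one_y : (1 : AxbGroup K).y = 0 := rfl
@[simp] theorem one_x : (1 : AxbGroup K).x = 1 := rfl
@[simp] theorem mul_y (g h : AxbGroup K) : (g * h).y = h.y + g.y * ((h.x : Kˣ) : K) := rfl
@[simp] theorem mul_x (g h : AxbGroup K) : (g * h).x = g.x * h.x := rfl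
@[simp] theorem inv_y (g : AxbGroup K) : (g⁻¹).y = -(g.y * ((g.x⁻¹ : Kˣ) : K)) := rfl
@[simp] theorem inv_x (g : AxbGroup K) : (g⁻¹).x = g.x⁻¹ := rfl

instance : Group (AxbGroup K) :=
  Group.ofLeftAxioms
    (fun a b c => by
      ext
      · simp; ring
      · simp [mul_assoc])
    (fun a => by ext <;> simp)
    (fun a => by
      ext
      · simp
      · simp)

/-- The group law is matrix multiplication. -/
theorem toMatrix_mul (g h : AxbGroup K) : (g * h).toMatrix = g.toMatrix * h.toMatrix := by
  simp [toMatrix]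

end AxbGroup

variable [NumberField K]

/-- `P_O^+ ⊂ P_K^+`: the matrices `(1, y; 0, x)` with `y ∈ O` and `x ∈ O^*_+`. -/
def integralAxbGroup : Subgroup (AxbGroup K) where
  carrier := {g | g.y ∈ (algebraMap (𝓞 K) K).range ∧ g.x ∈ totallyPositiveUnits K}
  one_mem' := ⟨zero_mem _, one_mem _⟩
  mul_mem' := by
    rintro g h ⟨hg, hg'⟩ ⟨hh, hh'⟩
    refine ⟨?_, mul_mem hg' hh'⟩
    obtain ⟨u, hu⟩ := hh'
    have hu' : (algebraMap (𝓞 K) K) (u : 𝓞 K) = ((h.x : Kˣ) : K) := congrArg Units.val hu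
    exact add_mem hh (mul_mem hg ⟨u, hu'⟩)
  inv_mem' := by
    rintro g ⟨hg, hg'⟩
    refine ⟨?_, inv_mem hg'⟩
    obtain ⟨u, hu⟩ := inv_mem hg'
    have hu' : (algebraMap (𝓞 K) K) (u : 𝓞 K) = (((g.x⁻¹ : totallyPositive K) : Kˣ) : K) :=
      congrArg Units.val hu
    exact neg_mem (mul_mem hg ⟨u, hu'⟩)

/-- The absolute norm `N_K(x)` of `x ∈ K^*`: the absolute norm of the fractional ideal `x O`. -/
def absoluteNorm (x : Kˣ) : ℝ :=
  ((FractionalIdeal.absNorm (FractionalIdeal.spanSingleton (𝓞 K)⁰ (x : K)) : ℚ) : ℝ)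

/-- The ring of finite adeles. -/
abbrev FiniteAdeles : Type u := FiniteAdeleRing (𝓞 K) K

instance : T2Space (FiniteAdeles K) :=
  inferInstanceAs (T2Space (RestrictedProduct
    (fun v : HeightOneSpectrum (𝓞 K) => v.adicCompletion K)
    (fun v => (v.adicCompletionIntegers K : Set (v.adicCompletion K))) Filter.cofinite))

/-- The closure of `O^*_+` in the topological group of finite ideles. -/
def unitsClosure : Subgroup (FiniteAdeles K)ˣ :=
  (((totallyPositiveUnits K).map (totallyPositive K).subtype).map
    (FiniteAdeleRing.unitEmbedding (𝓞 K) K)).topologicalClosure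

/-- The quotient of the finite adeles by the multiplication action of the closure of `O^*_+`. -/
def AdeleQuotient : Type u := MulAction.orbitRel.Quotient (unitsClosure K) (FiniteAdeles K)

instance : TopologicalSpace (AdeleQuotient K) :=
  inferInstanceAs (TopologicalSpace (MulAction.orbitRel.Quotient (unitsClosure K) (FiniteAdeles K)))

/-- The quotient map. -/
def AdeleQuotient.mk (a : FiniteAdeles K) : AdeleQuotient K :=
  Quotient.mk (MulAction.orbitRel (unitsClosure K) (FiniteAdeles K)) a

/-- The group `K^*_+ / O^*_+`. -/
abbrev PrincipalGroup : Type u := totallyPositive K ⧸ totallyPositiveUnits K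

theorem AdeleQuotient.mk_smul (h : (FiniteAdeles K)ˣ) (hh : h ∈ unitsClosure K)
    (a : FiniteAdeles K) : AdeleQuotient.mk K (h • a) = AdeleQuotient.mk K a :=
  Quotient.sound ((MulAction.orbitRel_apply).2 ⟨⟨h, hh⟩, rfl⟩)

/-- Multiplication by `x ∈ K^*_+` on the adele quotient. -/
def mulBy (x : totallyPositive K) (ω : AdeleQuotient K) : AdeleQuotient K :=
  Quotient.liftOn ω
    (fun a => AdeleQuotient.mk K (FiniteAdeleRing.unitEmbedding (𝓞 K) K (x : Kˣ) • a)) (by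
      intro a b hab
      obtain ⟨h, rfl⟩ := (MulAction.orbitRel_apply).1 hab
      change AdeleQuotient.mk K (_ • ((h : (FiniteAdeles K)ˣ) • b)) = _
      rw [smul_comm, AdeleQuotient.mk_smul K _ h.2])

/-- `K^*_+ / O^*_+` acts on the adele quotient by multiplication: `[x] [a] = [x a]`. -/
instance : MulAction (PrincipalGroup K) (AdeleQuotient K) where
  smul g ω := Quotient.liftOn g (fun x => mulBy K x ω) (by
    intro x x' hx
    obtain ⟨u, hu, rfl⟩ : ∃ u ∈ totallyPositiveUnits K, x' = x * u :=
      ⟨x⁻¹ * x', QuotientGroup.leftRel_apply.1 hx, by simp⟩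
    induction ω using Quotient.ind with
    | _ a =>
      change AdeleQuotient.mk K _ = AdeleQuotient.mk K _
      rw [Subgroup.coe_mul, map_mul, mul_smul, smul_comm]
      refine (AdeleQuotient.mk_smul K _ ?_ _).symm
      exact Subgroup.le_topologicalClosure _
        (Subgroup.mem_map_of_mem _ (Subgroup.mem_map_of_mem _ hu)))
  one_smul ω := by
    induction ω using Quotient.ind with
    | _ a =>
      change AdeleQuotient.mk K (FiniteAdeleRing.unitEmbedding (𝓞 K) K 1 • a) = AdeleQuotient.mk K a
      rw [map_one, one_smul]
  mul_smul g h ω := by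
    induction g using QuotientGroup.induction_on with
    | _ x =>
    induction h using QuotientGroup.induction_on with
    | _ y =>
    induction ω using Quotient.ind with
    | _ a =>
      change AdeleQuotient.mk K
          (FiniteAdeleRing.unitEmbedding (𝓞 K) K ((x * y : totallyPositive K) : Kˣ) • a) =
        AdeleQuotient.mk K (_ • (_ • a))
      rw [Subgroup.coe_mul, map_mul, mul_smul]

theorem AdeleQuotient.coe_smul_mk (x : totallyPositive K) (a : FiniteAdeles K) :
    (x : PrincipalGroup K) • AdeleQuotient.mk K a =
      AdeleQuotient.mk K (algebraMap K (FiniteAdeles K) ((x : Kˣ) : K) * a) := rfl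

instance : ContinuousConstSMul (PrincipalGroup K) (AdeleQuotient K) where
  continuous_const_smul g := by
    induction g using QuotientGroup.induction_on with
    | _ x =>
      refine continuous_quot_lift _ ?_
      exact continuous_quotient_mk'.comp (continuous_const_smul _)

/-- `Ô`: the ring of integral adeles, as a subset of the finite adeles. -/
def integralAdeles : Set (FiniteAdeles K) :=
  {a | ∀ v : HeightOneSpectrum (𝓞 K), a v ∈ v.adicCompletionIntegers K}

theorem residueField_finite (v : HeightOneSpectrum (𝓞 K)) :
    Finite (IsLocalRing.ResidueField (v.adicCompletionIntegers K)) := by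
  have : Finite (𝓞 K ⧸ v.asIdeal) := v.asIdeal.finiteQuotientOfFreeOfNeBot v.ne_bot
  let f : 𝓞 K →+* IsLocalRing.ResidueField (v.adicCompletionIntegers K) :=
    (IsLocalRing.residue _).comp (algebraMap (𝓞 K) (v.adicCompletionIntegers K))
  have hval : ∀ z : v.adicCompletionIntegers K, IsLocalRing.residue _ z = 0 ↔
      Valued.v (z : v.adicCompletion K) < 1 := by
    intro z
    rw [IsLocalRing.residue_eq_zero_iff]
    exact Valuation.mem_maximalIdeal_iff ..
  have hf : Function.Surjective f := by
    intro y
    obtain ⟨x, rfl⟩ := IsLocalRing.residue_surjective y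
    have hopen : IsOpen {z : v.adicCompletion K | Valued.v (z - (x : v.adicCompletion K)) < 1} := by
      have := (Valued.isOpen_ball (v.adicCompletion K) 1).preimage
        (continuous_id.sub (continuous_const (y := (x : v.adicCompletion K))))
      simpa [Valuation.restrict_lt_one_iff] using this
    obtain ⟨k, hk⟩ := (denseRange_algebraMap (R := 𝓞 K) (K := K) v).exists_mem_open hopen ⟨x, by simp⟩
    have hk' : Valued.v ((k : v.adicCompletion K) - x) < 1 := hk
    have hk1 : v.valuation K k ≤ 1 := by
      rw [← valuedAdicCompletion_eq_valuation']
      have := Valued.v.map_add ((k : v.adicCompletion K) - x) x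
      rw [sub_add_cancel] at this
      exact this.trans (max_le hk'.le x.2)
    obtain ⟨a, ha⟩ := v.exists_valuation_sub_lt_of_integer hk1 1
    refine ⟨a, ?_⟩
    change IsLocalRing.residue _ (algebraMap (𝓞 K) (v.adicCompletionIntegers K) a) = _
    rw [← sub_eq_zero, ← map_sub, hval]
    have e : ((algebraMap (𝓞 K) (v.adicCompletionIntegers K) a - x : v.adicCompletionIntegers K) :
        v.adicCompletion K) = ((algebraMap (𝓞 K) K a - k : K) : v.adicCompletion K) + (k - x) := by
      have h1 : ((algebraMap (𝓞 K) K a - k : K) : v.adicCompletion K) =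
          ((algebraMap (𝓞 K) (v.adicCompletionIntegers K) a : v.adicCompletionIntegers K) :
            v.adicCompletion K) - (k : v.adicCompletion K) :=
        map_sub (algebraMap K (v.adicCompletion K)) _ _
      rw [h1, sub_add_sub_cancel]
      rfl
    rw [e]
    refine (Valued.v.map_add _ _).trans_lt (max_lt ?_ hk')
    rw [valuedAdicCompletion_eq_valuation']
    exact ha
  exact Finite.of_surjective (Ideal.Quotient.lift v.asIdeal f (by
    intro a ha
    refine (hval _).2 ?_
    have := (v.valuation_lt_one_iff_mem (K := K) a).2 ha
    rwa [← valuedAdicCompletion_eq_valuation'] at this)) (Ideal.Quotient.lift_surjective_of_surjective _ _ hf)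

theorem adicCompletionIntegers_isCompact (v : HeightOneSpectrum (𝓞 K)) :
    IsCompact (v.adicCompletionIntegers K : Set (v.adicCompletion K)) := by
  have h := (Valued.integer.compactSpace_iff_completeSpace_and_isDiscreteValuationRing_and_finite_residueField (K := v.adicCompletion K)).2 ⟨?_, ?_, ?_⟩
  · exact isCompact_iff_compactSpace.2 h
  · exact ((Valued.isClosed_valuationSubring (v.adicCompletion K)).completeSpace_coe :)
  · exact (inferInstance : IsDiscreteValuationRing (v.adicCompletionIntegers K))
  · exact residueField_finite K v
theorem integralAdeles_isOpen : IsOpen (integralAdeles K) :=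
  RestrictedProduct.isOpen_forall_mem
    (R := fun v : HeightOneSpectrum (𝓞 K) => v.adicCompletion K)
    (A := fun v => (v.adicCompletionIntegers K : Set (v.adicCompletion K)))
    (fun _ => Valued.isOpen_valuationSubring _)

theorem integralAdeles_isCompact : IsCompact (integralAdeles K) := by
  have : ∀ v : HeightOneSpectrum (𝓞 K), CompactSpace (v.adicCompletionIntegers K) := fun v =>
    isCompact_iff_compactSpace.1 (adicCompletionIntegers_isCompact K v)
  have h := RestrictedProduct.range_structureMap
    (R := fun v : HeightOneSpectrum (𝓞 K) => v.adicCompletion K)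
    (A := fun v => (v.adicCompletionIntegers K : Set (v.adicCompletion K))) (𝓕 := Filter.cofinite)
  have h2 := isCompact_range (RestrictedProduct.isEmbedding_structureMap
    (R := fun v : HeightOneSpectrum (𝓞 K) => v.adicCompletion K)
    (A := fun v => (v.adicCompletionIntegers K : Set (v.adicCompletion K)))
    (𝓕 := Filter.cofinite)).continuous
  rw [h] at h2
  exact h2

/-- The image of `Ô` in the adele quotient. -/
def integralQuotient : Set (AdeleQuotient K) := AdeleQuotient.mk K '' integralAdeles K

theorem unitsClosure_smul_mem {h : (FiniteAdeles K)ˣ} (hh : h ∈ unitsClosure K)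
    {a : FiniteAdeles K} (ha : a ∈ integralAdeles K) : h • a ∈ integralAdeles K := by
  have hc : IsClosed {h : (FiniteAdeles K)ˣ | h • a ∈ integralAdeles K} :=
    (integralAdeles_isCompact K).isClosed.preimage
      (Units.continuous_val.mul continuous_const : Continuous fun h : (FiniteAdeles K)ˣ => h.1 * a)
  refine closure_minimal ?_ hc hh
  rintro _ ⟨_, ⟨x, ⟨u, hu⟩, rfl⟩, rfl⟩ v
  have hu' : (algebraMap (𝓞 K) K) (u : 𝓞 K) = ((x : Kˣ) : K) := congrArg Units.val hu
  have hx : ((((x : Kˣ) : K)) : v.adicCompletion K) ∈ v.adicCompletionIntegers K := by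
    rw [← hu']
    exact coe_algebraMap_mem (𝓞 K) K v u
  exact mul_mem hx (ha v)

theorem mk_preimage_integralQuotient :
    AdeleQuotient.mk K ⁻¹' integralQuotient K = integralAdeles K := by
  ext a
  refine ⟨?_, fun ha => ⟨a, ha, rfl⟩⟩
  rintro ⟨b, hb, hab⟩
  obtain ⟨h, rfl⟩ := (MulAction.orbitRel_apply).1 (Quotient.exact hab.symm)
  exact unitsClosure_smul_mem K h.2 hb

theorem integralQuotient_isClopen : IsClopen (integralQuotient K) := by
  have hq : Topology.IsQuotientMap (AdeleQuotient.mk K) := isQuotientMap_quot_mk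
  rw [← hq.isClopen_preimage, mk_preimage_integralQuotient]
  exact ⟨(integralAdeles_isCompact K).isClosed, integralAdeles_isOpen K⟩

theorem integralQuotient_isCompact : IsCompact (integralQuotient K) :=
  (integralAdeles_isCompact K).image continuous_quotient_mk'

/-- The characteristic function of `Ô / closure(O^*_+)`. -/
def integralIndicator : C₀(AdeleQuotient K, ℂ) where
  toFun := (integralQuotient K).indicator 1
  continuous_toFun := continuous_one.indicator fun x hx => by
    rw [(integralQuotient_isClopen K).frontier_eq] at hx
    exact hx.elim
  zero_at_infty' := by
    refine tendsto_const_nhds.congr' ?_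
    filter_upwards [(integralQuotient_isCompact K).compl_mem_cocompact] with x hx
    exact (Set.indicator_of_notMem hx _).symm

/-- The projection `1_{Ô / closure(O^*_+)}` of the crossed product (that is, `1_{…} u_e`). -/
def integralProjection : crossedProduct (AdeleQuotient K) (PrincipalGroup K) :=
  crossedMonomial (integralIndicator K) 1

theorem integralProjection_isStarProjection : IsStarProjection (integralProjection K) := by
  have h1 : integralIndicator K * integralIndicator K = integralIndicator K := by
    ext x
    by_cases hx : x ∈ integralQuotient K <;> simp [integralIndicator, hx]
  have h2 : star (integralIndicator K) = integralIndicator K := by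
    ext x
    by_cases hx : x ∈ integralQuotient K <;> simp [integralIndicator, hx]
  refine ⟨Subtype.ext (Subtype.ext (funext fun ρ => ?_)),
    Subtype.ext (Subtype.ext (funext fun ρ => ?_))⟩
  · change (ρ.π (integralIndicator K) * (ρ.U 1 : ρ.H →L[ℂ] ρ.H)) *
      (ρ.π (integralIndicator K) * (ρ.U 1 : ρ.H →L[ℂ] ρ.H)) =
        ρ.π (integralIndicator K) * (ρ.U 1 : ρ.H →L[ℂ] ρ.H)
    rw [map_one, OneMemClass.coe_one, mul_one, ← map_mul, h1]
  · change star (ρ.π (integralIndicator K) * (ρ.U 1 : ρ.H →L[ℂ] ρ.H)) =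
        ρ.π (integralIndicator K) * (ρ.U 1 : ρ.H →L[ℂ] ρ.H)
    rw [map_one, OneMemClass.coe_one, mul_one, ← map_star, h2]

/-- The corner of the crossed product. -/
def adelicCorner :
    NonUnitalStarSubalgebra ℂ (crossedProduct (AdeleQuotient K) (PrincipalGroup K)) :=
  corner (integralProjection K) (integralProjection_isStarProjection K)

/-- The action `σ` of `ℝ` on the crossed product: the action determined by
`σ_t(f u_x) = N_K(x)^{it} f u_x`. -/
structure IsNormDynamics
    (σ : ℝ → (crossedProduct (AdeleQuotient K) (PrincipalGroup K) ≃⋆ₐ[ℂ]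
      crossedProduct (AdeleQuotient K) (PrincipalGroup K))) : Prop where
  isRealAction : IsRealAction σ
  apply_monomial : ∀ (t : ℝ) (f : C₀(AdeleQuotient K, ℂ)) (x : totallyPositive K),
    σ t (crossedMonomial f (x : PrincipalGroup K)) =
      ((absoluteNorm K (x : Kˣ) : ℂ) ^ (Complex.I * t)) •
        crossedMonomial f (x : PrincipalGroup K)

end Arithmetic

end HeckeBC

end

/-!
Write `Γ = P_O^+`, `G = P_K^+` and `X = 𝔸_f / closure(O^*_+)`. The isomorphism sends the operator of
a double coset `[g]`, `g = (1, y; 0, x)`, to an explicit element `heckeElement ψ g = F_g u_x` of the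
corner `pAp`. Here `ψ` is a character of the finite adeles for which `Ô` is its own annihilator
(`exists_adelic_character`); it identifies `𝔸_f` with its dual. The right coset of `(1, y; 0, x)`
gives the function `w ↦ ψ(-y w) 1[x w ∈ Ô]` on `𝔸_f`, the sum of these functions over the right
cosets in `Γ g Γ` is invariant under `O^*_+` and supported in `Ô`, and `F_g` is this sum, translated
by `x` and multiplied by `N_K(x)^{-1/2}`. An involution of the summation index shows that the sums
for `g` and `g⁻¹` are related by `heckeSum_inv`, which says at once that `star` corresponds to
`g ↦ g⁻¹` and that `Δ(g) = N_K(x)⁻¹`, so that `τ` corresponds to `σ`.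

For an adele `w`, the functions of right cosets also define a map from the finitely supported vectors
on `Γ \ G` to `ℓ²(K^*_+ / O^*_+)`, on which the crossed product acts through the orbit of `w`; this
map intertwines `[g]` with `heckeElement ψ g` (`orbitEval_heckeElement_cosetVector`). No relation
between double cosets has to be computed: if a `*`-polynomial in the `[g]` and the same
`*`-polynomial in the `heckeElement ψ g` are intertwined in this way, then orthogonality of
characters on `Ô` shows that the vector state of `δ_Γ` and the state
`a ↦ ∫_Ô E(a)` of the crossed product agree on them (`Intertwined.cosetState_eq`), where `E` is the
conditional expectation onto `C₀(X)`.

Both states are faithful: the vector `δ_Γ` is separating because the Hecke operators commute with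
right translations (`eq_zero_of_apply_delta_one`), and `E` is faithful on the full crossed product
because it is the average of the dual action over the compact group of characters of
`K^*_+ / O^*_+` (`eq_zero_of_diagCoeff_star_mul_self`). A faithful state determines the norm of
`star a * a` through its values on the powers of this element (`norm_le_norm_of_functional_eq`), so
the correspondence is isometric and extends to the closures
(`exists_starAlgEquiv_of_isometric_correspondence`).

It remains to see that the elements `heckeElement ψ g` generate the corner
(`adelicCorner_le_heckeClosure`). Diagonal matrices give multiples of `p u_x p`. For the functions on
`Ô / closure(O^*_+)`, the characters `ψ(-y w)` with `y ∈ K` separate the points of `Ô`, so by the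
Stone-Weierstrass theorem an invariant continuous function is approximated by trigonometric
polynomials; averaging these over a finite quotient of `O^*_+` turns each character `ψ(-y w)` into a
multiple of the function of the double coset of `(1, y; 0, 1)`.
-/

noncomputable section

namespace HeckeBC

universe u

set_option linter.unusedSectionVars false

/-! ### Comparison of norms through faithful functionals -/

section FaithfulFunctional

open scoped ComplexOrder

variable {B : Type*} [NonUnitalCStarAlgebra B]

theorem iterate_sq_eq_cfcₙ {a : B} (ha : IsSelfAdjoint a) (k : ℕ) :
    (fun x : B => x * x)^[k] a = cfcₙ (fun t : ℝ => t ^ 2 ^ k) a := by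
  induction k with
  | zero => simp [cfcₙ_id' ℝ a]
  | succ k ih =>
    rw [Function.iterate_succ_apply', ih, ← cfcₙ_mul _ _ a]
    congr 1
    ext t
    ring

theorem norm_iterate_sq_le (a : B) (k : ℕ) : ‖(fun x : B => x * x)^[k] a‖ ≤ ‖a‖ ^ 2 ^ k := by
  induction k with
  | zero => simp
  | succ k ih =>
    rw [Function.iterate_succ_apply', pow_succ, pow_mul, sq]
    exact (norm_mul_le _ _).trans (mul_le_mul ih ih (norm_nonneg _) (by positivity))

theorem functional_cfcₙ_nonneg {ω : B →ₗ[ℂ] ℂ} (hpos : ∀ b, 0 ≤ ω (star b * b)) (a : B)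
    {f : ℝ → ℝ} (hf : Continuous f) (hf0 : f 0 = 0)
    (h : ∀ t ∈ quasispectrum ℝ a, 0 ≤ f t) :
    cfcₙ f a = star (cfcₙ (fun t => √(f t)) a) * cfcₙ (fun t => √(f t)) a ∧ 0 ≤ ω (cfcₙ f a) := by
  have e : cfcₙ f a = star (cfcₙ (fun t => √(f t)) a) * cfcₙ (fun t => √(f t)) a := by
    rw [← cfcₙ_star, ← cfcₙ_mul _ _ a (by fun_prop) (by simp [hf0]) (by fun_prop) (by simp [hf0])]
    refine cfcₙ_congr fun t ht => ?_
    simp [Real.mul_self_sqrt (h t ht)]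
  exact ⟨e, e ▸ hpos _⟩

/-- A faithful positive functional detects the norm of a positive element `a` through the growth of
its values on the powers `a ^ 2 ^ k`: if they are bounded by `C r ^ 2 ^ k`, then every function
`max (t - s) 0` with `s > r` vanishes on the spectrum of `a`. -/
theorem norm_star_mul_self_le_of_functional_le {ω : B →ₗ[ℂ] ℂ} (hpos : ∀ b, 0 ≤ ω (star b * b))
    (hfaith : ∀ b, ω (star b * b) = 0 → b = 0) (b : B) {C r : ℝ} (hr : 0 ≤ r)
    (hC : ∀ k : ℕ, ‖ω ((fun x : B => x * x)^[k] (star b * b))‖ ≤ C * r ^ 2 ^ k) :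
    ‖star b * b‖ ≤ r := by
  let _ := CStarAlgebra.spectralOrder B
  have _ := CStarAlgebra.spectralOrderedRing B
  have ha : IsSelfAdjoint (star b * b) := IsSelfAdjoint.star_mul_self b
  have ha0 : 0 ≤ star b * b := star_mul_self_nonneg b
  generalize star b * b = a at ha ha0 hC ⊢
  have hσ : ∀ t ∈ quasispectrum ℝ a, 0 ≤ t := fun t ht => quasispectrum_nonneg_of_nonneg a ha0 t ht
  have hσ' : ∀ t ∈ quasispectrum ℝ a, t ≤ ‖a‖ := fun t ht => by
    have := norm_apply_le_norm_cfcₙ (fun t : ℝ => t) a ht continuousOn_id rfl ha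
    rw [cfcₙ_id' ℝ a] at this
    exact (le_abs_self t).trans this
  refine le_of_forall_gt_imp_ge_of_dense fun s hs => ?_
  have hs0 : 0 < s := hr.trans_lt hs
  set f : ℝ → ℝ := fun t => max (t - s) 0 with hfdef
  have hfc : Continuous f := by fun_prop
  have hf0 : f 0 = 0 := by simp [hfdef, hs0.le]
  obtain ⟨hfe, hfpos⟩ := functional_cfcₙ_nonneg hpos a hfc hf0 (fun t _ => le_max_right _ _)
  -- comparison of `f` with the monomial `‖a‖ (t / s) ^ N` on the spectrum
  have hle : ∀ k : ℕ, ‖ω (cfcₙ f a)‖ ≤ ‖a‖ * C * (r / s) ^ 2 ^ k := by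
    intro k
    have hg := (functional_cfcₙ_nonneg hpos a (f := fun t => (‖a‖ / s ^ 2 ^ k) * t ^ 2 ^ k - f t)
      (by fun_prop) (by simp [hf0]) (fun t ht => by
        have h1 := hσ t ht
        have h2 := hσ' t ht
        rw [div_mul_eq_mul_div, mul_div_assoc, ← div_pow, sub_nonneg]
        refine max_le ?_ (by positivity)
        rcases le_total t s with h | h
        · exact (sub_nonpos.2 h).trans (by positivity)
        · have : 1 ≤ (t / s) ^ 2 ^ k := one_le_pow₀ ((one_le_div hs0).2 h)
          nlinarith [norm_nonneg a])).2
    rw [cfcₙ_sub _ _ a (by fun_prop) (by simp) (by fun_prop) hf0,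
      cfcₙ_const_mul _ _ a (by fun_prop) (by simp), ← iterate_sq_eq_cfcₙ ha, map_sub,
      sub_nonneg] at hg
    have hg' : ω ((‖a‖ / s ^ 2 ^ k) • (fun x : B => x * x)^[k] a) =
        ((‖a‖ / s ^ 2 ^ k : ℝ) : ℂ) * ω ((fun x : B => x * x)^[k] a) := by
      rw [← smul_eq_mul, ← map_smul]
      congr 1
    rw [hg'] at hg
    have hn : ‖ω (cfcₙ f a)‖ ≤
        ‖((‖a‖ / s ^ 2 ^ k : ℝ) : ℂ) * ω ((fun x : B => x * x)^[k] a)‖ :=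
      CStarAlgebra.norm_le_norm_of_nonneg_of_le hfpos hg
    refine hn.trans ?_
    rw [norm_mul, Complex.norm_real, Real.norm_of_nonneg (by positivity)]
    refine (mul_le_mul_of_nonneg_left (hC k) (by positivity)).trans (le_of_eq ?_)
    rw [div_pow]
    ring
  have hlim : Filter.Tendsto (fun k : ℕ => ‖a‖ * C * (r / s) ^ 2 ^ k) Filter.atTop (nhds 0) := by
    have h1 : Filter.Tendsto (fun n : ℕ => (r / s) ^ n) Filter.atTop (nhds 0) :=
      tendsto_pow_atTop_nhds_zero_of_lt_one (by positivity) ((div_lt_one hs0).2 hs)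
    have h2 := h1.comp (tendsto_pow_atTop_atTop_of_one_lt (one_lt_two (α := ℕ)))
    simpa using h2.const_mul (‖a‖ * C)
  have hz : ω (cfcₙ f a) = 0 :=
    norm_le_zero_iff.1 (ge_of_tendsto' hlim hle)
  have hz' : cfcₙ f a = 0 := by
    rw [hfe] at hz
    rw [hfe, hfaith _ hz, mul_zero]
  have hfin : ∀ t ∈ quasispectrum ℝ a, ‖t‖ ≤ s := fun t ht => by
    have := norm_apply_le_norm_cfcₙ f a ht hfc.continuousOn hf0 ha
    rw [hz', norm_zero] at this
    have h3 : t - s ≤ f t := le_max_left _ _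
    have h4 := (le_abs_self (f t)).trans this
    rw [Real.norm_of_nonneg (hσ t ht)]
    linarith
  have := norm_cfcₙ_le (f := fun t : ℝ => t) (a := a) hfin
  rwa [cfcₙ_id' ℝ a] at this

/-- If a bounded functional on `B₁` and a faithful positive functional on `B₂` agree on the powers of
`star T * T` and `star a * a`, then `‖a‖ ≤ ‖T‖`. The functional on `B₁` need not be positive. -/
theorem norm_le_norm_of_functional_eq {B₁ B₂ : Type*} [NonUnitalCStarAlgebra B₁] [NonUnitalCStarAlgebra B₂]
    {ω₁ : B₁ →ₗ[ℂ] ℂ} {ω₂ : B₂ →ₗ[ℂ] ℂ} {C : ℝ} (hC : ∀ b, ‖ω₁ b‖ ≤ C * ‖b‖)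
    (hpos : ∀ b, 0 ≤ ω₂ (star b * b)) (hfaith : ∀ b, ω₂ (star b * b) = 0 → b = 0) {T : B₁} {a : B₂}
    (h : ∀ k : ℕ, ω₁ ((fun x : B₁ => x * x)^[k] (star T * T)) =
      ω₂ ((fun x : B₂ => x * x)^[k] (star a * a))) : ‖a‖ ≤ ‖T‖ := by
  have := norm_star_mul_self_le_of_functional_le hpos hfaith a (C := max C 0) (r := ‖star T * T‖)
    (norm_nonneg _) (fun k => by
      rw [← h]
      exact (hC _).trans (mul_le_mul (le_max_left _ _) (norm_iterate_sq_le _ _) (norm_nonneg _)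
        (le_max_right _ _)))
  rw [CStarRing.norm_star_mul_self, CStarRing.norm_star_mul_self] at this
  exact le_of_sq_le_sq (by simpa [sq] using this) (norm_nonneg _)

end FaithfulFunctional

/-! ### Isometric correspondences -/

section ClosureOfCorrespondence

variable {E₁ E₂ : Type*} [NonUnitalNormedRing E₁] [StarRing E₁] [NormedSpace ℂ E₁] [CStarRing E₁]
  [CompleteSpace E₁] [NonUnitalNormedRing E₂] [StarRing E₂] [NormedSpace ℂ E₂] [CStarRing E₂]
  [CompleteSpace E₂]

/-- An isometric correspondence between dense `*`-subalgebras extends to an isomorphism of their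
closures. -/
theorem exists_starAlgEquiv_of_isometric_correspondence
    (D : NonUnitalStarSubalgebra ℂ (E₁ × E₂)) (hD : ∀ x ∈ D, ‖x.1‖ = ‖x.2‖)
    (B₁ : NonUnitalStarSubalgebra ℂ E₁) (B₂ : NonUnitalStarSubalgebra ℂ E₂)
    (hB₁ : (B₁ : Set E₁) = closure (Prod.fst '' (D : Set (E₁ × E₂))))
    (hB₂ : (B₂ : Set E₂) = closure (Prod.snd '' (D : Set (E₁ × E₂)))) :
    ∃ φ : B₁ ≃⋆ₐ[ℂ] B₂, (∀ b : B₁, ‖φ b‖ = ‖b‖) ∧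
      ∀ x ∈ D, ∀ b : B₁, (b : E₁) = x.1 → (φ b : E₂) = x.2 := by
  set G := D.topologicalClosure with hG
  have hGn : ∀ x ∈ G, ‖x.1‖ = ‖x.2‖ := fun x hx =>
    closure_minimal (t := {x : E₁ × E₂ | ‖x.1‖ = ‖x.2‖}) hD
      (isClosed_eq (by fun_prop) (by fun_prop)) hx
  have hGc : IsClosed (G : Set (E₁ × E₂)) := NonUnitalStarSubalgebra.isClosed_topologicalClosure _
  have hcomplete : CompleteSpace G := hGc.completeSpace_coe
  have hle : ∀ x ∈ D, x ∈ G := fun x hx => NonUnitalStarSubalgebra.le_topologicalClosure _ hx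
  let f₁ : G →⋆ₙₐ[ℂ] E₁ :=
    (NonUnitalStarAlgHom.fst ℂ E₁ E₂).comp (NonUnitalStarSubalgebraClass.subtype G)
  let f₂ : G →⋆ₙₐ[ℂ] E₂ :=
    (NonUnitalStarAlgHom.snd ℂ E₁ E₂).comp (NonUnitalStarSubalgebraClass.subtype G)
  have h₁ : ∀ x : G, ‖f₁ x‖ = ‖x‖ := fun x => by
    change ‖x.1.1‖ = max ‖x.1.1‖ ‖x.1.2‖
    rw [← hGn x.1 x.2, max_self]
  have h₂ : ∀ x : G, ‖f₂ x‖ = ‖x‖ := fun x => by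
    change ‖x.1.2‖ = max ‖x.1.1‖ ‖x.1.2‖
    rw [← hGn x.1 x.2, max_self]
  have i₁ : Isometry f₁ := AddMonoidHomClass.isometry_of_norm f₁ h₁
  have i₂ : Isometry f₂ := AddMonoidHomClass.isometry_of_norm f₂ h₂
  have r₁ : Set.range f₁ = B₁ := by
    refine Set.Subset.antisymm ?_ ?_
    · rintro _ ⟨x, rfl⟩
      rw [hB₁]
      exact map_mem_closure continuous_fst (s := (D : Set (E₁ × E₂))) x.2
        (fun y hy => ⟨y, hy, rfl⟩)
    · rw [hB₁]
      refine closure_minimal ?_ i₁.isClosedEmbedding.isClosed_range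
      rintro _ ⟨x, hx, rfl⟩
      exact ⟨⟨x, hle x hx⟩, rfl⟩
  have r₂ : Set.range f₂ = B₂ := by
    refine Set.Subset.antisymm ?_ ?_
    · rintro _ ⟨x, rfl⟩
      rw [hB₂]
      exact map_mem_closure continuous_snd (s := (D : Set (E₁ × E₂))) x.2
        (fun y hy => ⟨y, hy, rfl⟩)
    · rw [hB₂]
      refine closure_minimal ?_ i₂.isClosedEmbedding.isClosed_range
      rintro _ ⟨x, hx, rfl⟩
      exact ⟨⟨x, hle x hx⟩, rfl⟩
  let g₁ : G →⋆ₙₐ[ℂ] B₁ := NonUnitalStarAlgHom.codRestrict f₁ B₁ fun x => by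
    rw [← SetLike.mem_coe, ← r₁]; exact ⟨x, rfl⟩
  let g₂ : G →⋆ₙₐ[ℂ] B₂ := NonUnitalStarAlgHom.codRestrict f₂ B₂ fun x => by
    rw [← SetLike.mem_coe, ← r₂]; exact ⟨x, rfl⟩
  have bij₁ : Function.Bijective g₁ := by
    refine ⟨fun x y hxy => i₁.injective (congrArg Subtype.val hxy), fun b => ?_⟩
    obtain ⟨x, hx⟩ : (b : E₁) ∈ Set.range f₁ := r₁ ▸ b.2
    exact ⟨x, Subtype.ext hx⟩
  have bij₂ : Function.Bijective g₂ := by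
    refine ⟨fun x y hxy => i₂.injective (congrArg Subtype.val hxy), fun b => ?_⟩
    obtain ⟨x, hx⟩ : (b : E₂) ∈ Set.range f₂ := r₂ ▸ b.2
    exact ⟨x, Subtype.ext hx⟩
  let e₁ := StarAlgEquiv.ofBijective g₁ bij₁
  let e₂ := StarAlgEquiv.ofBijective g₂ bij₂
  have he : ∀ x : G, (e₁.symm.trans e₂) (g₁ x) = g₂ x := fun x =>
    congrArg e₂ (e₁.symm_apply_apply x)
  refine ⟨e₁.symm.trans e₂, fun b => ?_, fun x hx b hb => ?_⟩
  · obtain ⟨x, rfl⟩ := bij₁.surjective b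
    rw [he]
    exact (h₂ x).trans (h₁ x).symm
  · obtain rfl : b = g₁ ⟨x, hle x hx⟩ := Subtype.ext hb
    rw [he]
    rfl

end ClosureOfCorrespondence

/-! ### Operators with finitely many entries in each row and column -/

section KernelOperator

variable {α : Type*}

open Classical in
/-- The basis vector `δ_a` of `ℓ²(α)`. -/
def delta (a : α) : lp (fun _ : α => ℂ) 2 := lp.single 2 a 1

open Classical in
theorem delta_apply (a b : α) : delta a b = if b = a then 1 else 0 := by
  simp [delta, Pi.single_apply]

@[simp]
theorem delta_apply_self (a : α) : delta a a = 1 := by simp [delta_apply]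

theorem delta_apply_ne {a b : α} (h : b ≠ a) : delta a b = 0 := by simp [delta_apply, h]

theorem inner_delta_left (a : α) (ξ : lp (fun _ : α => ℂ) 2) : inner ℂ (delta a) ξ = ξ a := by
  classical
  rw [delta, lp.inner_single_left]
  simp

theorem norm_delta (a : α) : ‖delta a‖ = 1 := by
  classical
  rw [delta, lp.norm_single (by norm_num)]
  simp

theorem hasSum_smul_delta (ξ : lp (fun _ : α => ℂ) 2) : HasSum (fun a => ξ a • delta a) ξ := by
  classical
  have := lp.hasSum_single (p := 2) (by norm_num) ξ
  convert! this using 2 with a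
  rw [delta, ← lp.single_smul, smul_eq_mul, mul_one]

theorem clm_ext_delta {H : Type*} [NormedAddCommGroup H] [NormedSpace ℂ H]
    {S T : lp (fun _ : α => ℂ) 2 →L[ℂ] H} (h : ∀ a, S (delta a) = T (delta a)) : S = T := by
  ext ξ
  have hS := (hasSum_smul_delta ξ).mapL S
  have hT := (hasSum_smul_delta ξ).mapL T
  simp only [map_smul, h] at hS hT
  exact hS.unique hT

/-- An operator on `ℓ²(α)` is the adjoint of another one as soon as the matrices are adjoint. -/
theorem star_eq_of_matrix {S T : lp (fun _ : α => ℂ) 2 →L[ℂ] lp (fun _ : α => ℂ) 2}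
    (h : ∀ a b, S (delta a) b = star (T (delta b) a)) : star T = S := by
  refine clm_ext_delta fun a => lp.ext (funext fun b => ?_)
  rw [h, ← inner_delta_left, ContinuousLinearMap.star_eq_adjoint,
    ContinuousLinearMap.adjoint_inner_right, ← inner_conj_symm, inner_delta_left]
  rfl

variable (k : α → Finset α) (m : α → α → ℂ) {M : ℝ} {R R' : ℕ}

/-- Schur's test for a kernel with boundedly many entries in each row and each column. -/
theorem sum_norm_sq_kernel_le (hm : ∀ a b, ‖m a b‖ ≤ M) (hR : ∀ a, (k a).card ≤ R)
    (hR' : ∀ (b : α) (s : Finset α), (∀ a ∈ s, b ∈ k a) → s.card ≤ R')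
    (ξ : lp (fun _ : α => ℂ) 2) (s : Finset α) :
    ∑ a ∈ s, ‖∑ b ∈ k a, m a b * ξ b‖ ^ 2 ≤ M ^ 2 * R * R' * ‖ξ‖ ^ 2 := by
  classical
  have h1 : ∀ a ∈ s, ‖∑ b ∈ k a, m a b * ξ b‖ ^ 2 ≤ M ^ 2 * R * ∑ b ∈ k a, ‖ξ b‖ ^ 2 := by
    intro a _
    have hsum : 0 ≤ ∑ b ∈ k a, ‖ξ b‖ ^ 2 := Finset.sum_nonneg fun _ _ => by positivity
    calc ‖∑ b ∈ k a, m a b * ξ b‖ ^ 2 ≤ (∑ b ∈ k a, M * ‖ξ b‖) ^ 2 := by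
          gcongr
          refine (norm_sum_le _ _).trans (Finset.sum_le_sum fun b _ => ?_)
          rw [norm_mul]
          gcongr
          exact hm a b
      _ = M ^ 2 * (∑ b ∈ k a, ‖ξ b‖) ^ 2 := by rw [← Finset.mul_sum, mul_pow]
      _ ≤ M ^ 2 * ((k a).card * ∑ b ∈ k a, ‖ξ b‖ ^ 2) := by
          gcongr
          exact sq_sum_le_card_mul_sum_sq
      _ ≤ M ^ 2 * (R * ∑ b ∈ k a, ‖ξ b‖ ^ 2) := by
          gcongr
          exact_mod_cast hR a
      _ = _ := by ring
  refine (Finset.sum_le_sum h1).trans ?_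
  rw [← Finset.mul_sum, mul_assoc (M ^ 2 * R)]
  refine mul_le_mul_of_nonneg_left ?_ (by positivity)
  set t : Finset α := s.biUnion k with ht
  calc ∑ a ∈ s, ∑ b ∈ k a, ‖ξ b‖ ^ 2 = ∑ a ∈ s, ∑ b ∈ t, if b ∈ k a then ‖ξ b‖ ^ 2 else 0 := by
        refine Finset.sum_congr rfl fun a ha => ?_
        rw [← Finset.sum_filter]
        refine Finset.sum_congr ?_ fun _ _ => rfl
        ext b
        simp only [ht, Finset.mem_filter, Finset.mem_biUnion]
        exact ⟨fun hb => ⟨⟨a, ha, hb⟩, hb⟩, fun hb => hb.2⟩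
    _ = ∑ b ∈ t, ((s.filter fun a => b ∈ k a).card : ℝ) * ‖ξ b‖ ^ 2 := by
        rw [Finset.sum_comm]
        refine Finset.sum_congr rfl fun b _ => ?_
        rw [← Finset.sum_filter, Finset.sum_const, nsmul_eq_mul]
    _ ≤ ∑ b ∈ t, (R' : ℝ) * ‖ξ b‖ ^ 2 := by
        refine Finset.sum_le_sum fun b _ => ?_
        gcongr
        exact hR' b _ fun a ha => (Finset.mem_filter.1 ha).2
    _ ≤ R' * ‖ξ‖ ^ 2 := by
        rw [← Finset.mul_sum]
        gcongr
        have := lp.sum_rpow_le_norm_rpow (p := 2) (by norm_num) ξ t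
        simpa using this

/-- The operator `(Tξ)(a) = ∑_{b ∈ k a} m(a, b) ξ(b)` on `ℓ²(α)`, where `k a` is the support of the
`a`-th row of the matrix `m`. -/
def kernelOp (hm : ∀ a b, ‖m a b‖ ≤ M) (hR : ∀ a, (k a).card ≤ R)
    (hR' : ∀ (b : α) (s : Finset α), (∀ a ∈ s, b ∈ k a) → s.card ≤ R') :
    lp (fun _ : α => ℂ) 2 →L[ℂ] lp (fun _ : α => ℂ) 2 :=
  LinearMap.mkContinuous
    { toFun := fun ξ => ⟨fun a => ∑ b ∈ k a, m a b * ξ b, memℓp_gen' (C := M ^ 2 * R * R' * ‖ξ‖ ^ 2)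
        fun s => by simpa using sum_norm_sq_kernel_le k m hm hR hR' ξ s⟩
      map_add' := fun ξ η => by
        ext a
        simp [mul_add, Finset.sum_add_distrib]
        rfl
      map_smul' := fun c ξ => by
        ext a
        simp [Finset.mul_sum, mul_left_comm] }
    (√(M ^ 2 * R * R')) fun ξ => by
      refine lp.norm_le_of_forall_sum_le (by norm_num) (by positivity) fun s => ?_
      have := sum_norm_sq_kernel_le k m hm hR hR' ξ s
      simp only [ENNReal.toReal_ofNat, Real.rpow_ofNat]
      rw [mul_pow, Real.sq_sqrt (by positivity)]
      exact this

variable {k m} in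
theorem kernelOp_apply (hm : ∀ a b, ‖m a b‖ ≤ M) (hR : ∀ a, (k a).card ≤ R)
    (hR' : ∀ (b : α) (s : Finset α), (∀ a ∈ s, b ∈ k a) → s.card ≤ R')
    (ξ : lp (fun _ : α => ℂ) 2) (a : α) :
    kernelOp k m hm hR hR' ξ a = ∑ b ∈ k a, m a b * ξ b := rfl

end KernelOperator

/-! ### The crossed product -/

section CrossedProductAlgebra

variable {X G : Type u} [TopologicalSpace X] [Group G] [MulAction G X] [ContinuousConstSMul G X]

@[simp]
theorem translate_apply (g : G) (f : C₀(X, ℂ)) (x : X) : translate g f x = f (g⁻¹ • x) := rfl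

theorem translate_one (f : C₀(X, ℂ)) : translate (1 : G) f = f := by
  ext x; simp

namespace UniversalOperators

/-- Evaluation of a family of operators at a covariant representation. -/
def eval (ρ : CovariantRep X G) : UniversalOperators X G →⋆ₙₐ[ℂ] (ρ.H →L[ℂ] ρ.H) where
  toFun T := T.1 ρ
  map_smul' _ _ := rfl
  map_zero' := rfl
  map_add' _ _ := rfl
  map_mul' _ _ := rfl
  map_star' _ := rfl

theorem ext_eval {S T : UniversalOperators X G} (h : ∀ ρ, eval ρ S = eval ρ T) : S = T :=
  Subtype.ext (funext h)

theorem norm_eval_le (ρ : CovariantRep X G) (T : UniversalOperators X G) : ‖eval ρ T‖ ≤ ‖T‖ :=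
  lp.norm_apply_le_norm (p := ∞) (E := fun ρ : CovariantRep X G => ρ.H →L[ℂ] ρ.H) (by simp) T ρ

theorem norm_le_of_forall {T : UniversalOperators X G} {C : ℝ} (hC : 0 ≤ C)
    (h : ∀ ρ, ‖eval ρ T‖ ≤ C) : ‖T‖ ≤ C :=
  lp.norm_le_of_forall_le (E := fun ρ : CovariantRep X G => ρ.H →L[ℂ] ρ.H) hC h

end UniversalOperators

open UniversalOperators

theorem eval_monomial (ρ : CovariantRep X G) (f : C₀(X, ℂ)) (g : G) :
    eval ρ (monomial f g) = ρ.π f * (ρ.U g : ρ.H →L[ℂ] ρ.H) := rfl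

theorem monomial_add (f f' : C₀(X, ℂ)) (g : G) :
    monomial (f + f') g = monomial f g + monomial f' g :=
  ext_eval fun ρ => by simp [eval_monomial, add_mul]

theorem monomial_smul (c : ℂ) (f : C₀(X, ℂ)) (g : G) : monomial (c • f) g = c • monomial f g :=
  ext_eval fun ρ => by simp [eval_monomial]

theorem monomial_sub (f f' : C₀(X, ℂ)) (g : G) :
    monomial (f - f') g = monomial f g - monomial f' g :=
  ext_eval fun ρ => by simp [eval_monomial, sub_mul]

theorem CovariantRep.U_mul_π (ρ : CovariantRep X G) (f : C₀(X, ℂ)) (g : G) :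
    (ρ.U g : ρ.H →L[ℂ] ρ.H) * ρ.π f = ρ.π (translate g f) * (ρ.U g : ρ.H →L[ℂ] ρ.H) := by
  rw [← ρ.covariant, mul_assoc, Unitary.coe_star_mul_self, mul_one]

theorem monomial_mul (f f' : C₀(X, ℂ)) (g g' : G) :
    monomial f g * monomial f' g' = monomial (f * translate g f') (g * g') :=
  ext_eval fun ρ => by
    rw [map_mul, eval_monomial, eval_monomial, eval_monomial, map_mul, map_mul, mul_assoc,
      ← mul_assoc _ (ρ.π f'), ρ.U_mul_π]
    simp only [mul_assoc, Submonoid.coe_mul]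

theorem star_monomial (f : C₀(X, ℂ)) (g : G) :
    star (monomial f g) = monomial (translate g⁻¹ (star f)) g⁻¹ :=
  ext_eval fun ρ => by
    rw [map_star, eval_monomial, eval_monomial, star_mul, ← map_star, ← ρ.U_mul_π, map_inv]
    rfl

theorem norm_monomial_le (f : C₀(X, ℂ)) (g : G) : ‖monomial f g‖ ≤ ‖f‖ :=
  norm_le_of_forall (norm_nonneg _) fun ρ => by
    rw [eval_monomial, CStarRing.norm_mul_coe_unitary]
    exact NonUnitalStarAlgHom.norm_apply_le ρ.π f

theorem exists_finsupp_sum_monomial {T : UniversalOperators X G}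
    (hT : T ∈ Submodule.span ℂ {T | ∃ (f : C₀(X, ℂ)) (g : G), T = monomial f g}) :
    ∃ F : G →₀ C₀(X, ℂ), T = F.sum fun g f => monomial f g := by
  classical
  induction hT using Submodule.span_induction with
  | mem T h =>
    obtain ⟨f, g, rfl⟩ := h
    exact ⟨Finsupp.single g f, by rw [Finsupp.sum_single_index (by simpa using monomial_smul 0 (0 : C₀(X, ℂ)) g)]⟩
  | zero => exact ⟨0, by simp⟩
  | add S T _ _ hS hT =>
    obtain ⟨F, rfl⟩ := hS
    obtain ⟨F', rfl⟩ := hT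
    exact ⟨F + F', by
      rw [Finsupp.sum_add_index (by intro g _; simpa using monomial_smul 0 (0 : C₀(X, ℂ)) g)
        (by intro g _ f f'; exact monomial_add f f' g)]⟩
  | smul c T _ hT =>
    obtain ⟨F, rfl⟩ := hT
    refine ⟨c • F, ?_⟩
    rw [Finsupp.sum_smul_index' (by intro g; simpa using monomial_smul 0 (0 : C₀(X, ℂ)) g),
      Finsupp.smul_sum]
    simp only [monomial_smul]

variable (X G) in
/-- The linear span of the monomials is already a `*`-algebra, hence dense in the crossed product. -/
theorem coe_crossedProduct : (crossedProduct X G : Set (UniversalOperators X G)) =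
    closure (Submodule.span ℂ {T | ∃ (f : C₀(X, ℂ)) (g : G), T = monomial f g}) := by
  let S : NonUnitalStarSubalgebra ℂ (UniversalOperators X G) :=
    { Submodule.span ℂ {T : UniversalOperators X G | ∃ (f : C₀(X, ℂ)) (g : G), T = monomial f g} with
      mul_mem' := by
        intro a b ha hb
        refine Submodule.span_induction₂ (p := fun a b _ _ => a * b ∈ Submodule.span ℂ
          {T : UniversalOperators X G | ∃ (f : C₀(X, ℂ)) (g : G), T = monomial f g})
          ?_ ?_ ?_ ?_ ?_ ?_ ?_ ha hb
        · rintro _ _ ⟨f, g, rfl⟩ ⟨f', g', rfl⟩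
          exact Submodule.subset_span ⟨_, _, monomial_mul f f' g g'⟩
        · intro y _
          simp
        · intro y _
          simp
        · intro x y z _ _ _ h1 h2
          rw [add_mul]
          exact add_mem h1 h2
        · intro x y z _ _ _ h1 h2
          rw [mul_add]
          exact add_mem h1 h2
        · intro r x y _ _ h
          rw [smul_mul_assoc]
          exact Submodule.smul_mem _ _ h
        · intro r x y _ _ h
          rw [mul_smul_comm]
          exact Submodule.smul_mem _ _ h
      star_mem' := by
        intro a ha
        change star a ∈ Submodule.span ℂ _
        refine Submodule.span_induction (p := fun a _ => star a ∈ Submodule.span ℂ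
          {T : UniversalOperators X G | ∃ (f : C₀(X, ℂ)) (g : G), T = monomial f g}) ?_ ?_ ?_ ?_ ha
        · rintro _ ⟨f, g, rfl⟩
          exact Submodule.subset_span ⟨_, _, star_monomial f g⟩
        · simp
        · intro x y _ _ hx hy
          rw [star_add]
          exact add_mem hx hy
        · intro c x _ hx
          rw [star_smul]
          exact Submodule.smul_mem _ _ hx }
  have h : (NonUnitalStarAlgebra.adjoin ℂ
      {T : UniversalOperators X G | ∃ (f : C₀(X, ℂ)) (g : G), T = monomial f g}) = S := by
    refine le_antisymm (NonUnitalStarAlgebra.adjoin_le Submodule.subset_span) ?_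
    intro x hx
    exact Submodule.span_le (p := (NonUnitalStarAlgebra.adjoin ℂ
      {T : UniversalOperators X G | ∃ (f : C₀(X, ℂ)) (g : G), T = monomial f g}).toSubmodule).2
      (NonUnitalStarAlgebra.subset_adjoin ℂ _) hx
  rw [crossedProduct, h]
  rfl

theorem mem_crossedProduct_of_mem_span {S : UniversalOperators X G}
    (hS : S ∈ Submodule.span ℂ {T | ∃ (f : C₀(X, ℂ)) (g : G), T = monomial f g}) :
    S ∈ crossedProduct X G := by
  rw [← SetLike.mem_coe, coe_crossedProduct]
  exact subset_closure hS

variable (X G) in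
theorem isClosed_crossedProduct : IsClosed (crossedProduct X G : Set (UniversalOperators X G)) :=
  NonUnitalStarSubalgebra.isClosed_topologicalClosure _

/-! ### The dual action -/

/-- The unitary representation `χ U`. -/
def CovariantRep.twistU (ρ : CovariantRep X G) (χ : G →* Circle) : G →* unitary (ρ.H →L[ℂ] ρ.H) where
  toFun g := ⟨(χ g : ℂ) • (ρ.U g : ρ.H →L[ℂ] ρ.H), by
    have h : star (χ g : ℂ) * (χ g : ℂ) = 1 := by
      simp [← Circle.coe_inv_eq_conj]
    rw [Unitary.mem_iff, star_smul, smul_mul_smul_comm, smul_mul_smul_comm, h,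
      mul_comm (χ g : ℂ), h]
    simp⟩
  map_one' := Subtype.ext (by simp)
  map_mul' g h := Subtype.ext (by
    simp only [map_mul, Circle.coe_mul, Submonoid.coe_mul, smul_mul_smul_comm])

theorem CovariantRep.coe_twistU (ρ : CovariantRep X G) (χ : G →* Circle) (g : G) :
    (ρ.twistU χ g : ρ.H →L[ℂ] ρ.H) = (χ g : ℂ) • (ρ.U g : ρ.H →L[ℂ] ρ.H) := rfl

/-- The covariant representation `(π, χ U)`. -/
def CovariantRep.twist (ρ : CovariantRep X G) (χ : G →* Circle) : CovariantRep X G where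
  H := ρ.H
  π := ρ.π
  U := ρ.twistU χ
  covariant g f := by
    have h : (χ g : ℂ) * star (χ g : ℂ) = 1 := by
      simp [← Circle.coe_inv_eq_conj]
    rw [ρ.coe_twistU, star_smul, smul_mul_assoc, smul_mul_smul_comm, h, one_smul, ρ.covariant]

theorem CovariantRep.twistU_one (ρ : CovariantRep X G) : ρ.twistU 1 = ρ.U := by
  ext g : 2
  simp [coe_twistU]

theorem CovariantRep.twistU_mul (ρ : CovariantRep X G) (χ χ' : G →* Circle) :
    ((ρ.twist χ).twistU χ' : G →* unitary (ρ.H →L[ℂ] ρ.H)) = ρ.twistU (χ * χ') :=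
  MonoidHom.ext fun g => Subtype.ext <| by
    change (χ' g : ℂ) • ((χ g : ℂ) • (ρ.U g : ρ.H →L[ℂ] ρ.H)) =
      (((χ * χ') g : Circle) : ℂ) • (ρ.U g : ρ.H →L[ℂ] ρ.H)
    rw [MonoidHom.mul_apply, Circle.coe_mul, mul_comm, mul_smul]

/-- A family of operators takes the same value at two covariant representations that differ only
by a propositional equality of their unitary parts. -/
theorem UniversalOperators.apply_congr_U (T : UniversalOperators X G) (ρ : CovariantRep X G)
    {U U' : G →* unitary (ρ.H →L[ℂ] ρ.H)} (h : U = U') (hU hU') :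
    (T.1 { H := ρ.H, π := ρ.π, U := U, covariant := hU } : ρ.H →L[ℂ] ρ.H) =
      T.1 { H := ρ.H, π := ρ.π, U := U', covariant := hU' } := by
  subst h
  rfl

/-- The dual automorphism `f u_g ↦ χ(g) f u_g`, obtained by permuting the covariant
representations. -/
def dualHom (χ : G →* Circle) : UniversalOperators X G →⋆ₙₐ[ℂ] UniversalOperators X G where
  toFun T := ⟨fun ρ => eval (ρ.twist χ) T, memℓp_infty ⟨‖T‖, by
    rintro _ ⟨ρ, rfl⟩
    exact norm_eval_le (ρ.twist χ) T⟩⟩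
  map_smul' _ _ := rfl
  map_zero' := rfl
  map_add' _ _ := rfl
  map_mul' _ _ := rfl
  map_star' _ := rfl

theorem eval_dualHom (ρ : CovariantRep X G) (χ : G →* Circle) (T : UniversalOperators X G) :
    eval ρ (dualHom χ T) = eval (ρ.twist χ) T := rfl

theorem norm_dualHom_le (χ : G →* Circle) (T : UniversalOperators X G) : ‖dualHom χ T‖ ≤ ‖T‖ :=
  norm_le_of_forall (norm_nonneg _) fun ρ => norm_eval_le (ρ.twist χ) T

theorem dualHom_monomial (χ : G →* Circle) (f : C₀(X, ℂ)) (g : G) :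
    dualHom χ (monomial f g) = (χ g : ℂ) • monomial f g :=
  ext_eval fun ρ => by
    rw [eval_dualHom, map_smul, eval_monomial, eval_monomial]
    exact mul_smul_comm (χ g : ℂ) (ρ.π f) (ρ.U g : ρ.H →L[ℂ] ρ.H)

theorem dualHom_one (T : UniversalOperators X G) : dualHom 1 T = T :=
  Subtype.ext (funext fun ρ => by
    exact apply_congr_U T ρ ρ.twistU_one _ _)

theorem dualHom_dualHom (χ χ' : G →* Circle) (T : UniversalOperators X G) :
    dualHom χ (dualHom χ' T) = dualHom (χ * χ') T :=
  Subtype.ext (funext fun ρ => by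
    exact apply_congr_U T ρ (ρ.twistU_mul χ χ') _ _)

theorem dualHom_mem (χ : G →* Circle) {T : UniversalOperators X G} (hT : T ∈ crossedProduct X G) :
    dualHom χ T ∈ crossedProduct X G := by
  have hc : Continuous (dualHom χ : UniversalOperators X G → UniversalOperators X G) :=
    AddMonoidHomClass.continuous_of_bound (dualHom χ) 1 fun T => by
      simpa using norm_dualHom_le χ T
  rw [← SetLike.mem_coe, coe_crossedProduct] at hT ⊢
  refine map_mem_closure hc hT fun S hS => ?_
  refine Submodule.span_induction (p := fun S _ => dualHom χ S ∈ Submodule.span ℂ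
    {T : UniversalOperators X G | ∃ (f : C₀(X, ℂ)) (g : G), T = monomial f g}) ?_ ?_ ?_ ?_ hS
  · rintro _ ⟨f, g, rfl⟩
    rw [dualHom_monomial]
    exact Submodule.smul_mem _ _ (Submodule.subset_span ⟨f, g, rfl⟩)
  · simp
  · intro x y _ _ hx hy
    rw [map_add]
    exact add_mem hx hy
  · intro c x _ hx
    rw [map_smul]
    exact Submodule.smul_mem _ _ hx

/-- The dual action of the characters of `G` on the crossed product. -/
def dualAction (χ : G →* Circle) : crossedProduct X G ≃⋆ₐ[ℂ] crossedProduct X G where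
  toFun T := ⟨dualHom χ T.1, dualHom_mem χ T.2⟩
  invFun T := ⟨dualHom χ⁻¹ T.1, dualHom_mem χ⁻¹ T.2⟩
  left_inv T := Subtype.ext (by simp [dualHom_dualHom, dualHom_one])
  right_inv T := Subtype.ext (by simp [dualHom_dualHom, dualHom_one])
  map_mul' S T := Subtype.ext (map_mul (dualHom χ) S.1 T.1)
  map_add' S T := Subtype.ext (map_add (dualHom χ) S.1 T.1)
  map_smul' c T := Subtype.ext (map_smul (dualHom χ) c T.1)
  map_star' T := Subtype.ext (map_star (dualHom χ) T.1)

/-- Pointwise norm continuity of the dual action; it suffices to check it on the dense span of the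
monomials, because the automorphisms are contractive. -/
theorem continuous_dualHom {Λ : Type*} [TopologicalSpace Λ] {χ : Λ → G →* Circle}
    (hχ : ∀ g, Continuous fun t => χ t g) {T : UniversalOperators X G}
    (hT : T ∈ crossedProduct X G) : Continuous fun t => dualHom (χ t) T := by
  rw [← SetLike.mem_coe, coe_crossedProduct] at hT
  refine continuous_of_uniform_approx_of_continuous fun V hV => ?_
  obtain ⟨ε, hε, hV⟩ := Metric.mem_uniformity_dist.1 hV
  obtain ⟨S, hS, hST⟩ := Metric.mem_closure_iff.1 hT ε hε
  refine ⟨fun t => dualHom (χ t) S, ?_, fun t => hV ?_⟩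
  · refine Submodule.span_induction (p := fun S _ => Continuous fun t => dualHom (χ t) S)
      ?_ ?_ ?_ ?_ hS
    · rintro _ ⟨f, g, rfl⟩
      simp only [dualHom_monomial]
      exact (continuous_subtype_val.comp (hχ g)).smul continuous_const
    · simpa using continuous_const
    · intro x y _ _ hx hy
      simp only [map_add]
      exact hx.add hy
    · intro c x _ hx
      simp only [map_smul]
      exact hx.const_smul c
  · rw [dist_eq_norm, ← map_sub]
    exact (norm_dualHom_le _ _).trans_lt (by rwa [← dist_eq_norm])

theorem isRealAction_dualAction {χ : ℝ → G →* Circle} (hχ : ∀ g, Continuous fun t => χ t g)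
    (h0 : χ 0 = 1) (hadd : ∀ s t, χ (s + t) = χ s * χ t) :
    IsRealAction fun t => (dualAction (χ t) : crossedProduct X G ≃⋆ₐ[ℂ] crossedProduct X G) where
  zero a := Subtype.ext (by
    change dualHom (χ 0) a.1 = a.1
    rw [h0, dualHom_one])
  add s t a := Subtype.ext (by
    change dualHom (χ (s + t)) a.1 = dualHom (χ s) (dualHom (χ t) a.1)
    rw [dualHom_dualHom, hadd])
  continuous a := Continuous.subtype_mk (continuous_dualHom hχ a.2) _

end CrossedProductAlgebra

/-! ### Characters of a commutative discrete group -/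

section CircleCharacters

/-- The embedding of `ℚ / ℤ` into the circle. -/
def ratCircle : AddCircle (1 : ℚ) →+ Additive Circle :=
  QuotientAddGroup.lift _
    { toFun := fun q : ℚ => Additive.ofMul (Circle.exp (2 * Real.pi * q))
      map_zero' := by simp
      map_add' := fun p q => by simp [mul_add, Circle.exp_add] }
    (by
      rintro _ ⟨n, rfl⟩
      have : Circle.exp (2 * Real.pi * ((n • (1 : ℚ) : ℚ) : ℝ)) = 1 := by
        rw [Circle.exp_eq_one]
        exact ⟨n, by simp; ring⟩
      exact congrArg Additive.ofMul this)

theorem ratCircle_eq_zero {q : AddCircle (1 : ℚ)} (h : ratCircle q = 0) : q = 0 := by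
  induction q using QuotientAddGroup.induction_on with
  | H q =>
    have h' : Circle.exp (2 * Real.pi * (q : ℝ)) = 1 := congrArg Additive.toMul h
    obtain ⟨n, hn⟩ := Circle.exp_eq_one.1 h'
    rw [mul_comm (n : ℝ), mul_right_inj' (by positivity)] at hn
    exact (QuotientAddGroup.eq_zero_iff _).2 ⟨n, by
      have : (q : ℝ) = ((n : ℚ) : ℝ) := by simpa using hn
      simpa using (Rat.cast_injective this).symm⟩

/-- The characters with values in the circle separate the points of a commutative group; they are
obtained from characters with values in the injective group `ℚ / ℤ`. -/
theorem exists_circle_character_ne_one {G : Type*} [CommGroup G] {g : G} (hg : g ≠ 1) :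
    ∃ χ : G →* Circle, χ g ≠ 1 := by
  obtain ⟨c, hc⟩ := CharacterModule.exists_character_apply_ne_zero_of_ne_zero
    (A := Additive G) (a := Additive.ofMul g) hg
  refine ⟨MonoidHom.mk' (fun g => (ratCircle (c (Additive.ofMul g))).toMul) fun a b => by
    rw [ofMul_mul, map_add, map_add, toMul_add], fun h => hc ?_⟩
  exact ratCircle_eq_zero (congrArg Additive.ofMul h)

/-- The group of characters of a discrete group, as a subgroup of a product of circles. -/
def characterGroup (G : Type*) [Group G] : Subgroup (G → Circle) where
  carrier := {χ | ∀ g h, χ (g * h) = χ g * χ h}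
  one_mem' _ _ := by simp
  mul_mem' {χ χ'} h h' a b := by simp only [Pi.mul_apply, h a b, h' a b, mul_mul_mul_comm]
  inv_mem' {χ} h a b := by simp only [Pi.inv_apply, h a b, mul_inv]

variable {G : Type*} [Group G]

instance : CompactSpace (characterGroup G) := by
  refine isCompact_iff_compactSpace.1 (IsClosed.isCompact ?_)
  have : (characterGroup G : Set (G → Circle)) = ⋂ (g : G) (h : G), {χ | χ (g * h) = χ g * χ h} := by
    ext χ
    simp [characterGroup]
  rw [this]
  exact isClosed_iInter fun g => isClosed_iInter fun h => isClosed_eq (by fun_prop) (by fun_prop)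

instance : MeasurableSpace (characterGroup G) := borel _
instance : BorelSpace (characterGroup G) := ⟨rfl⟩

/-- An element of the character group as a homomorphism. -/
def characterHom (χ : characterGroup G) : G →* Circle :=
  MonoidHom.mk' χ.1 χ.2

theorem continuous_characterHom_apply (g : G) :
    Continuous fun χ : characterGroup G => characterHom χ g :=
  (_root_.continuous_apply g).comp continuous_subtype_val

/-- The normalized Haar measure on the character group. -/
def characterMeasure (G : Type*) [Group G] : MeasureTheory.Measure (characterGroup G) :=
  MeasureTheory.Measure.haarMeasure ⊤

instance : MeasureTheory.Measure.IsHaarMeasure (characterMeasure G) :=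
  inferInstanceAs (MeasureTheory.Measure.IsHaarMeasure (MeasureTheory.Measure.haarMeasure _))

instance : MeasureTheory.IsProbabilityMeasure (characterMeasure G) :=
  ⟨MeasureTheory.Measure.haarMeasure_self (K₀ := ⊤)⟩

theorem integral_character_eq_zero {G : Type*} [CommGroup G] {g : G} (hg : g ≠ 1) :
    ∫ χ : characterGroup G, (characterHom χ g : ℂ) ∂(characterMeasure G) = 0 := by
  obtain ⟨χ₀, hχ₀⟩ := exists_circle_character_ne_one hg
  let c : characterGroup G := ⟨χ₀, fun a b => map_mul χ₀ a b⟩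
  have h := MeasureTheory.integral_mul_left_eq_self (μ := characterMeasure G)
    (fun χ : characterGroup G => (characterHom χ g : ℂ)) c
  have h' : ∀ χ : characterGroup G, (characterHom (c * χ) g : ℂ) = (χ₀ g : ℂ) * (characterHom χ g : ℂ) :=
    fun χ => rfl
  simp only [h', MeasureTheory.integral_const_mul] at h
  have h1 : (χ₀ g : ℂ) ≠ 1 := fun h => hχ₀ (Subtype.ext h)
  have h2 : ((χ₀ g : ℂ) - 1) * ∫ χ : characterGroup G, (characterHom χ g : ℂ) ∂(characterMeasure G) = 0 := by
    rw [sub_mul, h, one_mul, sub_self]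
  exact (mul_eq_zero.1 h2).resolve_left (sub_ne_zero.2 h1)

end CircleCharacters

/-! ### Orbit representations and the conditional expectation -/

section OrbitRepresentation

variable {X G : Type u} [TopologicalSpace X] [Group G] [MulAction G X]

open UniversalOperators

theorem norm_apply_le_norm (f : C₀(X, ℂ)) (x : X) : ‖f x‖ ≤ ‖f‖ :=
  BoundedContinuousFunction.norm_coe_le_norm f.toBCF x

/-- Multiplication by the restriction of `f` to the orbit of `x`, on `ℓ²(G)`. -/
def orbitMul (x : X) (f : C₀(X, ℂ)) :
    lp (fun _ : G => ℂ) 2 →L[ℂ] lp (fun _ : G => ℂ) 2 :=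
  kernelOp (fun s => {s}) (fun s _ => f (s • x)) (M := ‖f‖) (R := 1) (R' := 1)
    (fun _ _ => norm_apply_le_norm f _) (fun _ => by simp)
    (fun b s h => Finset.card_le_one.2 fun a ha a' ha' => by
      rw [← Finset.mem_singleton.1 (h a ha), ← Finset.mem_singleton.1 (h a' ha')])

/-- The left regular representation of `G` on `ℓ²(G)`. -/
def leftShift (g : G) : lp (fun _ : G => ℂ) 2 →L[ℂ] lp (fun _ : G => ℂ) 2 :=
  kernelOp (fun s => {g⁻¹ * s}) (fun _ _ => 1) (M := 1) (R := 1) (R' := 1)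
    (fun _ _ => by simp) (fun _ => by simp)
    (fun b s h => Finset.card_le_one.2 fun a ha a' ha' => by
      have h1 := Finset.mem_singleton.1 (h a ha)
      have h2 := Finset.mem_singleton.1 (h a' ha')
      exact mul_left_cancel (h1.symm.trans h2))

theorem orbitMul_apply (x : X) (f : C₀(X, ℂ)) (ξ : lp (fun _ : G => ℂ) 2) (s : G) :
    orbitMul x f ξ s = f (s • x) * ξ s := by
  rw [orbitMul, kernelOp_apply, Finset.sum_singleton]

theorem leftShift_apply (g : G) (ξ : lp (fun _ : G => ℂ) 2) (s : G) :
    leftShift g ξ s = ξ (g⁻¹ * s) := by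
  rw [leftShift, kernelOp_apply, Finset.sum_singleton, one_mul]

theorem leftShift_mul (g h : G) : leftShift (g * h) = leftShift g * leftShift h := by
  ext ξ s
  rw [mul_apply_eq_comp, leftShift_apply, leftShift_apply, leftShift_apply, mul_inv_rev,
    mul_assoc]

theorem leftShift_one : leftShift (1 : G) = 1 := by
  ext ξ s
  rw [leftShift_apply]
  simp

theorem star_leftShift (g : G) : star (leftShift g) = leftShift g⁻¹ :=
  star_eq_of_matrix fun a b => by
    rw [leftShift_apply, leftShift_apply, inv_inv, delta_apply, delta_apply]
    by_cases h : g * b = a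
    · subst h
      simp
    · rw [if_neg h, if_neg (fun h' => h (by rw [← h', mul_inv_cancel_left])), star_zero]

variable [ContinuousConstSMul G X]

/-- The covariant representation of `(C₀(X), G)` on `ℓ²(G)` attached to the orbit of `x`. -/
def orbitRep (x : X) : CovariantRep X G where
  H := lp (fun _ : G => ℂ) 2
  π :=
    { toFun := orbitMul x
      map_smul' := fun c f => by
        ext ξ s
        simp [orbitMul_apply, mul_assoc]
      map_zero' := by
        ext ξ s
        simp [orbitMul_apply]
      map_add' := fun f f' => by
        ext ξ s
        simp [orbitMul_apply, add_mul]
      map_mul' := fun f f' => by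
        ext ξ s
        simp [orbitMul_apply, mul_assoc]
      map_star' := fun f => (star_eq_of_matrix fun a b => by
        rw [orbitMul_apply, orbitMul_apply, delta_apply, delta_apply]
        by_cases h : b = a
        · subst h
          simp
        · simp [h, Ne.symm h]).symm }
  U :=
    { toFun := fun g => ⟨leftShift g, by
        rw [Unitary.mem_iff, star_leftShift, ← leftShift_mul, ← leftShift_mul]
        simp [leftShift_one]⟩
      map_one' := Subtype.ext leftShift_one
      map_mul' := fun g h => Subtype.ext (leftShift_mul g h) }
  covariant g f := by
    change leftShift g * orbitMul x f * star (leftShift g) = orbitMul x (translate g f)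
    rw [star_leftShift]
    ext ξ s
    rw [mul_apply_eq_comp, mul_apply_eq_comp, leftShift_apply,
      orbitMul_apply, leftShift_apply, orbitMul_apply, translate_apply, mul_smul, inv_inv,
      mul_inv_cancel_left]

/-- The operator on `ℓ²(G)` by which an element of the crossed product acts in the representation
attached to the orbit of `x`. -/
def orbitEval (x : X) : UniversalOperators X G →⋆ₙₐ[ℂ]
    (lp (fun _ : G => ℂ) 2 →L[ℂ] lp (fun _ : G => ℂ) 2) :=
  eval (orbitRep x)

theorem norm_orbitEval_le (x : X) (T : UniversalOperators X G) : ‖orbitEval x T‖ ≤ ‖T‖ :=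
  norm_eval_le (orbitRep x) T

theorem orbitEval_monomial (x : X) (f : C₀(X, ℂ)) (g : G) :
    orbitEval x (monomial f g) = orbitMul x f * leftShift g := rfl

theorem orbitEval_monomial_delta (x : X) (f : C₀(X, ℂ)) (g s : G) :
    orbitEval x (monomial f g) (delta s) = f ((g * s) • x) • delta (g * s) := by
  ext t
  rw [orbitEval_monomial, mul_apply_eq_comp, orbitMul_apply, leftShift_apply,
    lp.coeFn_smul, Pi.smul_apply, smul_eq_mul]
  by_cases h : t = g * s
  · subst h
    simp
  · rw [delta_apply_ne h, delta_apply_ne (fun h' => h (by rw [← h', mul_inv_cancel_left])), mul_zero,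
      mul_zero]

/-- The value at `x` of the canonical conditional expectation `∑ f_g u_g ↦ f_1` onto `C₀(X)`. -/
def diagCoeff (x : X) : UniversalOperators X G →ₗ[ℂ] ℂ where
  toFun T := orbitEval x T (delta 1) 1
  map_add' S T := by simp
  map_smul' c T := by simp

theorem diagCoeff_eq (x : X) (T : UniversalOperators X G) :
    diagCoeff x T = orbitEval x T (delta 1) 1 := rfl

theorem norm_diagCoeff_le (x : X) (T : UniversalOperators X G) : ‖diagCoeff x T‖ ≤ ‖T‖ := by
  rw [diagCoeff_eq]
  refine (lp.norm_apply_le_norm (by simp) _ _).trans ((ContinuousLinearMap.le_opNorm _ _).trans ?_)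
  rw [norm_delta, mul_one]
  exact norm_orbitEval_le x T

open Classical in
theorem diagCoeff_monomial (x : X) (f : C₀(X, ℂ)) (g : G) :
    diagCoeff x (monomial f g) = if g = 1 then f x else 0 := by
  rw [diagCoeff_eq, orbitEval_monomial_delta, lp.coeFn_smul, Pi.smul_apply, mul_one, delta_apply,
    smul_eq_mul]
  by_cases h : g = 1
  · subst h
    simp
  · simp [h, Ne.symm h]

theorem diagCoeff_star_mul_self (x : X) (T : UniversalOperators X G) :
    diagCoeff x (star T * T) = ((‖orbitEval x T (delta 1)‖ ^ 2 : ℝ) : ℂ) := by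
  rw [diagCoeff_eq, map_mul, map_star, ← inner_delta_left, mul_apply_eq_comp,
    ContinuousLinearMap.star_eq_adjoint, ContinuousLinearMap.adjoint_inner_right]
  simp

theorem diagCoeff_finsupp_sum (x : X) (F : G →₀ C₀(X, ℂ)) :
    diagCoeff x (F.sum fun g f => monomial f g) = F 1 x := by
  classical
  rw [Finsupp.sum, map_sum]
  simp only [diagCoeff_monomial, Finset.sum_ite_eq']
  split_ifs with h
  · rfl
  · rw [Finsupp.notMem_support_iff.1 h]; rfl

theorem continuous_diagCoeff {T : UniversalOperators X G} (hT : T ∈ crossedProduct X G) :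
    Continuous fun x => diagCoeff x T := by
  rw [← SetLike.mem_coe, coe_crossedProduct] at hT
  refine continuous_of_uniform_approx_of_continuous fun V hV => ?_
  obtain ⟨ε, hε, hV⟩ := Metric.mem_uniformity_dist.1 hV
  obtain ⟨S, hS, hST⟩ := Metric.mem_closure_iff.1 hT ε hε
  obtain ⟨F, rfl⟩ := exists_finsupp_sum_monomial hS
  refine ⟨fun x => F 1 x, (F 1).continuous, fun x => hV ?_⟩
  change dist _ (F 1 x) < ε
  rw [← diagCoeff_finsupp_sum, dist_eq_norm, ← map_sub]
  exact (norm_diagCoeff_le _ _).trans_lt (by rwa [← dist_eq_norm])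

end OrbitRepresentation

/-! ### Faithfulness of the conditional expectation -/

section Faithful

variable {X G : Type u} [TopologicalSpace X] [CommGroup G] [MulAction G X] [ContinuousConstSMul G X]

open UniversalOperators MeasureTheory

theorem continuous_inner_dualHom (ρ : CovariantRep X G) (v : ρ.H) {T : UniversalOperators X G}
    (hT : T ∈ crossedProduct X G) :
    Continuous fun χ : characterGroup G => inner ℂ v (eval ρ (dualHom (characterHom χ) T) v) := by
  have h1 := continuous_dualHom (χ := characterHom) continuous_characterHom_apply hT
  have h2 : Continuous (eval ρ : UniversalOperators X G → _) :=
    AddMonoidHomClass.continuous_of_bound (eval ρ) 1 fun T => by simpa using norm_eval_le ρ T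
  exact continuous_const.inner ((h2.comp h1).clm_apply continuous_const)

theorem integrable_inner_dualHom (ρ : CovariantRep X G) (v : ρ.H) {T : UniversalOperators X G}
    (hT : T ∈ crossedProduct X G) :
    Integrable (fun χ : characterGroup G => inner ℂ v (eval ρ (dualHom (characterHom χ) T) v))
      (characterMeasure G) :=
  (continuous_inner_dualHom ρ v hT).integrable_of_hasCompactSupport
    (HasCompactSupport.of_compactSpace _)

/-- The average of the dual action kills all coefficients `f_g` with `g ≠ 1`. -/
theorem integral_inner_dualHom_finsupp_sum (ρ : CovariantRep X G) (v : ρ.H) (F : G →₀ C₀(X, ℂ)) :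
    ∫ χ : characterGroup G, inner ℂ v (eval ρ (dualHom (characterHom χ) (F.sum fun g f => monomial f g)) v)
      ∂(characterMeasure G) = inner ℂ v (ρ.π (F 1) v) := by
  classical
  have h : ∀ χ : characterGroup G,
      inner ℂ v (eval ρ (dualHom (characterHom χ) (F.sum fun g f => monomial f g)) v) =
        ∑ g ∈ F.support, (characterHom χ g : ℂ) * inner ℂ v (eval ρ (monomial (F g) g) v) := by
    intro χ
    simp only [Finsupp.sum, map_sum, dualHom_monomial, map_smul, _root_.sum_apply,
      _root_.smul_apply, inner_sum, inner_smul_right]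
  simp only [h]
  have hint : ∀ g : G, Integrable (fun χ : characterGroup G => (characterHom χ g : ℂ)) (characterMeasure G) :=
    fun g => (continuous_subtype_val.comp (continuous_characterHom_apply g)).integrable_of_hasCompactSupport
      (HasCompactSupport.of_compactSpace _)
  rw [integral_finsetSum _ fun g _ => (hint g).mul_const _]
  simp only [integral_mul_const]
  have h1 : ∫ χ : characterGroup G, (characterHom χ 1 : ℂ) ∂(characterMeasure G) = 1 := by simp
  rw [Finset.sum_eq_single 1]
  · rw [h1, one_mul, eval_monomial, map_one ρ.U, OneMemClass.coe_one, mul_one]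
  · intro g _ hg
    rw [integral_character_eq_zero hg, zero_mul]
  · intro h
    rw [Finsupp.notMem_support_iff.1 h, eval_monomial]
    simp

/-- An element whose conditional expectation vanishes is averaged to zero by the dual action. -/
theorem integral_inner_dualHom_eq_zero (ρ : CovariantRep X G) (v : ρ.H) {T : UniversalOperators X G}
    (hT : T ∈ crossedProduct X G) (h : ∀ x, diagCoeff x T = 0) :
    ∫ χ : characterGroup G, inner ℂ v (eval ρ (dualHom (characterHom χ) T) v) ∂(characterMeasure G) = 0 := by
  rw [← norm_le_zero_iff]
  refine le_of_forall_pos_le_add fun ε hε => ?_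
  have hT' := hT
  rw [← SetLike.mem_coe, coe_crossedProduct] at hT'
  set δ := ε / (2 * (‖v‖ ^ 2 + 1)) with hδ
  have hδ0 : 0 < δ := by positivity
  obtain ⟨S, hS, hST⟩ := Metric.mem_closure_iff.1 hT' δ hδ0
  rw [dist_eq_norm] at hST
  have hS' : S ∈ crossedProduct X G := mem_crossedProduct_of_mem_span hS
  have e1 : ‖∫ χ : characterGroup G, inner ℂ v (eval ρ (dualHom (characterHom χ) (T - S)) v)
      ∂(characterMeasure G)‖ ≤ δ * ‖v‖ ^ 2 := by
    refine (norm_integral_le_of_norm_le_const (C := δ * ‖v‖ ^ 2) (Filter.Eventually.of_forall fun χ => ?_)).trans (by simp)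
    refine (norm_inner_le_norm _ _).trans ?_
    have : ‖eval ρ (dualHom (characterHom χ) (T - S)) v‖ ≤ δ * ‖v‖ :=
      (ContinuousLinearMap.le_opNorm _ _).trans (mul_le_mul_of_nonneg_right
        (((norm_eval_le _ _).trans (norm_dualHom_le _ _)).trans hST.le) (norm_nonneg _))
    calc _ ≤ ‖v‖ * (δ * ‖v‖) := mul_le_mul_of_nonneg_left this (norm_nonneg _)
      _ = _ := by ring
  have e2 : ‖∫ χ : characterGroup G, inner ℂ v (eval ρ (dualHom (characterHom χ) S) v)
      ∂(characterMeasure G)‖ ≤ δ * ‖v‖ ^ 2 := by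
    obtain ⟨F, rfl⟩ := exists_finsupp_sum_monomial hS
    rw [integral_inner_dualHom_finsupp_sum]
    have hF : ‖F 1‖ ≤ δ := by
      rw [← ZeroAtInftyContinuousMap.norm_toBCF_eq_norm, BoundedContinuousFunction.norm_le hδ0.le]
      intro x
      change ‖F 1 x‖ ≤ δ
      rw [← diagCoeff_finsupp_sum]
      have := norm_diagCoeff_le x (T - F.sum fun g f => monomial f g)
      rw [map_sub, h x, zero_sub, norm_neg] at this
      exact this.trans hST.le
    refine (norm_inner_le_norm _ _).trans ?_
    have : ‖ρ.π (F 1) v‖ ≤ δ * ‖v‖ :=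
      (ContinuousLinearMap.le_opNorm _ _).trans (mul_le_mul_of_nonneg_right
        ((NonUnitalStarAlgHom.norm_apply_le ρ.π (F 1)).trans hF) (norm_nonneg _))
    calc _ ≤ ‖v‖ * (δ * ‖v‖) := mul_le_mul_of_nonneg_left this (norm_nonneg _)
      _ = _ := by ring
  have e3 : ∫ χ : characterGroup G, inner ℂ v (eval ρ (dualHom (characterHom χ) T) v) ∂(characterMeasure G) =
      ∫ χ : characterGroup G, inner ℂ v (eval ρ (dualHom (characterHom χ) (T - S)) v) ∂(characterMeasure G) +
      ∫ χ : characterGroup G, inner ℂ v (eval ρ (dualHom (characterHom χ) S) v) ∂(characterMeasure G) := by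
    rw [← integral_add (integrable_inner_dualHom ρ v (sub_mem hT hS'))
      (integrable_inner_dualHom ρ v hS')]
    refine integral_congr_ae (Filter.Eventually.of_forall fun χ => ?_)
    simp only [map_sub, _root_.sub_apply, inner_sub_right, sub_add_cancel]
  rw [e3, zero_add]
  refine (norm_add_le _ _).trans ((add_le_add e1 e2).trans ?_)
  rw [hδ, ← two_mul, ← mul_assoc, mul_div_assoc', div_mul_eq_mul_div, div_le_iff₀ (by positivity)]
  nlinarith [sq_nonneg ‖v‖]

/-- The conditional expectation of a crossed product by a commutative discrete group is faithful on
the full crossed product: it is the average of the dual action over the compact group of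
characters, and the average of a continuous nonnegative function vanishes only if the function
does. -/
theorem eq_zero_of_diagCoeff_star_mul_self {T : UniversalOperators X G}
    (hT : T ∈ crossedProduct X G) (h : ∀ x, diagCoeff x (star T * T) = 0) : T = 0 := by
  refine ext_eval fun ρ => ?_
  rw [map_zero]
  ext v
  have hTT : star T * T ∈ crossedProduct X G := mul_mem (star_mem hT) hT
  have hint := integral_inner_dualHom_eq_zero ρ v hTT h
  have hF : ∀ χ : characterGroup G, inner ℂ v (eval ρ (dualHom (characterHom χ) (star T * T)) v) =
      ((‖eval ρ (dualHom (characterHom χ) T) v‖ ^ 2 : ℝ) : ℂ) := by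
    intro χ
    rw [map_mul, map_star, map_mul, map_star, mul_apply_eq_comp,
      ContinuousLinearMap.star_eq_adjoint, ContinuousLinearMap.adjoint_inner_right]
    simp
  have hcont := continuous_inner_dualHom ρ v hTT
  simp only [hF] at hint hcont
  have hcont' : Continuous fun χ : characterGroup G => ‖eval ρ (dualHom (characterHom χ) T) v‖ ^ 2 := by
    refine (Complex.continuous_re.comp hcont).congr fun χ => ?_
    exact Complex.ofReal_re _
  have hr := integral_ofReal (𝕜 := ℂ) (μ := characterMeasure G)
    (f := fun χ : characterGroup G => ‖eval ρ (dualHom (characterHom χ) T) v‖ ^ 2)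
  rw [show (RCLike.ofReal : ℝ → ℂ) = Complex.ofReal from rfl] at hr
  rw [hr, Complex.ofReal_eq_zero, integral_eq_zero_iff_of_nonneg (fun _ => by positivity)
    (hcont'.integrable_of_hasCompactSupport (HasCompactSupport.of_compactSpace _)),
    Continuous.ae_eq_iff_eq _ hcont' continuous_zero] at hint
  have h1 := congrFun hint 1
  have h2 : characterHom (1 : characterGroup G) = 1 := rfl
  simp only [h2, dualHom_one] at h1
  simpa using h1

end Faithful

/-! ### Hecke operators -/

section HeckeOperators

variable {G : Type u} [Group G] (Γ : Subgroup G)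

variable {Γ} in
theorem rightCoset_eq_iff {a b : G} : rightCoset Γ a = rightCoset Γ b ↔ b * a⁻¹ ∈ Γ :=
  Quotient.eq.trans QuotientGroup.rightRel_apply

theorem rightCoset_mul_left {γ : G} (hγ : γ ∈ Γ) (a : G) :
    rightCoset Γ (γ * a) = rightCoset Γ a := by
  rw [rightCoset_eq_iff]
  simpa using hγ

@[simp]
theorem rightCoset_out (c : RightCosets Γ) : rightCoset Γ c.out = c := Quotient.out_eq c

/-- Right multiplication by `h` on `Γ \ G`. -/
def cosetMul (c : RightCosets Γ) (h : G) : RightCosets Γ :=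
  Quotient.map (· * h) (fun a b hab => by
    change QuotientGroup.rightRel Γ _ _ at hab
    change QuotientGroup.rightRel Γ _ _
    rw [QuotientGroup.rightRel_apply] at hab ⊢
    simpa [mul_assoc] using hab) c

theorem cosetMul_mk (a h : G) : cosetMul Γ (rightCoset Γ a) h = rightCoset Γ (a * h) := rfl

theorem cosetMul_mul (c : RightCosets Γ) (a b : G) :
    cosetMul Γ c (a * b) = cosetMul Γ (cosetMul Γ c a) b := by
  induction c using Quotient.ind with
  | _ c => exact congrArg (rightCoset Γ) (mul_assoc c a b).symm

theorem cosetMul_one (c : RightCosets Γ) : cosetMul Γ c 1 = c := by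
  induction c using Quotient.ind with
  | _ c => exact congrArg (rightCoset Γ) (mul_one c)

theorem cosetMul_injective (h : G) : Function.Injective fun c => cosetMul Γ c h := by
  intro c d hcd
  have := congrArg (fun c => cosetMul Γ c h⁻¹) hcd
  simpa [← cosetMul_mul, cosetMul_one] using this

theorem mem_doubleCoset_iff {g a : G} :
    a ∈ DoubleCoset.doubleCoset g (Γ : Set G) (Γ : Set G) ↔ ∃ x ∈ Γ, ∃ y ∈ Γ, a = x * g * y :=
  DoubleCoset.mem_doubleCoset

theorem inv_mem_doubleCoset_inv {g a : G} :
    a⁻¹ ∈ DoubleCoset.doubleCoset g⁻¹ (Γ : Set G) (Γ : Set G) ↔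
      a ∈ DoubleCoset.doubleCoset g (Γ : Set G) (Γ : Set G) := by
  rw [mem_doubleCoset_iff, mem_doubleCoset_iff]
  constructor
  · rintro ⟨x, hx, y, hy, h⟩
    exact ⟨y⁻¹, inv_mem hy, x⁻¹, inv_mem hx, by rw [← inv_inv a, h]; group⟩
  · rintro ⟨x, hx, y, hy, rfl⟩
    exact ⟨y⁻¹, inv_mem hy, x⁻¹, inv_mem hx, by group⟩

theorem mul_mem_doubleCoset_iff {g a γ : G} (hγ : γ ∈ Γ) :
    γ * a ∈ DoubleCoset.doubleCoset g (Γ : Set G) (Γ : Set G) ↔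
      a ∈ DoubleCoset.doubleCoset g (Γ : Set G) (Γ : Set G) := by
  rw [mem_doubleCoset_iff, mem_doubleCoset_iff]
  constructor
  · rintro ⟨x, hx, y, hy, h⟩
    exact ⟨γ⁻¹ * x, mul_mem (inv_mem hγ) hx, y, hy, by
      rw [mul_assoc γ⁻¹, mul_assoc γ⁻¹, ← h, inv_mul_cancel_left]⟩
  · rintro ⟨x, hx, y, hy, rfl⟩
    exact ⟨γ * x, mul_mem hγ hx, y, hy, by group⟩

theorem mem_doubleCoset_mul_iff {g a γ : G} (hγ : γ ∈ Γ) :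
    a * γ ∈ DoubleCoset.doubleCoset g (Γ : Set G) (Γ : Set G) ↔
      a ∈ DoubleCoset.doubleCoset g (Γ : Set G) (Γ : Set G) := by
  rw [← inv_mem_doubleCoset_inv, mul_inv_rev, mul_mem_doubleCoset_iff Γ (inv_mem hγ),
    inv_mem_doubleCoset_inv]

theorem rightCoset_mem_image_iff {g a : G} :
    rightCoset Γ a ∈ rightCoset Γ '' DoubleCoset.doubleCoset g (Γ : Set G) (Γ : Set G) ↔
      a ∈ DoubleCoset.doubleCoset g (Γ : Set G) (Γ : Set G) := by
  refine ⟨?_, fun h => ⟨a, h, rfl⟩⟩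
  rintro ⟨b, hb, hab⟩
  have := (mul_mem_doubleCoset_iff Γ (rightCoset_eq_iff.1 hab)).2 hb
  simpa using this

/-- A pair is a Hecke pair as soon as all double cosets are finite unions of right cosets: the left
cosets in `Γ g Γ` are the inverses of the right cosets in `Γ g⁻¹ Γ`. -/
theorem isHeckePair_of_finite
    (h : ∀ g : G, (rightCoset Γ '' DoubleCoset.doubleCoset g (Γ : Set G) (Γ : Set G)).Finite) :
    IsHeckePair Γ := by
  refine fun g => ⟨h g, ?_⟩
  let i : RightCosets Γ → G ⧸ Γ := Quotient.lift (fun a => ((a⁻¹ : G) : G ⧸ Γ)) fun a b hab => by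
    change QuotientGroup.rightRel Γ _ _ at hab
    rw [QuotientGroup.rightRel_apply] at hab
    rw [QuotientGroup.eq]
    simpa using inv_mem hab
  refine ((h g⁻¹).image i).subset ?_
  rintro _ ⟨a, ha, rfl⟩
  exact ⟨rightCoset Γ a⁻¹, ⟨a⁻¹, (inv_mem_doubleCoset_inv Γ).2 ha, rfl⟩, by
    change (((a⁻¹)⁻¹ : G) : G ⧸ Γ) = _
    rw [inv_inv]⟩

variable {Γ} (hΓ : IsHeckePair Γ)

/-- The finite set of right cosets contained in `Γ g Γ`. -/
def cosetsIn (g : G) : Finset (RightCosets Γ) := (hΓ g).1.toFinset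

theorem mem_cosetsIn {g a : G} : rightCoset Γ a ∈ cosetsIn hΓ g ↔
    a ∈ DoubleCoset.doubleCoset g (Γ : Set G) (Γ : Set G) := by
  rw [cosetsIn, Set.Finite.mem_toFinset, rightCoset_mem_image_iff]

open Classical in
/-- The right cosets `Γ b` with `a b⁻¹ ∈ Γ g Γ`, for a right coset `Γ a`. -/
def heckeRow (g : G) (c : RightCosets Γ) : Finset (RightCosets Γ) :=
  (cosetsIn hΓ g⁻¹).image fun d => cosetMul Γ d c.out

theorem mem_cosetMul_cosetsIn {g a b : G} :
    (∃ d ∈ cosetsIn hΓ g, cosetMul Γ d b = rightCoset Γ a) ↔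
      a * b⁻¹ ∈ DoubleCoset.doubleCoset g (Γ : Set G) (Γ : Set G) := by
  constructor
  · rintro ⟨d, hd, h⟩
    obtain ⟨d, rfl⟩ : ∃ x, rightCoset Γ x = d := ⟨d.out, rightCoset_out Γ d⟩
    rw [cosetMul_mk, rightCoset_eq_iff, mul_inv_rev, ← mul_assoc] at h
    rw [mem_cosetsIn] at hd
    simpa using (mul_mem_doubleCoset_iff Γ h).2 hd
  · intro h
    exact ⟨rightCoset Γ (a * b⁻¹), (mem_cosetsIn hΓ).2 h, by rw [cosetMul_mk, inv_mul_cancel_right]⟩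

theorem mem_heckeRow {g a b : G} : rightCoset Γ b ∈ heckeRow hΓ g (rightCoset Γ a) ↔
    a * b⁻¹ ∈ DoubleCoset.doubleCoset g (Γ : Set G) (Γ : Set G) := by
  classical
  rw [heckeRow, Finset.mem_image, mem_cosetMul_cosetsIn, ← inv_mem_doubleCoset_inv, inv_inv,
    mul_inv_rev, inv_inv]
  have : (rightCoset Γ a).out * a⁻¹ ∈ Γ := rightCoset_eq_iff.1 (rightCoset_out Γ (rightCoset Γ a)).symm
  rw [← mul_mem_doubleCoset_iff Γ this (a := a * b⁻¹), ← mul_assoc (_ * a⁻¹), inv_mul_cancel_right]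

theorem mem_heckeRow_iff {g : G} {c d : RightCosets Γ} : d ∈ heckeRow hΓ g c ↔
    ∃ x ∈ cosetsIn hΓ g, cosetMul Γ x d.out = c := by
  obtain ⟨a, rfl⟩ : ∃ x, rightCoset Γ x = c := ⟨c.out, rightCoset_out Γ c⟩
  conv_lhs => rw [← rightCoset_out Γ d]
  rw [mem_heckeRow, mem_cosetMul_cosetsIn]

/-- The operator by which `[g]` acts on `ℓ²(Γ \ G)`. -/
def heckeOp (g : G) : CosetL2 Γ →L[ℂ] CosetL2 Γ :=
  kernelOp (heckeRow hΓ g) (fun _ _ => 1) (M := 1) (R := (cosetsIn hΓ g⁻¹).card)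
    (R' := (cosetsIn hΓ g).card) (fun _ _ => by simp) (fun c => by
      classical
      exact Finset.card_image_le)
    (fun d s h => by
      classical
      refine (Finset.card_le_card (t := (cosetsIn hΓ g).image fun x => cosetMul Γ x d.out)
        fun c hc => ?_).trans Finset.card_image_le
      obtain ⟨x, hx, rfl⟩ := (mem_heckeRow_iff hΓ).1 (h c hc)
      exact Finset.mem_image_of_mem _ hx)

theorem heckeOp_apply (g : G) (ξ : CosetL2 Γ) (c : RightCosets Γ) :
    heckeOp hΓ g ξ c = ∑ d ∈ heckeRow hΓ g c, ξ d := by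
  change ∑ d ∈ heckeRow hΓ g c, (1 : ℂ) * ξ d = _
  simp only [one_mul]

theorem sum_delta_apply {α : Type*} (s : Finset α) (a : α) [Decidable (a ∈ s)] :
    (∑ b ∈ s, delta b : lp (fun _ : α => ℂ) 2) a = if a ∈ s then 1 else 0 := by
  classical
  rw [lp.coeFn_sum, Finset.sum_apply]
  simp [delta_apply]

theorem sum_eval_delta {α : Type*} (s : Finset α) (a : α) [Decidable (a ∈ s)] :
    ∑ b ∈ s, (delta a : lp (fun _ : α => ℂ) 2) b = if a ∈ s then 1 else 0 := by
  split_ifs with h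
  · exact (Finset.sum_eq_single_of_mem (f := fun b => (delta a : lp (fun _ : α => ℂ) 2) b) a h
      fun b _ hb => delta_apply_ne hb).trans (delta_apply_self a)
  · exact Finset.sum_eq_zero fun b hb => delta_apply_ne fun h' => h (h' ▸ hb)

/-- On basis vectors, `[g] δ_{Γh}` is the sum of `δ_{Γkh}` over the right cosets `Γ k ⊂ Γ g Γ`. -/
theorem heckeOp_delta (g h : G) : heckeOp hΓ g (delta (rightCoset Γ h)) =
    ∑ d ∈ cosetsIn hΓ g, delta (cosetMul Γ d h) := by
  classical
  have e : ∑ d ∈ cosetsIn hΓ g, delta (cosetMul Γ d h) =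
      ∑ c ∈ (cosetsIn hΓ g).image fun d => cosetMul Γ d h, delta c :=
    (Finset.sum_image fun _ _ _ _ h' => cosetMul_injective Γ h h').symm
  ext c
  rw [e, sum_delta_apply, heckeOp_apply, sum_eval_delta]
  obtain ⟨a, rfl⟩ : ∃ x, rightCoset Γ x = c := ⟨c.out, rightCoset_out Γ c⟩
  simp only [Finset.mem_image, mem_heckeRow, mem_cosetMul_cosetsIn]

theorem star_heckeOp (g : G) : star (heckeOp hΓ g) = heckeOp hΓ g⁻¹ := by
  classical
  refine star_eq_of_matrix fun a b => ?_
  obtain ⟨a, rfl⟩ : ∃ x, rightCoset Γ x = a := ⟨a.out, rightCoset_out Γ a⟩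
  obtain ⟨b, rfl⟩ : ∃ x, rightCoset Γ x = b := ⟨b.out, rightCoset_out Γ b⟩
  rw [heckeOp_apply, heckeOp_apply, sum_eval_delta, sum_eval_delta]
  simp only [mem_heckeRow]
  have : b * a⁻¹ ∈ DoubleCoset.doubleCoset g⁻¹ (Γ : Set G) (Γ : Set G) ↔
      a * b⁻¹ ∈ DoubleCoset.doubleCoset g (Γ : Set G) (Γ : Set G) := by
    rw [← inv_mem_doubleCoset_inv Γ (g := g), mul_inv_rev, inv_inv]
  simp only [this]
  split_ifs <;> simp

theorem doubleCosetFunction_apply (g a : G) [Decidable (a ∈ DoubleCoset.doubleCoset g (Γ : Set G) (Γ : Set G))] :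
    doubleCosetFunction Γ g (DoubleCoset.mk Γ Γ a) =
      if a ∈ DoubleCoset.doubleCoset g (Γ : Set G) (Γ : Set G) then 1 else 0 := by
  classical
  rw [doubleCosetFunction, Finsupp.single_apply]
  congr 1
  rw [eq_iff_iff, DoubleCoset.eq, mem_doubleCoset_iff]

theorem isHeckeOperator_heckeOp (g : G) :
    IsHeckeOperator Γ (doubleCosetFunction Γ g) (heckeOp hΓ g) := by
  classical
  intro ξ a
  have h : ∀ c : RightCosets Γ, doubleCosetFunction Γ g (DoubleCoset.mk Γ Γ (a * (Quotient.out c)⁻¹)) * ξ c =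
      if c ∈ heckeRow hΓ g (rightCoset Γ a) then ξ c else 0 := by
    intro c
    have : c ∈ heckeRow hΓ g (rightCoset Γ a) ↔
        a * (Quotient.out c)⁻¹ ∈ DoubleCoset.doubleCoset g (Γ : Set G) (Γ : Set G) := by
      conv_lhs => rw [← rightCoset_out Γ c]
      exact mem_heckeRow hΓ
    rw [doubleCosetFunction_apply]
    simp only [this]
    split_ifs <;> simp
  simp only [h]
  have h2 : heckeOp hΓ g ξ (rightCoset Γ a) = ∑ c ∈ heckeRow hΓ g (rightCoset Γ a),
      if c ∈ heckeRow hΓ g (rightCoset Γ a) then ξ c else 0 := by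
    rw [heckeOp_apply]
    exact Finset.sum_congr rfl fun c hc => (if_pos hc).symm
  rw [h2]
  exact hasSum_sum_of_ne_finset_zero fun c hc => if_neg hc

theorem IsHeckeOperator.unique {f : HeckeAlgebra Γ} {S T : CosetL2 Γ →L[ℂ] CosetL2 Γ}
    (hS : IsHeckeOperator Γ f S) (hT : IsHeckeOperator Γ f T) : S = T := by
  ext ξ c
  rw [← rightCoset_out Γ c]
  exact (hS ξ c.out).unique (hT ξ c.out)

/-- Elements of the Hecke algebra act by bounded operators, which are linear combinations of the
operators of double cosets. -/
theorem exists_isHeckeOperator (f : HeckeAlgebra Γ) :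
    ∃ T ∈ Submodule.span ℂ (Set.range (heckeOp hΓ)), IsHeckeOperator Γ f T := by
  induction f using Finsupp.induction_linear with
  | zero => exact ⟨0, zero_mem _, fun ξ g => by simp⟩
  | add f f' hf hf' =>
    obtain ⟨T, hT, h⟩ := hf
    obtain ⟨T', hT', h'⟩ := hf'
    refine ⟨T + T', add_mem hT hT', fun ξ g => ?_⟩
    simpa [add_mul] using (h ξ g).add (h' ξ g)
  | single D z =>
    induction D using Quotient.ind with
    | _ g =>
    refine ⟨z • heckeOp hΓ g, Submodule.smul_mem _ _ (Submodule.subset_span ⟨g, rfl⟩), fun ξ a => ?_⟩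
    have := (isHeckeOperator_heckeOp hΓ g ξ a).mul_left z
    have e : (Finsupp.single (Quotient.mk (DoubleCoset.setoid (Γ : Set G) (Γ : Set G)) g) z : HeckeAlgebra Γ) =
        z • doubleCosetFunction Γ g := by
      rw [doubleCosetFunction, Finsupp.smul_single, smul_eq_mul, mul_one]
    rw [e]
    simpa [mul_assoc] using this

theorem heckeOp_mem_reducedHeckeAlgebra (g : G) : heckeOp hΓ g ∈ reducedHeckeAlgebra Γ :=
  NonUnitalStarSubalgebra.le_topologicalClosure _
    (NonUnitalStarAlgebra.subset_adjoin ℂ _ ⟨_, isHeckeOperator_heckeOp hΓ g⟩)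

theorem reducedHeckeAlgebra_eq : reducedHeckeAlgebra Γ =
    (NonUnitalStarAlgebra.adjoin ℂ (Set.range (heckeOp hΓ))).topologicalClosure := by
  rw [reducedHeckeAlgebra]
  congr 1
  refine le_antisymm (NonUnitalStarAlgebra.adjoin_le ?_) (NonUnitalStarAlgebra.adjoin_le ?_)
  · rintro T ⟨f, hT⟩
    obtain ⟨S, hS, h⟩ := exists_isHeckeOperator hΓ f
    rw [hT.unique h]
    exact Submodule.span_le (p := (NonUnitalStarAlgebra.adjoin ℂ
      (Set.range (heckeOp hΓ))).toSubmodule).2 (NonUnitalStarAlgebra.subset_adjoin ℂ _) hS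
  · rintro _ ⟨g, rfl⟩
    exact NonUnitalStarAlgebra.subset_adjoin ℂ _ ⟨_, isHeckeOperator_heckeOp hΓ g⟩

/-! ### Right translations -/

variable (Γ) in
/-- Right translation by `h` on `ℓ²(Γ \ G)`. -/
def rightShift (h : G) : CosetL2 Γ →L[ℂ] CosetL2 Γ :=
  kernelOp (fun c => {cosetMul Γ c h}) (fun _ _ => 1) (M := 1) (R := 1) (R' := 1)
    (fun _ _ => by simp) (fun _ => by simp)
    (fun b s h' => Finset.card_le_one.2 fun c hc d hd => cosetMul_injective Γ h
      ((Finset.mem_singleton.1 (h' c hc)).symm.trans (Finset.mem_singleton.1 (h' d hd))))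

theorem rightShift_delta (h : G) (c : RightCosets Γ) :
    rightShift Γ h (delta c) = delta (cosetMul Γ c h⁻¹) := by
  ext d
  rw [rightShift, kernelOp_apply, Finset.sum_singleton, one_mul]
  by_cases hd : cosetMul Γ d h = c
  · subst hd
    rw [delta_apply_self, ← cosetMul_mul, mul_inv_cancel, cosetMul_one, delta_apply_self]
  · rw [delta_apply_ne hd, delta_apply_ne fun h' => hd (by
      rw [h', ← cosetMul_mul, inv_mul_cancel, cosetMul_one])]

theorem star_rightShift (h : G) : star (rightShift Γ h) = rightShift Γ h⁻¹ := by
  classical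
  refine star_eq_of_matrix fun a b => ?_
  rw [rightShift_delta, rightShift_delta, inv_inv, delta_apply, delta_apply]
  have : b = cosetMul Γ a h ↔ a = cosetMul Γ b h⁻¹ := by
    constructor
    · rintro rfl
      rw [← cosetMul_mul, mul_inv_cancel, cosetMul_one]
    · rintro rfl
      rw [← cosetMul_mul, inv_mul_cancel, cosetMul_one]
  simp only [this]
  split_ifs <;> simp

/-- The reduced Hecke algebra commutes with the right regular representation of `G`. -/
theorem commute_rightShift_of_mem (hΓ : IsHeckePair Γ) {T : CosetL2 Γ →L[ℂ] CosetL2 Γ} (hT : T ∈ reducedHeckeAlgebra Γ)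
    (h : G) : T * rightShift Γ h = rightShift Γ h * T := by
  rw [reducedHeckeAlgebra_eq hΓ] at hT
  refine closure_minimal (t := {T | T * rightShift Γ h = rightShift Γ h * T}) ?_
    (isClosed_eq (by fun_prop) (by fun_prop)) hT
  intro T hT
  change _ = _
  revert h
  refine NonUnitalStarAlgebra.adjoin_induction (R := ℂ)
    (p := fun T _ => ∀ h, T * rightShift Γ h = rightShift Γ h * T) ?_ ?_ ?_ ?_ ?_ ?_ hT
  · rintro _ ⟨g, rfl⟩ h
    refine clm_ext_delta fun c => ?_
    obtain ⟨a, rfl⟩ : ∃ x, rightCoset Γ x = c := ⟨c.out, rightCoset_out Γ c⟩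
    rw [mul_apply_eq_comp, mul_apply_eq_comp, rightShift_delta, cosetMul_mk, heckeOp_delta,
      heckeOp_delta, map_sum]
    simp only [rightShift_delta, cosetMul_mul]
  · intro S T _ _ hS hT h
    rw [add_mul, mul_add, hS, hT]
  · intro h
    simp
  · intro S T _ _ hS hT h
    rw [mul_assoc, hT, ← mul_assoc, hS, mul_assoc]
  · intro c T _ hT h
    rw [smul_mul_assoc, hT, mul_smul_comm]
  · intro T _ hT h
    have := congrArg star (hT h⁻¹)
    rw [star_mul, star_mul, star_rightShift, inv_inv] at this
    exact this.symm

/-- The vector `δ_Γ` is separating for the reduced Hecke algebra. -/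
theorem eq_zero_of_apply_delta_one (hΓ : IsHeckePair Γ) {T : CosetL2 Γ →L[ℂ] CosetL2 Γ}
    (hT : T ∈ reducedHeckeAlgebra Γ) (h : T (delta (rightCoset Γ 1)) = 0) : T = 0 := by
  refine clm_ext_delta fun c => ?_
  obtain ⟨a, rfl⟩ : ∃ x, rightCoset Γ x = c := ⟨c.out, rightCoset_out Γ c⟩
  have e : delta (rightCoset Γ a) = rightShift Γ a⁻¹ (delta (rightCoset Γ 1)) := by
    rw [rightShift_delta, inv_inv, cosetMul_mk, one_mul]
  rw [e, ← mul_apply_eq_comp, commute_rightShift_of_mem hΓ hT, mul_apply_eq_comp, h, map_zero]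
  rfl

/-! ### The modular function -/

theorem mem_map_conj {g a : G} : a ∈ Γ.map (MulAut.conj g).toMonoidHom ↔ g⁻¹ * a * g ∈ Γ := by
  rw [Subgroup.mem_map]
  constructor
  · rintro ⟨b, hb, rfl⟩
    simpa [mul_assoc] using hb
  · intro h
    exact ⟨_, h, by simp [mul_assoc]⟩

/-- `[Γ : Γ ∩ gΓg⁻¹]` is the number of right cosets in `Γ g⁻¹ Γ`, through `γ ↦ Γ g⁻¹ γ⁻¹`. -/
theorem relIndex_conj_eq_card (g : G) :
    (Γ.map (MulAut.conj g).toMonoidHom).relIndex Γ = (cosetsIn hΓ g⁻¹).card := by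
  rw [Subgroup.relIndex, Subgroup.index, ← Fintype.card_coe, ← Nat.card_eq_fintype_card]
  have key : ∀ a b : Γ, (QuotientGroup.mk a : Γ ⧸ (Γ.map (MulAut.conj g).toMonoidHom).subgroupOf Γ) =
      QuotientGroup.mk b ↔ rightCoset Γ (g⁻¹ * (a : G)⁻¹) = rightCoset Γ (g⁻¹ * (b : G)⁻¹) := by
    intro a b
    rw [QuotientGroup.eq, Subgroup.mem_subgroupOf, mem_map_conj, rightCoset_eq_iff, ← inv_mem_iff]
    simp [mul_assoc]
  refine Nat.card_eq_of_bijective (fun q => ⟨rightCoset Γ (g⁻¹ * (q.out : G)⁻¹), ?_⟩) ⟨?_, ?_⟩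
  · exact (mem_cosetsIn hΓ).2 ((mem_doubleCoset_iff Γ).2
      ⟨1, one_mem _, _, inv_mem q.out.2, by rw [one_mul]⟩)
  · intro q q' h
    rw [← Quotient.out_eq q, ← Quotient.out_eq q']
    exact (key _ _).2 (congrArg Subtype.val h)
  · rintro ⟨c, hc⟩
    obtain ⟨a, rfl⟩ : ∃ x, rightCoset Γ x = c := ⟨c.out, rightCoset_out Γ c⟩
    obtain ⟨x, hx, y, hy, rfl⟩ := (mem_doubleCoset_iff Γ).1 ((mem_cosetsIn hΓ).1 hc)
    refine ⟨QuotientGroup.mk ⟨y⁻¹, inv_mem hy⟩, Subtype.ext ?_⟩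
    change rightCoset Γ (g⁻¹ * (_ : G)⁻¹) = rightCoset Γ (x * g⁻¹ * y)
    rw [(key _ ⟨y⁻¹, inv_mem hy⟩).1 (Quotient.out_eq _), mul_assoc, rightCoset_mul_left Γ hx, inv_inv]

theorem modularFunction_eq (g : G) :
    modularFunction Γ g = ((cosetsIn hΓ g⁻¹).card : ℝ) / (cosetsIn hΓ g).card := by
  have h : Γ.relIndex (Γ.map (MulAut.conj g).toMonoidHom) = (cosetsIn hΓ g).card := by
    have h1 := relIndex_conj_eq_card hΓ g⁻¹
    rw [inv_inv] at h1
    have h2 : (Γ.map (MulAut.conj g⁻¹).toMonoidHom).map (MulAut.conj g).toMonoidHom = Γ := by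
      ext a
      rw [mem_map_conj, mem_map_conj]
      simp [mul_assoc]
    rw [← h1, ← Subgroup.relIndex_map_map_of_injective (f := (MulAut.conj g).toMonoidHom)
      (Γ.map (MulAut.conj g⁻¹).toMonoidHom) Γ (MulAut.conj g).injective, h2]
  rw [modularFunction, relIndex_conj_eq_card hΓ, h]

end HeckeOperators

/-! ### A self-dual character of the finite adeles -/

section AdelicCharacter

open IsDedekindDomain HeightOneSpectrum NumberField

variable (K : Type u) [Field K] [NumberField K]

/-- A character of the finite adeles for which `Ô` is its own annihilator. The second half of this is
stated in the stronger form that an adele which is annihilated by the ring of integers, a dense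
subset of `Ô`, is integral. Continuity is a consequence of the triviality on `Ô`. No compatibility
with the embedding of `K` is asked for. -/
structure AdelicCharacter where
  /-- The character, with values in the complex numbers of absolute value one. -/
  toFun : FiniteAdeles K → ℂ
  map_add : ∀ a b, toFun (a + b) = toFun a * toFun b
  norm_eq_one : ∀ a, ‖toFun a‖ = 1
  eq_one_of_mem : ∀ a ∈ integralAdeles K, toFun a = 1
  mem_of_eq_one : ∀ a, (∀ b : 𝓞 K, toFun (algebraMap K (FiniteAdeles K) (algebraMap (𝓞 K) K b) * a) = 1) →
    a ∈ integralAdeles K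

variable {K}

/-- A character of a local completion which is trivial on the integers and separates all other points
from them: extend a character of `K_v / O_v` which is nontrivial on an element of valuation
`exp 1`, the smallest value outside `O_v`. -/
theorem exists_local_character (v : HeightOneSpectrum (𝓞 K)) :
    ∃ ψ : v.adicCompletion K →+ AddCircle (1 : ℚ), (∀ x ∈ v.adicCompletionIntegers K, ψ x = 0) ∧
      ∀ w ∉ v.adicCompletionIntegers K, ∃ c ∈ v.adicCompletionIntegers K, ψ (c * w) ≠ 0 := by
  obtain ⟨t, ht⟩ := valuedAdicCompletion_surjective K v (WithZero.exp 1)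
  let O := (v.adicCompletionIntegers K).toSubring.toAddSubgroup
  have hO : ∀ x, x ∈ O ↔ Valued.v x ≤ 1 := fun x => Iff.rfl
  have ht' : (QuotientAddGroup.mk t : v.adicCompletion K ⧸ O) ≠ 0 := by
    rw [Ne, QuotientAddGroup.eq_zero_iff, hO, ht, not_le, ← WithZero.exp_zero, WithZero.exp_lt_exp]
    exact zero_lt_one
  obtain ⟨c, hc⟩ := CharacterModule.exists_character_apply_ne_zero_of_ne_zero ht'
  refine ⟨(c : (v.adicCompletion K ⧸ O) →+ AddCircle (1 : ℚ)).comp (QuotientAddGroup.mk' O),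
    fun x hx => ?_, fun w hw => ?_⟩
  · have : QuotientAddGroup.mk' O x = 0 := (QuotientAddGroup.eq_zero_iff _).2 hx
    exact (congrArg c this).trans (_root_.map_zero c)
  · have hw1 : 1 < Valued.v w := (notMem_adicCompletionIntegers (𝓞 K) K v).1 hw
    have hw0 : w ≠ 0 := fun h => by simp [h] at hw1
    refine ⟨t / w, (mem_adicCompletionIntegers (𝓞 K) K v).2 ?_, ?_⟩
    · rw [map_div₀, ht]
      refine div_le_one_of_le₀ ?_ zero_le
      rw [← WithZero.exp_log (ne_of_gt (zero_lt_one.trans hw1)), WithZero.exp_le_exp]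
      rw [← WithZero.exp_log (ne_of_gt (zero_lt_one.trans hw1)), ← WithZero.exp_zero,
        WithZero.exp_lt_exp] at hw1
      omega
    · rw [div_mul_cancel₀ _ hw0]
      exact hc

theorem exists_integer_local_approx (v : HeightOneSpectrum (𝓞 K)) {c : v.adicCompletion K}
    (hc : c ∈ v.adicCompletionIntegers K) (w : v.adicCompletion K) :
    ∃ b : 𝓞 K, (((algebraMap (𝓞 K) K b : K) : v.adicCompletion K) - c) * w ∈
      v.adicCompletionIntegers K := by
  have hO : IsOpen (v.adicCompletionIntegers K : Set (v.adicCompletion K)) :=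
    Valued.isOpen_valuationSubring _
  have hopen : IsOpen {z : v.adicCompletion K | (z - c) * w ∈ v.adicCompletionIntegers K ∧
      z - c ∈ v.adicCompletionIntegers K} :=
    (hO.preimage (f := fun z => (z - c) * w)
      ((continuous_id.sub continuous_const).mul continuous_const)).inter
      (hO.preimage (f := fun z => z - c) (continuous_id.sub continuous_const))
  obtain ⟨k, hk1, hk2⟩ := (denseRange_algebraMap (R := 𝓞 K) (K := K) v).exists_mem_open hopen
    ⟨c, by simp, by simp⟩
  have hk1' : ((k : v.adicCompletion K) - c) * w ∈ v.adicCompletionIntegers K := hk1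
  have hk2' : (k : v.adicCompletion K) - c ∈ v.adicCompletionIntegers K := hk2
  have hk : v.valuation K k ≤ 1 := by
    rw [← valuedAdicCompletion_eq_valuation']
    have := add_mem hk2' hc
    rw [sub_add_cancel] at this
    exact this
  by_cases hw : w = 0
  · exact ⟨0, by simp [hw]⟩
  have hw' : (Valued.v w)⁻¹ ≠ 0 := inv_ne_zero ((map_ne_zero _).2 hw)
  obtain ⟨b, hb⟩ := v.exists_valuation_sub_lt_of_integer hk (Units.mk0 _ hw')
  refine ⟨b, ?_⟩
  have e : (((algebraMap (𝓞 K) K b : K) : v.adicCompletion K) - c) * w =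
      ((algebraMap (𝓞 K) K b - k : K) : v.adicCompletion K) * w + ((k : v.adicCompletion K) - c) * w := by
    have : ((algebraMap (𝓞 K) K b - k : K) : v.adicCompletion K) =
        ((algebraMap (𝓞 K) K b : K) : v.adicCompletion K) - (k : v.adicCompletion K) :=
      map_sub (algebraMap K (v.adicCompletion K)) _ _
    rw [this]
    ring
  rw [e]
  refine add_mem ?_ hk1'
  rw [mem_adicCompletionIntegers, map_mul, valuedAdicCompletion_eq_valuation']
  rw [Units.val_mk0] at hb
  exact (mul_le_mul_left hb.le _).trans (by rw [inv_mul_cancel₀ ((map_ne_zero _).2 hw)])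

/-- The ring of integers is dense in `Ô`; the neighbourhoods of zero are written as
`{a | a w ∈ Ô}`. -/
theorem exists_integer_approx {c : FiniteAdeles K} (hc : c ∈ integralAdeles K) (w : FiniteAdeles K) :
    ∃ b : 𝓞 K, (algebraMap K (FiniteAdeles K) (algebraMap (𝓞 K) K b) - c) * w ∈ integralAdeles K := by
  classical
  have hfin : {v : HeightOneSpectrum (𝓞 K) | w v ∉ v.adicCompletionIntegers K}.Finite := by
    have := w.2
    rwa [Filter.eventually_cofinite] at this
  choose b hb using fun v : HeightOneSpectrum (𝓞 K) => exists_integer_local_approx v (hc v) (w v)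
  obtain ⟨y, hy⟩ := IsDedekindDomain.exists_forall_sub_mem_ideal (s := hfin.toFinset)
    (fun v : HeightOneSpectrum (𝓞 K) => v.asIdeal) (fun v => (WithZero.log (Valued.v (w v))).toNat)
    (fun v _ => v.prime) (fun v _ v' _ h h' => h (HeightOneSpectrum.ext h')) (fun v => b v)
  refine ⟨y, fun v => ?_⟩
  change (((algebraMap (𝓞 K) K y : K) : v.adicCompletion K) - c v) * w v ∈ v.adicCompletionIntegers K
  by_cases hv : w v ∈ v.adicCompletionIntegers K
  · exact mul_mem (sub_mem (coe_algebraMap_mem (𝓞 K) K v y) (hc v)) hv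
  have hy' := hy v (hfin.mem_toFinset.2 hv)
  rw [← intValuation_le_pow_iff_mem, ← valuation_of_algebraMap (K := K),
    ← valuedAdicCompletion_eq_valuation'] at hy'
  have e : (((algebraMap (𝓞 K) K y : K) : v.adicCompletion K) - c v) * w v =
      ((algebraMap (𝓞 K) K (y - b v) : K) : v.adicCompletion K) * w v +
        (((algebraMap (𝓞 K) K (b v) : K) : v.adicCompletion K) - c v) * w v := by
    have : ((algebraMap (𝓞 K) K (y - b v) : K) : v.adicCompletion K) =
        ((algebraMap (𝓞 K) K y : K) : v.adicCompletion K) -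
          ((algebraMap (𝓞 K) K (b v) : K) : v.adicCompletion K) := by
      rw [map_sub]
      exact map_sub (algebraMap K (v.adicCompletion K)) _ _
    rw [this]
    ring
  rw [e]
  refine add_mem ?_ (hb v)
  rw [mem_adicCompletionIntegers, map_mul]
  refine (mul_le_mul_left hy' _).trans ?_
  have hw0 : Valued.v (w v) ≠ 0 := fun h0 => hv (by
    rw [mem_adicCompletionIntegers, h0]; exact zero_le_one)
  conv_lhs => rw [← WithZero.exp_log hw0]
  rw [WithZero.log_exp, ← WithZero.exp_add, ← WithZero.exp_zero, WithZero.exp_le_exp]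
  have := Int.self_le_toNat (WithZero.log (Valued.v (w v)))
  omega

open Classical in
/-- The finite adele with a single nonzero component. -/
def singleAdele (v : HeightOneSpectrum (𝓞 K)) {c : v.adicCompletion K}
    (_hc : c ∈ v.adicCompletionIntegers K) : FiniteAdeles K :=
  ⟨Pi.single v c, by
    rw [Filter.eventually_cofinite]
    refine (Set.finite_singleton v).subset fun v' hv' => ?_
    by_contra h
    refine hv' ?_
    rw [Pi.single_eq_of_ne h]
    exact zero_mem (v'.adicCompletionIntegers K)⟩

variable (K) in
/-- The sum over all places of the local characters with values in `ℚ / ℤ`, mapped to the circle. -/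
theorem exists_adelic_character : Nonempty (AdelicCharacter K) := by
  classical
  choose ψ hψ1 hψ2 using exists_local_character (K := K)
  have hfin : ∀ w : FiniteAdeles K, (Function.support fun v => ψ v (w v)).Finite := by
    intro w
    have := w.2
    rw [Filter.eventually_cofinite] at this
    exact this.subset fun v hv h => hv (hψ1 v _ h)
  let Ψ : FiniteAdeles K →+ AddCircle (1 : ℚ) := AddMonoidHom.mk' (fun w => ∑ᶠ v, ψ v (w v))
    fun a b => by
      rw [← finsum_add_distrib (hfin a) (hfin b)]
      exact finsum_congr fun v => (ψ v).map_add _ _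
  have hΨ1 : ∀ a ∈ integralAdeles K, Ψ a = 0 := fun a ha =>
    (finsum_congr fun v => hψ1 v _ (ha v)).trans finsum_zero
  have hΨ2 : ∀ a ∉ integralAdeles K, ∃ c ∈ integralAdeles K, Ψ (c * a) ≠ 0 := by
    intro a ha
    obtain ⟨v, hv⟩ := not_forall.1 ha
    obtain ⟨c, hc, hne⟩ := hψ2 v _ hv
    refine ⟨singleAdele v hc, fun v' => ?_, ?_⟩
    · change (Pi.single v c : ∀ v : HeightOneSpectrum (𝓞 K), v.adicCompletion K) v' ∈ _
      by_cases h : v' = v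
      · subst h
        rwa [Pi.single_eq_same]
      · rw [Pi.single_eq_of_ne h]
        exact zero_mem _
    · have : Ψ (singleAdele v hc * a) = ψ v (c * a v) := by
        change ∑ᶠ v', ψ v' ((Pi.single v c : ∀ v : HeightOneSpectrum (𝓞 K), v.adicCompletion K) v' * a v') = _
        rw [finsum_eq_single _ v fun v' h => by rw [Pi.single_eq_of_ne h, zero_mul, map_zero],
          Pi.single_eq_same]
      rwa [this]
  refine ⟨⟨fun a => ((ratCircle (Ψ a)).toMul : Circle), fun a b => ?_, fun a => Circle.norm_coe _,
    fun a ha => ?_, fun a h => ?_⟩⟩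
  · rw [Ψ.map_add, ratCircle.map_add, toMul_add, Circle.coe_mul]
  · rw [hΨ1 a ha, ratCircle.map_zero, toMul_zero, Circle.coe_one]
  · by_contra ha
    obtain ⟨c, hc, hne⟩ := hΨ2 a ha
    obtain ⟨b, hb⟩ := exists_integer_approx hc a
    have h1 := hΨ1 _ hb
    rw [sub_mul, Ψ.map_sub, sub_eq_zero] at h1
    rw [← h1] at hne
    refine hne (ratCircle_eq_zero ?_)
    exact congrArg Additive.ofMul (Subtype.ext (h b) : (ratCircle (Ψ _)).toMul = 1)

namespace AdelicCharacter

variable (ψ : AdelicCharacter K)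

instance : CoeFun (AdelicCharacter K) fun _ => FiniteAdeles K → ℂ := ⟨toFun⟩

variable (K) in
theorem zero_mem_integralAdeles : (0 : FiniteAdeles K) ∈ integralAdeles K :=
  fun v => zero_mem (v.adicCompletionIntegers K)

theorem map_zero : ψ 0 = 1 := ψ.eq_one_of_mem 0 (zero_mem_integralAdeles K)

theorem map_neg (a : FiniteAdeles K) : ψ (-a) = star (ψ a) := by
  have h1 : ψ (-a) * ψ a = 1 := by rw [← ψ.map_add, neg_add_cancel, ψ.map_zero]
  have h2 : star (ψ a) * ψ a = 1 := by
    have := Complex.conj_mul' (ψ a)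
    rw [ψ.norm_eq_one] at this
    simpa using this
  exact mul_right_cancel₀ (right_ne_zero_of_mul_eq_one h1) (h1.trans h2.symm)

theorem map_add_of_mem {a b : FiniteAdeles K} (hb : b ∈ integralAdeles K) : ψ (a + b) = ψ a := by
  rw [ψ.map_add, ψ.eq_one_of_mem b hb, mul_one]

theorem continuous : Continuous ψ := by
  rw [continuous_iff_continuousAt]
  intro a
  have hopen : IsOpen {b | b - a ∈ integralAdeles K} :=
    (integralAdeles_isOpen K).preimage (continuous_id.sub continuous_const)
  have ha : a ∈ {b | b - a ∈ integralAdeles K} := by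
    change a - a ∈ integralAdeles K
    rw [sub_self]
    exact zero_mem_integralAdeles K
  refine continuousAt_const.congr (f := fun _ => ψ a) ?_
  filter_upwards [hopen.mem_nhds ha] with b hb
  have := ψ.map_add_of_mem (a := a) hb
  rw [add_sub_cancel] at this
  exact this.symm

end AdelicCharacter

end AdelicCharacter

/-! ### The Hecke pair of integral matrices -/

section AxbHeckePair

open IsDedekindDomain HeightOneSpectrum NumberField
open scoped nonZeroDivisors

variable {K : Type u} [Field K] [NumberField K]

theorem add_mem_integralAdeles {a b : FiniteAdeles K} (ha : a ∈ integralAdeles K)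
    (hb : b ∈ integralAdeles K) : a + b ∈ integralAdeles K :=
  fun v => add_mem (ha v) (hb v)

theorem mul_mem_integralAdeles {a b : FiniteAdeles K} (ha : a ∈ integralAdeles K)
    (hb : b ∈ integralAdeles K) : a * b ∈ integralAdeles K :=
  fun v => mul_mem (ha v) (hb v)

theorem neg_mem_integralAdeles {a : FiniteAdeles K} (ha : a ∈ integralAdeles K) :
    -a ∈ integralAdeles K :=
  fun v => neg_mem (ha v)

variable (K) in
/-- The diagonal embedding of `K` into the finite adeles. -/
abbrev diagonal : K →+* FiniteAdeles K := algebraMap K (FiniteAdeles K)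

theorem diagonal_integer_mem (b : 𝓞 K) :
    diagonal K (algebraMap (𝓞 K) K b) ∈ integralAdeles K :=
  fun v => coe_algebraMap_mem (𝓞 K) K v b

theorem diagonal_mem_iff {k : K} :
    diagonal K k ∈ integralAdeles K ↔ k ∈ (algebraMap (𝓞 K) K).range := by
  constructor
  · intro h
    refine HeightOneSpectrum.mem_integers_of_valuation_le_one K k fun v => ?_
    rw [← valuedAdicCompletion_eq_valuation']
    exact h v
  · rintro ⟨b, rfl⟩
    exact diagonal_integer_mem b

theorem exists_unit_of_mem {x : totallyPositive K} (hx : x ∈ totallyPositiveUnits K) :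
    ∃ u : (𝓞 K)ˣ, algebraMap (𝓞 K) K u = ((x : Kˣ) : K) := by
  obtain ⟨u, hu⟩ := hx
  exact ⟨u, congrArg Units.val hu⟩

theorem exists_unit_inv_of_mem {x : totallyPositive K} (hx : x ∈ totallyPositiveUnits K) :
    ∃ u : (𝓞 K), algebraMap (𝓞 K) K u = ((x : Kˣ) : K)⁻¹ := by
  obtain ⟨u, hu⟩ := exists_unit_of_mem (inv_mem hx)
  exact ⟨u, hu.trans (by simp)⟩

theorem diagonal_unit_mul_mem_iff {x : totallyPositive K} (hx : x ∈ totallyPositiveUnits K)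
    {a : FiniteAdeles K} :
    diagonal K ((x : Kˣ) : K) * a ∈ integralAdeles K ↔ a ∈ integralAdeles K := by
  constructor
  · intro h
    obtain ⟨u, hu⟩ := exists_unit_inv_of_mem hx
    have h2 := mul_mem_integralAdeles (diagonal_integer_mem u) h
    rwa [hu, ← mul_assoc, ← map_mul, inv_mul_cancel₀ (Units.ne_zero _), map_one, one_mul] at h2
  · intro h
    obtain ⟨u, hu⟩ := exists_unit_of_mem hx
    rw [← hu]
    exact mul_mem_integralAdeles (diagonal_integer_mem _) h

/-- The fractional ideal `x O`, as a subgroup of `K`. -/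
def scaledIntegers (x : K) : AddSubgroup K :=
  ((AddMonoidHom.mulLeft x).comp (algebraMap (𝓞 K) K).toAddMonoidHom).range

theorem mem_scaledIntegers {x z : K} :
    z ∈ scaledIntegers x ↔ ∃ b : 𝓞 K, x * algebraMap (𝓞 K) K b = z := Iff.rfl

theorem scaledIntegers_mul_le (x : K) (b : 𝓞 K) :
    scaledIntegers (x * algebraMap (𝓞 K) K b) ≤ scaledIntegers x := by
  rintro _ ⟨c, rfl⟩
  exact ⟨b * c, by simp [mul_assoc]⟩

/-- `[x O : x b O] = N(b)`. -/
theorem relIndex_scaledIntegers {x : K} (hx : x ≠ 0) (b : 𝓞 K) :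
    (scaledIntegers (x * algebraMap (𝓞 K) K b)).relIndex (scaledIntegers x) =
      Ideal.absNorm (Ideal.span {b}) := by
  let f : 𝓞 K →+ K := (AddMonoidHom.mulLeft x).comp (algebraMap (𝓞 K) K).toAddMonoidHom
  have hf : Function.Injective f := fun a c h =>
    RingOfIntegers.coe_injective (mul_left_cancel₀ hx h)
  have h1 : scaledIntegers (x * algebraMap (𝓞 K) K b) =
      (Submodule.toAddSubgroup (Ideal.span {b})).map f := by
    ext z
    rw [mem_scaledIntegers]
    constructor
    · rintro ⟨c, rfl⟩
      exact ⟨b * c, Ideal.mul_mem_right _ _ (Ideal.mem_span_singleton_self b), by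
        simp [f, mul_assoc]⟩
    · rintro ⟨d, hd, rfl⟩
      obtain ⟨c, rfl⟩ := Ideal.mem_span_singleton.1 hd
      exact ⟨c, by simp [f, mul_assoc]⟩
  have h2 : scaledIntegers x = (⊤ : AddSubgroup (𝓞 K)).map f := AddMonoidHom.range_eq_map f
  rw [h1, h2, AddSubgroup.relIndex_map_map_of_injective _ _ hf, AddSubgroup.relIndex_top_right]
  rfl

/-- A sum over the cosets of a subgroup `J` of a function invariant under `L ⊇ J`. -/
theorem finsum_quotient_out {A : Type*} [AddCommGroup A] {J L : AddSubgroup A} (hJL : J ≤ L)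
    (hfin : J.relIndex L ≠ 0) {F : A → ℂ} (hF : ∀ z, ∀ l ∈ L, F (z + l) = F z)
    (hsupp : (Function.support fun q : A ⧸ L => F q.out).Finite) :
    ∑ᶠ q : A ⧸ J, F q.out = J.relIndex L * ∑ᶠ q : A ⧸ L, F q.out := by
  have hout : ∀ (M : AddSubgroup A) (_ : M ≤ L) (z : A), F (Quotient.out (z : A ⧸ M)) = F z := by
    intro M hM z
    obtain ⟨m, hm⟩ := QuotientAddGroup.mk_out_eq_add M z
    rw [hm, hF _ _ (hM m.2)]
  have hfinite : Finite (L ⧸ J.addSubgroupOf L) := by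
    have : (J.addSubgroupOf L).FiniteIndex := ⟨hfin⟩
    exact AddSubgroup.finite_quotient_of_finiteIndex
  let e := AddSubgroup.quotientEquivProdOfLE hJL
  have he : ∀ q : A ⧸ J, F q.out = F (e q).1.out := by
    intro q
    induction q using QuotientAddGroup.induction_on with
    | H z => exact (hout J hJL z).trans (hout L le_rfl z).symm
  have h1 : ∑ᶠ q : A ⧸ J, F q.out = ∑ᶠ p : (A ⧸ L) × (L ⧸ J.addSubgroupOf L), F p.1.out := by
    rw [finsum_congr he]
    exact finsum_comp_equiv e (f := fun p => F p.1.out)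
  rw [h1, finsum_curry]
  · have : Fintype (L ⧸ J.addSubgroupOf L) := Fintype.ofFinite _
    rw [← nsmul_eq_mul, smul_finsum]
    refine finsum_congr fun q => ?_
    rw [finsum_eq_sum_of_fintype]
    change ∑ _i : L ⧸ J.addSubgroupOf L, F q.out = _
    rw [Finset.sum_const, Finset.card_univ, ← Nat.card_eq_fintype_card]
    rfl
  · refine (hsupp.prod (Set.finite_univ (α := L ⧸ J.addSubgroupOf L))).subset ?_
    rintro ⟨q, r⟩ h
    exact ⟨h, trivial⟩

theorem sum_eq_finsum_of_injective {α β : Type*} {s : Finset β} {j : α → β}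
    (hj : Function.Injective j) (hs : ∀ b ∈ s, ∃ a, j a = b) {E : β → ℂ} {F : α → ℂ}
    (hF : ∀ a, j a ∈ s → F a = E (j a)) (hF' : ∀ a, j a ∉ s → F a = 0) :
    (Function.support F).Finite ∧ ∑ d ∈ s, E d = ∑ᶠ a, F a := by
  classical
  have hsub : Function.support F ⊆ j ⁻¹' s := fun a ha => by
    by_contra h
    exact ha (hF' a h)
  have hfin : (j ⁻¹' (s : Set β)).Finite := s.finite_toSet.preimage hj.injOn
  refine ⟨hfin.subset hsub, ?_⟩
  rw [finsum_eq_sum_of_support_subset (s := hfin.toFinset) F (by simpa using hsub)]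
  refine (Finset.sum_bij (fun a _ => j a) (fun a ha => by simpa using ha) (fun a _ b _ h => hj h)
    (fun b hb => ?_) (fun a ha => hF a (by simpa using ha))).symm
  obtain ⟨a, rfl⟩ := hs b hb
  exact ⟨a, by simpa using hb, rfl⟩

theorem mem_integralAxbGroup {g : AxbGroup K} : g ∈ integralAxbGroup K ↔
    g.y ∈ (algebraMap (𝓞 K) K).range ∧ g.x ∈ totallyPositiveUnits K := Iff.rfl

theorem rightCoset_mk_eq_iff {x : totallyPositive K} {z z' : K} :
    rightCoset (integralAxbGroup K) ⟨z, x⟩ = rightCoset (integralAxbGroup K) ⟨z', x⟩ ↔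
      z' - z ∈ scaledIntegers ((x : Kˣ) : K) := by
  rw [rightCoset_eq_iff, mem_integralAxbGroup]
  have hx : ((x : Kˣ) : K) ≠ 0 := Units.ne_zero _
  have h1 : ((⟨z', x⟩ : AxbGroup K) * (⟨z, x⟩ : AxbGroup K)⁻¹).x ∈ totallyPositiveUnits K := by
    simp [one_mem]
  rw [and_iff_left h1, mem_scaledIntegers]
  simp only [RingHom.mem_range, AxbGroup.mul_y, AxbGroup.inv_y, AxbGroup.inv_x]
  refine exists_congr fun b => ?_
  have : (((x⁻¹ : totallyPositive K) : Kˣ) : K) = ((x : Kˣ) : K)⁻¹ := by simp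
  have h2 : (((x : Kˣ)⁻¹ : Kˣ) : K) = ((x : Kˣ) : K)⁻¹ := by simp
  rw [this, h2]
  constructor
  · intro h
    rw [h]
    field_simp
    ring
  · intro h
    rw [← mul_right_inj' hx, h]
    field_simp
    ring

theorem rightCoset_mk_inv_eq_iff {x : totallyPositive K} {z z' : K} :
    rightCoset (integralAxbGroup K) (⟨z, x⟩ : AxbGroup K)⁻¹ =
      rightCoset (integralAxbGroup K) (⟨z', x⟩ : AxbGroup K)⁻¹ ↔ z - z' ∈ scaledIntegers (1 : K) := by
  rw [rightCoset_eq_iff, mem_integralAxbGroup]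
  have h1 : ((⟨z', x⟩ : AxbGroup K)⁻¹ * ((⟨z, x⟩ : AxbGroup K)⁻¹)⁻¹).x ∈ totallyPositiveUnits K := by
    simp [one_mem]
  rw [and_iff_left h1, mem_scaledIntegers, inv_inv]
  simp only [RingHom.mem_range, AxbGroup.mul_y, AxbGroup.inv_y, one_mul]
  refine exists_congr fun b => ?_
  have h2 : (((x : Kˣ)⁻¹ : Kˣ) : K) = ((x : Kˣ) : K)⁻¹ := by simp
  have hx : ((x : Kˣ) : K) ≠ 0 := Units.ne_zero _
  rw [h2, neg_mul, inv_mul_cancel_right₀ hx, ← sub_eq_add_neg]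

/-- Every element of the double coset of `g` lies in the right coset of a matrix with the same lower
right entry as `g`. -/
theorem exists_rightCoset_mk {g h : AxbGroup K}
    (hh : h ∈ DoubleCoset.doubleCoset g (integralAxbGroup K : Set (AxbGroup K)) (integralAxbGroup K)) :
    ∃ b : 𝓞 K, ∃ u ∈ totallyPositiveUnits K,
      rightCoset (integralAxbGroup K) h = rightCoset (integralAxbGroup K)
        ⟨algebraMap (𝓞 K) K b + g.y * ((u : Kˣ) : K), g.x⟩ := by
  obtain ⟨γ, hγ, γ', ⟨⟨b, hb⟩, hu⟩, rfl⟩ := (mem_doubleCoset_iff _).1 hh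
  refine ⟨b, γ'.x, hu, ?_⟩
  rw [mul_assoc, rightCoset_mul_left _ hγ,
    ← rightCoset_mul_left (integralAxbGroup K) (γ := ⟨0, γ'.x⁻¹⟩) ⟨zero_mem _, inv_mem hu⟩]
  congr 1
  ext
  · simp [hb]
  · simp [mul_comm]

theorem x_of_mem_doubleCoset {g h : AxbGroup K}
    (hh : h ∈ DoubleCoset.doubleCoset g (integralAxbGroup K : Set (AxbGroup K)) (integralAxbGroup K)) :
    ∃ u ∈ totallyPositiveUnits K, h.x = u * g.x := by
  obtain ⟨γ, hγ, γ', hγ', rfl⟩ := (mem_doubleCoset_iff _).1 hh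
  exact ⟨γ.x * γ'.x, mul_mem hγ.2 hγ'.2, by simp [mul_right_comm]⟩

variable (K) in
/-- The right cosets in the double coset of `(1, p / q; 0, a / c)` have representatives
`(1, s / q; 0, a / c)` with `s ∈ O`, and depend only on `s` modulo `q a`. -/
theorem isHeckePair_integralAxbGroup : IsHeckePair (integralAxbGroup K) := by
  refine isHeckePair_of_finite _ fun g => ?_
  obtain ⟨p, q, hq, hy⟩ := IsFractionRing.div_surjective (A := 𝓞 K) g.y
  obtain ⟨a, c, hc, hx⟩ := IsFractionRing.div_surjective (A := 𝓞 K) ((g.x : Kˣ) : K)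
  have hq0 : algebraMap (𝓞 K) K q ≠ 0 := IsFractionRing.to_map_ne_zero_of_mem_nonZeroDivisors hq
  have hc0 : algebraMap (𝓞 K) K c ≠ 0 := IsFractionRing.to_map_ne_zero_of_mem_nonZeroDivisors hc
  have ha : a ≠ 0 := by
    rintro rfl
    exact Units.ne_zero (g.x : Kˣ) (by rw [← hx, map_zero, zero_div])
  let Φ : 𝓞 K → RightCosets (integralAxbGroup K) := fun s =>
    rightCoset _ ⟨algebraMap (𝓞 K) K s / algebraMap (𝓞 K) K q, g.x⟩
  let I : Ideal (𝓞 K) := Ideal.span {q * a}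
  have hI : I ≠ ⊥ := by
    rw [Ne, Ideal.span_singleton_eq_bot]
    exact mul_ne_zero (nonZeroDivisors.ne_zero hq) ha
  have hΦ : ∀ s s', s' - s ∈ I → Φ s = Φ s' := by
    intro s s' h
    obtain ⟨t, ht⟩ := Ideal.mem_span_singleton.1 h
    refine rightCoset_mk_eq_iff.2 ⟨c * t, ?_⟩
    change ((g.x : Kˣ) : K) * algebraMap (𝓞 K) K (c * t) = _
    rw [← sub_div, ← map_sub, ht, ← hx]
    simp only [map_mul]
    field_simp
  have hfin : Finite (𝓞 K ⧸ I) := Ideal.finiteQuotientOfFreeOfNeBot I hI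
  refine (Set.finite_range fun r : 𝓞 K ⧸ I => Φ r.out).subset ?_
  rintro _ ⟨h, hh, rfl⟩
  obtain ⟨b, v, hv, e⟩ := exists_rightCoset_mk hh
  obtain ⟨u, hu⟩ := exists_unit_of_mem hv
  have e' : rightCoset (integralAxbGroup K) h = Φ (b * q + p * u) := by
    rw [e]
    congr 2
    rw [← hy, ← hu]
    simp only [map_mul, map_add]
    field_simp
  refine ⟨Ideal.Quotient.mk I (b * q + p * u), ?_⟩
  rw [e']
  refine hΦ _ _ ?_
  rw [← Ideal.Quotient.eq, Ideal.Quotient.mk_out]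

theorem sum_cosetsIn_cosetMul {G : Type*} [Group G] {Γ : Subgroup G} (hΓ : IsHeckePair Γ) (g : G)
    {γ : G} (hγ : γ ∈ Γ) {M : Type*} [AddCommMonoid M] (E : RightCosets Γ → M) :
    ∑ d ∈ cosetsIn hΓ g, E (cosetMul Γ d γ) = ∑ d ∈ cosetsIn hΓ g, E d := by
  refine Finset.sum_bij (fun d _ => cosetMul Γ d γ) (fun d hd => ?_)
    (fun a _ b _ h => cosetMul_injective Γ γ h) (fun d hd => ⟨cosetMul Γ d γ⁻¹, ?_, ?_⟩)
    (fun _ _ => rfl)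
  · induction d using Quotient.ind with
    | _ a => exact (mem_cosetsIn hΓ).2 ((mem_doubleCoset_mul_iff Γ hγ).2 ((mem_cosetsIn hΓ).1 hd))
  · induction d using Quotient.ind with
    | _ a =>
      exact (mem_cosetsIn hΓ).2 ((mem_doubleCoset_mul_iff Γ (inv_mem hγ)).2 ((mem_cosetsIn hΓ).1 hd))
  · rw [← cosetMul_mul, inv_mul_cancel, cosetMul_one]

open Classical in
/-- The function `(Γ (1, y; 0, x), w) ↦ ψ(-y w) 1[x w ∈ Ô]` on `Γ \ P_K^+ × 𝔸_f`. -/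
def cosetCharacter (ψ : AdelicCharacter K) (c : RightCosets (integralAxbGroup K))
    (w : FiniteAdeles K) : ℂ :=
  Quotient.liftOn c (fun g => if diagonal K ((g.x : Kˣ) : K) * w ∈ integralAdeles K then
    ψ (-(diagonal K g.y * w)) else 0) (by
    intro a b hab
    obtain ⟨γ, hγ, rfl⟩ : ∃ γ ∈ integralAxbGroup K, b = γ * a :=
      ⟨b * a⁻¹, QuotientGroup.rightRel_apply.1 hab, by simp⟩
    have e : diagonal K (((γ * a).x : Kˣ) : K) * w =
        diagonal K ((γ.x : Kˣ) : K) * (diagonal K ((a.x : Kˣ) : K) * w) := by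
      rw [← mul_assoc, ← map_mul]
      rfl
    simp only [e, diagonal_unit_mul_mem_iff hγ.2]
    split_ifs with h
    · obtain ⟨b, hb⟩ := hγ.1
      rw [AxbGroup.mul_y, map_add, add_mul, neg_add, ψ.map_add_of_mem]
      refine neg_mem_integralAdeles ?_
      rw [map_mul, mul_assoc, ← hb]
      exact mul_mem_integralAdeles (diagonal_integer_mem b) h
    · rfl)

variable (ψ : AdelicCharacter K)

open Classical in
theorem cosetCharacter_mk (g : AxbGroup K) (w : FiniteAdeles K) :
    cosetCharacter ψ (rightCoset _ g) w =
      if diagonal K ((g.x : Kˣ) : K) * w ∈ integralAdeles K then ψ (-(diagonal K g.y * w)) else 0 :=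
  rfl

theorem cosetCharacter_cosetMul (c : RightCosets (integralAxbGroup K)) (h : AxbGroup K)
    (w : FiniteAdeles K) : cosetCharacter ψ (cosetMul _ c h) w =
      ψ (-(diagonal K h.y * w)) * cosetCharacter ψ c (diagonal K ((h.x : Kˣ) : K) * w) := by
  classical
  induction c using Quotient.ind with
  | _ g =>
  rw [cosetMul_mk, cosetCharacter_mk, cosetCharacter_mk, ← mul_assoc (diagonal K _) _ w, ← map_mul]
  change (if diagonal K (((g.x : Kˣ) : K) * ((h.x : Kˣ) : K)) * w ∈ integralAdeles K then _ else 0) = _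
  split_ifs
  · rw [← ψ.map_add, AxbGroup.mul_y, map_add, add_mul, neg_add, map_mul, mul_assoc]
  · rw [mul_zero]

theorem isClopen_mul_mem (a : FiniteAdeles K) : IsClopen {w | a * w ∈ integralAdeles K} :=
  IsClopen.preimage ⟨(integralAdeles_isCompact K).isClosed, integralAdeles_isOpen K⟩
    (continuous_const.mul continuous_id)

theorem continuous_cosetCharacter (c : RightCosets (integralAxbGroup K)) :
    Continuous (cosetCharacter ψ c) := by
  classical
  induction c using Quotient.ind with
  | _ g =>
  refine Continuous.if (fun w hw => ?_)
    (ψ.continuous.comp (continuous_const.mul continuous_id).neg) continuous_const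
  rw [(isClopen_mul_mem _).frontier_eq] at hw
  exact hw.elim

/-- The sum of the functions of the right cosets in the double coset of `g`. -/
def heckeSum (g : AxbGroup K) (w : FiniteAdeles K) : ℂ :=
  ∑ d ∈ cosetsIn (isHeckePair_integralAxbGroup K) g, cosetCharacter ψ d w

theorem continuous_heckeSum (g : AxbGroup K) : Continuous (heckeSum ψ g) :=
  continuous_finsetSum _ fun _ _ => continuous_cosetCharacter ψ _

/-- Right multiplication by a diagonal matrix with a totally positive unit as entry permutes the right
cosets in a double coset. -/
theorem heckeSum_unit_mul (g : AxbGroup K) {u : totallyPositive K} (hu : u ∈ totallyPositiveUnits K)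
    (w : FiniteAdeles K) : heckeSum ψ g (diagonal K ((u : Kˣ) : K) * w) = heckeSum ψ g w := by
  have hγ : (⟨0, u⟩ : AxbGroup K) ∈ integralAxbGroup K := ⟨zero_mem _, hu⟩
  conv_rhs => rw [heckeSum, ← sum_cosetsIn_cosetMul _ _ hγ]
  refine Finset.sum_congr rfl fun d _ => ?_
  rw [cosetCharacter_cosetMul]
  simp [ψ.map_zero]

/-- The sum is supported in `Ô`: right multiplication by an integral unipotent matrix `(1, -b; 0, 1)`
permutes the right cosets and multiplies the sum by `ψ(b w)`, and these numbers are all one only for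
integral `w`. -/
theorem heckeSum_eq_zero (g : AxbGroup K) {w : FiniteAdeles K} (hw : w ∉ integralAdeles K) :
    heckeSum ψ g w = 0 := by
  by_contra h
  refine hw (ψ.mem_of_eq_one w fun b => ?_)
  have hγ : (⟨-algebraMap (𝓞 K) K b, 1⟩ : AxbGroup K) ∈ integralAxbGroup K :=
    ⟨neg_mem ⟨b, rfl⟩, one_mem _⟩
  have h2 : heckeSum ψ g w = ψ (diagonal K (algebraMap (𝓞 K) K b) * w) * heckeSum ψ g w := by
    conv_lhs => rw [heckeSum, ← sum_cosetsIn_cosetMul _ _ hγ]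
    rw [heckeSum, Finset.mul_sum]
    refine Finset.sum_congr rfl fun d _ => ?_
    rw [cosetCharacter_cosetMul]
    simp
  exact mul_right_cancel₀ h (h2.symm.trans (one_mul _).symm)

/-- The sum is supported in `x⁻¹ Ô`, because all its terms are. -/
theorem heckeSum_eq_zero' (g : AxbGroup K) {w : FiniteAdeles K}
    (hw : diagonal K ((g.x : Kˣ) : K) * w ∉ integralAdeles K) : heckeSum ψ g w = 0 := by
  classical
  refine Finset.sum_eq_zero fun d hd => ?_
  induction d using Quotient.ind with
  | _ h =>
  obtain ⟨u, hu, hx⟩ := x_of_mem_doubleCoset ((mem_cosetsIn _).1 hd)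
  rw [cosetCharacter_mk, if_neg]
  rw [hx, Subgroup.coe_mul, Units.val_mul, map_mul, mul_assoc, diagonal_unit_mul_mem_iff hu]
  exact hw

theorem absoluteNorm_eq {x : Kˣ} {a c : 𝓞 K} (h : (x : K) * algebraMap (𝓞 K) K c = algebraMap (𝓞 K) K a) :
    absoluteNorm K x * Ideal.absNorm (Ideal.span {c}) = Ideal.absNorm (Ideal.span {a}) := by
  have key : ∀ b : 𝓞 K, ((Ideal.absNorm (Ideal.span {b}) : ℕ) : ℚ) =
      |Algebra.norm ℚ (algebraMap (𝓞 K) K b)| := by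
    intro b
    rw [← FractionalIdeal.absNorm_span_singleton (R := 𝓞 K), ← FractionalIdeal.coeIdeal_span_singleton,
      FractionalIdeal.coeIdeal_absNorm]
  have h2 : ((FractionalIdeal.absNorm (FractionalIdeal.spanSingleton (𝓞 K)⁰ (x : K)) : ℚ)) *
      ((Ideal.absNorm (Ideal.span {c}) : ℕ) : ℚ) = ((Ideal.absNorm (Ideal.span {a}) : ℕ) : ℚ) := by
    rw [key, key, FractionalIdeal.absNorm_span_singleton, ← abs_mul, ← map_mul, h]
  unfold absoluteNorm
  exact_mod_cast congrArg (Rat.cast : ℚ → ℝ) h2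

theorem absoluteNorm_mul (x y : Kˣ) : absoluteNorm K (x * y) = absoluteNorm K x * absoluteNorm K y := by
  unfold absoluteNorm
  rw [FractionalIdeal.absNorm_span_singleton, FractionalIdeal.absNorm_span_singleton,
    FractionalIdeal.absNorm_span_singleton, Units.val_mul, map_mul, abs_mul, Rat.cast_mul]

theorem absoluteNorm_pos (x : Kˣ) : 0 < absoluteNorm K x := by
  unfold absoluteNorm
  rw [FractionalIdeal.absNorm_span_singleton, Rat.cast_pos, abs_pos]
  exact (Algebra.norm_ne_zero_iff).2 x.ne_zero

theorem absoluteNorm_one : absoluteNorm K 1 = 1 := by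
  have h := absoluteNorm_mul (K := K) 1 1
  rw [one_mul] at h
  exact (mul_eq_left₀ (absoluteNorm_pos 1).ne').1 h.symm

theorem absoluteNorm_unit {u : totallyPositive K} (hu : u ∈ totallyPositiveUnits K) :
    absoluteNorm K (u : Kˣ) = 1 := by
  obtain ⟨v, hv⟩ := exists_unit_of_mem hu
  have h := absoluteNorm_eq (x := (u : Kˣ)) (c := 1) (a := v) (by rw [map_one, mul_one, hv])
  rw [Ideal.span_singleton_eq_top.2 isUnit_one, Ideal.span_singleton_eq_top.2 v.isUnit] at h
  simpa using h

/-- Passing to the inverse double coset: if `M` is the set of `z` with `(1, z; 0, x) ∈ Γ g Γ`, then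
up to the indicator functions the two sides are sums of the same function of `z` over `M / O` and
`M / x O`; both are compared with the sum over `M / a O`, for an element `a` of `O ∩ x O`. -/
theorem heckeSum_inv (g : AxbGroup K) (w : FiniteAdeles K) :
    heckeSum ψ g w = absoluteNorm K (g.x : Kˣ) *
      star (heckeSum ψ g⁻¹ (diagonal K ((g.x : Kˣ) : K) * w)) := by
  classical
  have hx0 : ((g.x : Kˣ) : K) ≠ 0 := Units.ne_zero _
  by_cases hw : w ∈ integralAdeles K
  swap
  · rw [heckeSum_eq_zero ψ g hw, heckeSum_eq_zero' ψ g⁻¹, star_zero, mul_zero]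
    rwa [← mul_assoc, ← map_mul, AxbGroup.inv_x, InvMemClass.coe_inv, Units.inv_mul, map_one, one_mul]
  by_cases hxw : diagonal K ((g.x : Kˣ) : K) * w ∈ integralAdeles K
  swap
  · rw [heckeSum_eq_zero' ψ g hxw, heckeSum_eq_zero ψ g⁻¹ hxw, star_zero, mul_zero]
  let F : K → ℂ := fun z => if (⟨z, g.x⟩ : AxbGroup K) ∈ DoubleCoset.doubleCoset g
    (integralAxbGroup K : Set (AxbGroup K)) (integralAxbGroup K) then ψ (-(diagonal K z * w)) else 0
  have hF1 : ∀ z, ∀ l ∈ scaledIntegers (1 : K), F (z + l) = F z := by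
    rintro z _ ⟨b, rfl⟩
    have hγ : (⟨algebraMap (𝓞 K) K b, 1⟩ : AxbGroup K) ∈ integralAxbGroup K := ⟨⟨b, rfl⟩, one_mem _⟩
    have e : (⟨z + algebraMap (𝓞 K) K b, g.x⟩ : AxbGroup K) =
        ⟨z, g.x⟩ * ⟨algebraMap (𝓞 K) K b, 1⟩ := by
      ext
      · simp [add_comm]
      · simp
    change F (z + 1 * algebraMap (𝓞 K) K b) = F z
    simp only [F]
    rw [one_mul, e, mem_doubleCoset_mul_iff _ hγ, map_add, add_mul, neg_add, ψ.map_add_of_mem]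
    exact neg_mem_integralAdeles (mul_mem_integralAdeles (diagonal_integer_mem b) hw)
  have hFx : ∀ z, ∀ l ∈ scaledIntegers ((g.x : Kˣ) : K), F (z + l) = F z := by
    rintro z _ ⟨b, rfl⟩
    have hγ : (⟨algebraMap (𝓞 K) K b, 1⟩ : AxbGroup K) ∈ integralAxbGroup K := ⟨⟨b, rfl⟩, one_mem _⟩
    have e : (⟨z + ((g.x : Kˣ) : K) * algebraMap (𝓞 K) K b, g.x⟩ : AxbGroup K) =
        ⟨algebraMap (𝓞 K) K b, 1⟩ * ⟨z, g.x⟩ := by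
      ext
      · simp [mul_comm]
      · simp
    change F (z + ((g.x : Kˣ) : K) * algebraMap (𝓞 K) K b) = F z
    simp only [F]
    rw [e, mul_mem_doubleCoset_iff _ hγ, map_add, add_mul, neg_add, ψ.map_add_of_mem]
    rw [mul_comm ((g.x : Kˣ) : K), map_mul, mul_assoc]
    exact neg_mem_integralAdeles (mul_mem_integralAdeles (diagonal_integer_mem b) hxw)
  have hq : ∀ (L : AddSubgroup K) (q q' : K ⧸ L), q'.out - q.out ∈ L → q = q' := by
    intro L q q' h
    have := (QuotientAddGroup.eq (s := L) (a := q.out) (b := q'.out)).2 (by rwa [neg_add_eq_sub])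
    rwa [QuotientAddGroup.out_eq', QuotientAddGroup.out_eq'] at this
  have hq' : ∀ (L : AddSubgroup K) (z : K), (z : K ⧸ L).out - z ∈ L := by
    intro L z
    obtain ⟨l, hl⟩ := QuotientAddGroup.mk_out_eq_add L z
    rw [hl, add_sub_cancel_left]
    exact l.2
  -- the sum over `M / x O`
  obtain ⟨hsx, hsumx⟩ := sum_eq_finsum_of_injective
    (s := cosetsIn (isHeckePair_integralAxbGroup K) g)
    (j := fun q : K ⧸ scaledIntegers ((g.x : Kˣ) : K) => rightCoset (integralAxbGroup K) ⟨q.out, g.x⟩)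
    (fun q q' h => hq _ _ _ (rightCoset_mk_eq_iff.1 h)) (fun d hd => by
      induction d using Quotient.ind with
      | _ h =>
      obtain ⟨b, u, -, e⟩ := exists_rightCoset_mk ((mem_cosetsIn _).1 hd)
      refine ⟨(algebraMap (𝓞 K) K b + g.y * ((u : Kˣ) : K) : K), ?_⟩
      refine Eq.trans ?_ e.symm
      rw [rightCoset_mk_eq_iff, ← neg_mem_iff, neg_sub]
      exact hq' _ _) (E := fun d => cosetCharacter ψ d w) (F := fun q => F q.out)
    (fun q hj => by
      simp only [F]
      rw [if_pos ((mem_cosetsIn _).1 hj), cosetCharacter_mk, if_pos hxw])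
    (fun q hj => if_neg fun h => hj ((mem_cosetsIn _).2 h))
  -- the sum over `M / O`
  obtain ⟨hs1, hsum1⟩ := sum_eq_finsum_of_injective
    (s := cosetsIn (isHeckePair_integralAxbGroup K) g⁻¹)
    (j := fun q : K ⧸ scaledIntegers (1 : K) =>
      rightCoset (integralAxbGroup K) (⟨q.out, g.x⟩ : AxbGroup K)⁻¹)
    (fun q q' h => (hq _ _ _ (rightCoset_mk_inv_eq_iff.1 h)).symm) (fun d hd => by
      induction d using Quotient.ind with
      | _ h =>
      obtain ⟨b, u, -, e⟩ := exists_rightCoset_mk ((mem_cosetsIn _).1 hd)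
      refine ⟨(-((algebraMap (𝓞 K) K b + g⁻¹.y * ((u : Kˣ) : K)) * ((g.x : Kˣ) : K)) : K), ?_⟩
      refine Eq.trans ?_ e.symm
      have e2 : (⟨algebraMap (𝓞 K) K b + g⁻¹.y * ((u : Kˣ) : K), g⁻¹.x⟩ : AxbGroup K) =
          (⟨-((algebraMap (𝓞 K) K b + g⁻¹.y * ((u : Kˣ) : K)) * ((g.x : Kˣ) : K)), g.x⟩ :
            AxbGroup K)⁻¹ := by
        ext
        · simp
        · simp
      rw [e2, rightCoset_mk_inv_eq_iff]
      exact hq' _ _)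
    (E := fun d => star (cosetCharacter ψ d (diagonal K ((g.x : Kˣ) : K) * w)))
    (F := fun q => F q.out)
    (fun q hj => by
      have h1 := (inv_mem_doubleCoset_inv _).1 ((mem_cosetsIn _).1 hj)
      have e2 : diagonal K (((⟨q.out, g.x⟩ : AxbGroup K)⁻¹.x : Kˣ) : K) *
          (diagonal K ((g.x : Kˣ) : K) * w) = w := by
        rw [← mul_assoc, ← map_mul, AxbGroup.inv_x, InvMemClass.coe_inv, Units.inv_mul, map_one, one_mul]
      have e3 : diagonal K (⟨q.out, g.x⟩ : AxbGroup K)⁻¹.y *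
          (diagonal K ((g.x : Kˣ) : K) * w) = -(diagonal K q.out * w) := by
        rw [← mul_assoc, ← map_mul, AxbGroup.inv_y, neg_mul, Units.inv_mul_cancel_right, map_neg, neg_mul]
      simp only [F]
      rw [if_pos h1, cosetCharacter_mk, e2, if_pos hw, e3, neg_neg, ← ψ.map_neg])
    (fun q hj => if_neg fun h => hj ((mem_cosetsIn _).2 ((inv_mem_doubleCoset_inv _).2 h)))
  obtain ⟨a, c, hc, hx⟩ := IsFractionRing.div_surjective (A := 𝓞 K) ((g.x : Kˣ) : K)
  have hc0 : algebraMap (𝓞 K) K c ≠ 0 := IsFractionRing.to_map_ne_zero_of_mem_nonZeroDivisors hc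
  have hc' : c ≠ 0 := nonZeroDivisors.ne_zero hc
  have ha : a ≠ 0 := by
    rintro rfl
    exact hx0 (by rw [← hx, map_zero, zero_div])
  have hxc : ((g.x : Kˣ) : K) * algebraMap (𝓞 K) K c = algebraMap (𝓞 K) K a := by
    rw [← hx, div_mul_cancel₀ _ hc0]
  have hJ : scaledIntegers ((1 : K) * algebraMap (𝓞 K) K a) =
      scaledIntegers (((g.x : Kˣ) : K) * algebraMap (𝓞 K) K c) := by rw [one_mul, hxc]
  have hne : ∀ b : 𝓞 K, b ≠ 0 → Ideal.absNorm (Ideal.span {b}) ≠ 0 := by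
    intro b hb
    rwa [Ne, Ideal.absNorm_eq_zero_iff, Ideal.span_singleton_eq_bot]
  have h1 := finsum_quotient_out (scaledIntegers_mul_le 1 a)
    (by rw [relIndex_scaledIntegers one_ne_zero]; exact hne a ha) hF1 hs1
  have h2 := finsum_quotient_out (scaledIntegers_mul_le ((g.x : Kˣ) : K) c)
    (by rw [relIndex_scaledIntegers hx0]; exact hne c hc') hFx hsx
  rw [relIndex_scaledIntegers one_ne_zero, hJ, h2, relIndex_scaledIntegers hx0, ← hsumx, ← hsum1,
    ← Complex.ofReal_natCast, ← Complex.ofReal_natCast, ← absoluteNorm_eq hxc] at h1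
  have hN : ((Ideal.absNorm (Ideal.span {c}) : ℝ) : ℂ) ≠ 0 := by exact_mod_cast hne c hc'
  refine mul_left_cancel₀ hN (h1.trans ?_)
  rw [heckeSum, star_sum]
  push_cast
  ring

end AxbHeckePair

/-! ### Double cosets in the crossed product -/

section Crossed

variable {X G : Type u} [TopologicalSpace X] [Group G] [MulAction G X] [ContinuousConstSMul G X]

theorem translate_inv_apply (g : G) (f : C₀(X, ℂ)) (x : X) : translate g⁻¹ f x = f (g • x) := by
  rw [translate_apply, inv_inv]

theorem monomial_one_mul (f f' : C₀(X, ℂ)) (g : G) :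
    monomial f 1 * monomial f' g = monomial (f * f') g := by
  rw [monomial_mul, one_mul, translate_one]

end Crossed

section HeckeElements

open IsDedekindDomain HeightOneSpectrum NumberField

variable {K : Type u} [Field K] [NumberField K]

/-- A function on `𝔸_f` which is invariant under `O^*_+` is invariant under its closure. -/
theorem unitsClosure_smul_eq {F : FiniteAdeles K → ℂ} (hc : Continuous F)
    (hu : ∀ u ∈ totallyPositiveUnits K, ∀ w, F (diagonal K ((u : Kˣ) : K) * w) = F w)
    {h : (FiniteAdeles K)ˣ} (hh : h ∈ unitsClosure K) (w : FiniteAdeles K) : F (h • w) = F w := by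
  have hcl : IsClosed {h : (FiniteAdeles K)ˣ | F (h • w) = F w} :=
    isClosed_eq (hc.comp (Units.continuous_val.mul continuous_const :
      Continuous fun h : (FiniteAdeles K)ˣ => h.1 * w)) continuous_const
  refine closure_minimal ?_ hcl hh
  rintro _ ⟨_, ⟨x, hx, rfl⟩, rfl⟩
  exact hu x hx w

variable (K) in
theorem continuous_mk : Continuous (AdeleQuotient.mk K) := continuous_quotient_mk'

/-- The function on the adele quotient defined by an `O^*_+`-invariant function supported in `Ô`. -/
def integralFunction (F : FiniteAdeles K → ℂ) (hc : Continuous F)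
    (hu : ∀ u ∈ totallyPositiveUnits K, ∀ w, F (diagonal K ((u : Kˣ) : K) * w) = F w)
    (h0 : ∀ w ∉ integralAdeles K, F w = 0) : C₀(AdeleQuotient K, ℂ) where
  toFun ω := Quotient.liftOn ω F (by
    intro a b hab
    obtain ⟨h, rfl⟩ := (MulAction.orbitRel_apply).1 hab
    exact unitsClosure_smul_eq hc hu h.2 b)
  continuous_toFun := by
    have hq : Topology.IsQuotientMap (AdeleQuotient.mk K) := isQuotientMap_quot_mk
    exact hq.continuous_iff.2 hc
  zero_at_infty' := by
    refine tendsto_const_nhds.congr' ?_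
    filter_upwards [(integralQuotient_isCompact K).compl_mem_cocompact] with x hx
    induction x using Quotient.ind with
    | _ a => exact (h0 a fun ha => hx ⟨a, ha, rfl⟩).symm

theorem integralIndicator_mk {w : FiniteAdeles K} (hw : w ∈ integralAdeles K) :
    integralIndicator K (AdeleQuotient.mk K w) = 1 :=
  Set.indicator_of_mem (s := integralQuotient K) ⟨w, hw, rfl⟩ _

theorem integralIndicator_mk_of_notMem {w : FiniteAdeles K} (hw : w ∉ integralAdeles K) :
    integralIndicator K (AdeleQuotient.mk K w) = 0 :=
  Set.indicator_of_notMem (fun h => hw (by rwa [← mk_preimage_integralQuotient])) _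

theorem adeleQuotient_ext {f g : C₀(AdeleQuotient K, ℂ)}
    (h : ∀ w, f (AdeleQuotient.mk K w) = g (AdeleQuotient.mk K w)) : f = g := by
  ext x
  induction x using Quotient.ind with
  | _ a => exact h a

variable (K) in
/-- The absolute norm on `K^*_+ / O^*_+`. -/
def classNorm : PrincipalGroup K →* ℝ :=
  QuotientGroup.lift (totallyPositiveUnits K)
    { toFun := fun x => absoluteNorm K (x : Kˣ)
      map_one' := absoluteNorm_one
      map_mul' := fun _ _ => absoluteNorm_mul _ _ } fun _ hu => absoluteNorm_unit hu

theorem classNorm_mk (x : totallyPositive K) :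
    classNorm K (x : PrincipalGroup K) = absoluteNorm K (x : Kˣ) := rfl

theorem classNorm_pos (q : PrincipalGroup K) : 0 < classNorm K q := by
  induction q using QuotientGroup.induction_on with
  | _ x => exact absoluteNorm_pos _

/-- The weight `N_K(x)^{-1/2}`. -/
def normWeight (q : PrincipalGroup K) : ℂ := ((Real.sqrt (classNorm K q))⁻¹ : ℝ)

theorem normWeight_mul (p q : PrincipalGroup K) :
    normWeight (p * q) = normWeight p * normWeight q := by
  rw [normWeight, map_mul, Real.sqrt_mul (classNorm_pos p).le, mul_inv, Complex.ofReal_mul]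
  rfl

theorem normWeight_one : normWeight (1 : PrincipalGroup K) = 1 := by
  simp [normWeight]

theorem normWeight_ne_zero (q : PrincipalGroup K) : normWeight q ≠ 0 := by
  rw [normWeight, Complex.ofReal_ne_zero]
  exact inv_ne_zero (Real.sqrt_ne_zero'.2 (classNorm_pos q))

theorem star_normWeight (q : PrincipalGroup K) : star (normWeight q) = normWeight q :=
  Complex.conj_ofReal _

theorem normWeight_mul_classNorm (q : PrincipalGroup K) :
    normWeight q * classNorm K q = normWeight q⁻¹ := by
  have hinv : classNorm K q⁻¹ = (classNorm K q)⁻¹ :=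
    eq_inv_of_mul_eq_one_left (by rw [← map_mul, inv_mul_cancel, map_one])
  rw [normWeight, normWeight, ← Complex.ofReal_mul, hinv, Real.sqrt_inv, inv_inv]
  congr 1
  have h := Real.sqrt_pos.2 (classNorm_pos q)
  nth_rw 2 [← Real.mul_self_sqrt (classNorm_pos q).le]
  rw [inv_mul_cancel_left₀ h.ne']

/-- The action of `K^*_+ / O^*_+` in coordinates. -/
theorem smul_mk (x : totallyPositive K) (w : FiniteAdeles K) :
    (x : PrincipalGroup K) • AdeleQuotient.mk K w =
      AdeleQuotient.mk K (diagonal K ((x : Kˣ) : K) * w) := rfl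

theorem inv_smul_mk (x : totallyPositive K) (w : FiniteAdeles K) :
    (x : PrincipalGroup K)⁻¹ • AdeleQuotient.mk K w =
      AdeleQuotient.mk K (diagonal K (((x : Kˣ) : K)⁻¹) * w) := by
  rw [← QuotientGroup.mk_inv, smul_mk]
  simp

theorem diagonal_mul_inv_cancel (x : Kˣ) (w : FiniteAdeles K) :
    diagonal K (x : K) * (diagonal K ((x : K)⁻¹) * w) = w := by
  rw [← mul_assoc, ← map_mul, mul_inv_cancel₀ x.ne_zero, map_one, one_mul]

theorem diagonal_inv_mul_cancel (x : Kˣ) (w : FiniteAdeles K) :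
    diagonal K ((x : K)⁻¹) * (diagonal K (x : K) * w) = w := by
  rw [← mul_assoc, ← map_mul, inv_mul_cancel₀ x.ne_zero, map_one, one_mul]

variable (ψ : AdelicCharacter K)

/-- The function `w ↦ N_K(x)^{-1/2} S_g(x⁻¹ w)`, where `S_g` is the sum of the characters of the
right cosets in the double coset of `g = (1, y; 0, x)`. -/
def heckeSymbol (g : AxbGroup K) : C₀(AdeleQuotient K, ℂ) :=
  integralFunction
    (fun w => normWeight (g.x : PrincipalGroup K) * heckeSum ψ g (diagonal K (((g.x : Kˣ) : K)⁻¹) * w))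
    (continuous_const.mul ((continuous_heckeSum ψ g).comp (continuous_const.mul continuous_id)))
    (fun u hu w => by rw [mul_left_comm, heckeSum_unit_mul ψ g hu])
    (fun w hw => by
      rw [heckeSum_eq_zero' ψ g, mul_zero]
      rwa [diagonal_mul_inv_cancel])

theorem heckeSymbol_mk (g : AxbGroup K) (w : FiniteAdeles K) :
    heckeSymbol ψ g (AdeleQuotient.mk K w) = normWeight (g.x : PrincipalGroup K) *
      heckeSum ψ g (diagonal K (((g.x : Kˣ) : K)⁻¹) * w) := rfl

/-- The element of the crossed product which corresponds to the double coset of `g`. -/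
def heckeElement (g : AxbGroup K) : crossedProduct (AdeleQuotient K) (PrincipalGroup K) :=
  crossedMonomial (heckeSymbol ψ g) (g.x : PrincipalGroup K)

theorem coe_heckeElement (g : AxbGroup K) :
    (heckeElement ψ g : UniversalOperators (AdeleQuotient K) (PrincipalGroup K)) =
      monomial (heckeSymbol ψ g) (g.x : PrincipalGroup K) := rfl

theorem star_heckeElement (g : AxbGroup K) : star (heckeElement ψ g) = heckeElement ψ g⁻¹ := by
  refine Subtype.ext ?_
  change star (monomial (heckeSymbol ψ g) (g.x : PrincipalGroup K)) = _
  rw [star_monomial, coe_heckeElement, AxbGroup.inv_x, QuotientGroup.mk_inv]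
  congr 1
  refine adeleQuotient_ext fun w => ?_
  rw [translate_inv_apply, smul_mk, heckeSymbol_mk]
  change star (heckeSymbol ψ g (AdeleQuotient.mk K _)) = _
  rw [heckeSymbol_mk, diagonal_inv_mul_cancel, heckeSum_inv, AxbGroup.inv_x, QuotientGroup.mk_inv,
    InvMemClass.coe_inv, Units.val_inv_eq_inv_val, inv_inv, ← normWeight_mul_classNorm, star_mul', star_mul',
    star_normWeight, star_star, classNorm_mk, mul_assoc]
  congr 2
  exact Complex.conj_ofReal _

theorem integralProjection_mul_heckeElement (g : AxbGroup K) :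
    integralProjection K * heckeElement ψ g = heckeElement ψ g := by
  refine Subtype.ext ?_
  change monomial (integralIndicator K) 1 * monomial (heckeSymbol ψ g) (g.x : PrincipalGroup K) =
    monomial (heckeSymbol ψ g) (g.x : PrincipalGroup K)
  rw [monomial_one_mul]
  congr 1
  refine adeleQuotient_ext fun w => ?_
  rw [ZeroAtInftyContinuousMap.coe_mul, Pi.mul_apply]
  by_cases hw : w ∈ integralAdeles K
  · rw [integralIndicator_mk hw, one_mul]
  · rw [heckeSymbol_mk, heckeSum_eq_zero' ψ g (by rwa [diagonal_mul_inv_cancel]), mul_zero, mul_zero]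

theorem heckeElement_mem_adelicCorner (g : AxbGroup K) : heckeElement ψ g ∈ adelicCorner K := by
  refine ⟨integralProjection_mul_heckeElement ψ g, ?_⟩
  have h := congrArg star (integralProjection_mul_heckeElement ψ g⁻¹)
  have hp : star (integralProjection K) = integralProjection K :=
    (integralProjection_isStarProjection K).isSelfAdjoint
  rwa [star_mul, star_heckeElement, inv_inv, hp] at h

theorem heckeSum_zero (g : AxbGroup K) :
    heckeSum ψ g 0 = (cosetsIn (isHeckePair_integralAxbGroup K) g).card := by
  classical
  rw [heckeSum, Finset.sum_congr rfl (g := fun _ => (1 : ℂ)), Finset.sum_const, nsmul_one]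
  intro d _
  induction d using Quotient.ind with
  | _ h =>
  rw [cosetCharacter_mk, mul_zero, mul_zero, neg_zero, if_pos (AdelicCharacter.zero_mem_integralAdeles K), ψ.map_zero]

/-- `heckeSum_inv` at the adele zero, where the sums count right cosets. -/
theorem modularFunction_integralAxbGroup (g : AxbGroup K) :
    modularFunction (integralAxbGroup K) g = (absoluteNorm K (g.x : Kˣ))⁻¹ := by
  obtain ⟨ψ⟩ := exists_adelic_character K
  have h := heckeSum_inv ψ g 0
  rw [mul_zero, heckeSum_zero, heckeSum_zero, star_natCast] at h
  have h' : ((cosetsIn (isHeckePair_integralAxbGroup K) g).card : ℝ) =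
      absoluteNorm K (g.x : Kˣ) * (cosetsIn (isHeckePair_integralAxbGroup K) g⁻¹).card := by
    exact_mod_cast h
  have h0 : ((cosetsIn (isHeckePair_integralAxbGroup K) g⁻¹).card : ℝ) ≠ 0 := by
    rw [Nat.cast_ne_zero, Finset.card_ne_zero]
    exact ⟨rightCoset _ g⁻¹, (mem_cosetsIn _).2 ((mem_doubleCoset_iff _).2
      ⟨1, one_mem _, 1, one_mem _, by simp⟩)⟩
  rw [modularFunction_eq (isHeckePair_integralAxbGroup K), h', mul_comm, div_mul_cancel_left₀ h0]

end HeckeElements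

/-! ### The correspondence between Hecke operators and the crossed product -/

section Linking

open IsDedekindDomain HeightOneSpectrum NumberField

variable {K : Type u} [Field K] [NumberField K]

theorem mk_mul_eq (a b : AxbGroup K) : ((a * b).x : PrincipalGroup K) =
    (a.x : PrincipalGroup K) * (b.x : PrincipalGroup K) := rfl

theorem mul_smul_mk (x y : totallyPositive K) (w : FiniteAdeles K) :
    ((x : PrincipalGroup K) * (y : PrincipalGroup K)) • AdeleQuotient.mk K w =
      AdeleQuotient.mk K (diagonal K ((x : Kˣ) : K) * (diagonal K ((y : Kˣ) : K) * w)) := by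
  rw [← mul_assoc, ← map_mul]
  rfl

/-- The class in `K^*_+ / O^*_+` of the lower right entry of the matrices in a right coset. -/
def cosetClass (c : RightCosets (integralAxbGroup K)) : PrincipalGroup K :=
  Quotient.liftOn c (fun g => (g.x : PrincipalGroup K)) (by
    intro a b hab
    obtain ⟨γ, hγ, rfl⟩ : ∃ γ ∈ integralAxbGroup K, b = γ * a :=
      ⟨b * a⁻¹, QuotientGroup.rightRel_apply.1 hab, by simp⟩
    rw [mk_mul_eq, (QuotientGroup.eq_one_iff γ.x).2 hγ.2]
    exact (one_mul (_ : PrincipalGroup K)).symm)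

theorem cosetClass_mk (g : AxbGroup K) :
    cosetClass (rightCoset _ g) = (g.x : PrincipalGroup K) := rfl

variable (ψ : AdelicCharacter K)

/-- The image in `ℓ²(K^*_+ / O^*_+)` of the basis vector of a right coset, under the map which
intertwines the Hecke operators with the elements of the crossed product in the representation
attached to the orbit of `w`. -/
def cosetVector (w : FiniteAdeles K) (c : RightCosets (integralAxbGroup K)) :
    lp (fun _ : PrincipalGroup K => ℂ) 2 :=
  (normWeight (cosetClass c) * cosetCharacter ψ c w) • delta (cosetClass c)

/-- An operator on `ℓ²(Γ \ P_K^+)` which preserves the finitely supported functions, and an element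
of the crossed product, which are intertwined by the maps `cosetVector`. -/
def Intertwined (T : CosetL2 (integralAxbGroup K) →L[ℂ] CosetL2 (integralAxbGroup K))
    (a : UniversalOperators (AdeleQuotient K) (PrincipalGroup K)) : Prop :=
  ∃ T₀ : (RightCosets (integralAxbGroup K) →₀ ℂ) →ₗ[ℂ] (RightCosets (integralAxbGroup K) →₀ ℂ),
    (∀ ξ, Finsupp.linearCombination ℂ delta (T₀ ξ) = T (Finsupp.linearCombination ℂ delta ξ)) ∧
    ∀ w ξ, Finsupp.linearCombination ℂ (cosetVector ψ w) (T₀ ξ) =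
      orbitEval (AdeleQuotient.mk K w) a (Finsupp.linearCombination ℂ (cosetVector ψ w) ξ)

variable {ψ}

theorem Intertwined.zero : Intertwined ψ 0 0 :=
  ⟨0, fun ξ => by simp, fun w ξ => by simp⟩

theorem Intertwined.add {S T : CosetL2 (integralAxbGroup K) →L[ℂ] CosetL2 (integralAxbGroup K)}
    {a b : UniversalOperators (AdeleQuotient K) (PrincipalGroup K)}
    (h : Intertwined ψ S a) (h' : Intertwined ψ T b) : Intertwined ψ (S + T) (a + b) := by
  obtain ⟨S₀, h1, h2⟩ := h
  obtain ⟨T₀, h3, h4⟩ := h'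
  refine ⟨S₀ + T₀, fun ξ => ?_, fun w ξ => ?_⟩
  · rw [LinearMap.add_apply, map_add, h1, h3]
    rfl
  · rw [LinearMap.add_apply, map_add, h2, h4, map_add]
    rfl

theorem Intertwined.smul (c : ℂ) {T : CosetL2 (integralAxbGroup K) →L[ℂ] CosetL2 (integralAxbGroup K)}
    {a : UniversalOperators (AdeleQuotient K) (PrincipalGroup K)}
    (h : Intertwined ψ T a) : Intertwined ψ (c • T) (c • a) := by
  obtain ⟨T₀, h1, h2⟩ := h
  refine ⟨c • T₀, fun ξ => ?_, fun w ξ => ?_⟩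
  · rw [LinearMap.smul_apply, map_smul, h1]
    rfl
  · rw [LinearMap.smul_apply, map_smul, h2, map_smul]
    rfl

theorem Intertwined.mul {S T : CosetL2 (integralAxbGroup K) →L[ℂ] CosetL2 (integralAxbGroup K)}
    {a b : UniversalOperators (AdeleQuotient K) (PrincipalGroup K)}
    (h : Intertwined ψ S a) (h' : Intertwined ψ T b) : Intertwined ψ (S * T) (a * b) := by
  obtain ⟨S₀, h1, h2⟩ := h
  obtain ⟨T₀, h3, h4⟩ := h'
  refine ⟨S₀ ∘ₗ T₀, fun ξ => ?_, fun w ξ => ?_⟩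
  · rw [LinearMap.comp_apply, h1, h3, mul_apply_eq_comp]
  · rw [LinearMap.comp_apply, h2, h4, map_mul, mul_apply_eq_comp]

/-- The reason for the weight `N_K(x)^{-1/2}` is only that it makes `star` correspond to the adjoint; the
intertwining relation itself holds because the weight is multiplicative. -/
theorem orbitEval_heckeElement_cosetVector (w : FiniteAdeles K) (g h : AxbGroup K) :
    orbitEval (AdeleQuotient.mk K w)
      (heckeElement ψ g : UniversalOperators (AdeleQuotient K) (PrincipalGroup K))
      (cosetVector ψ w (rightCoset _ h)) =
    ∑ d ∈ cosetsIn (isHeckePair_integralAxbGroup K) g, cosetVector ψ w (cosetMul _ d h) := by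
  classical
  have h1 : ∀ d ∈ cosetsIn (isHeckePair_integralAxbGroup K) g, cosetVector ψ w (cosetMul _ d h) =
      ((normWeight (g.x : PrincipalGroup K) * normWeight (h.x : PrincipalGroup K) *
        ψ (-(diagonal K h.y * w))) * cosetCharacter ψ d (diagonal K ((h.x : Kˣ) : K) * w)) •
          (delta ((g.x : PrincipalGroup K) * (h.x : PrincipalGroup K)) :
            lp (fun _ : PrincipalGroup K => ℂ) 2) := by
    intro d hd
    rw [cosetVector, cosetCharacter_cosetMul]
    induction d using Quotient.ind with
    | _ k =>
    obtain ⟨u, hu, hx⟩ := x_of_mem_doubleCoset ((mem_cosetsIn _).1 hd)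
    have e : cosetClass (cosetMul (integralAxbGroup K) (rightCoset _ k) h) =
        (g.x : PrincipalGroup K) * (h.x : PrincipalGroup K) := by
      rw [cosetMul_mk, cosetClass_mk, mk_mul_eq, hx, QuotientGroup.mk_mul,
        (QuotientGroup.eq_one_iff u).2 hu]
      exact congrArg (· * (h.x : PrincipalGroup K)) (one_mul (_ : PrincipalGroup K))
    rw [e, normWeight_mul, mul_assoc _ (ψ _)]
  rw [Finset.sum_congr rfl h1, ← Finset.sum_smul, ← Finset.mul_sum]
  rw [cosetVector, map_smul, coe_heckeElement, orbitEval_monomial_delta, cosetClass_mk, smul_smul,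
    mul_smul_mk, heckeSymbol_mk, diagonal_inv_mul_cancel, cosetCharacter_mk]
  congr 1
  change _ = _ * heckeSum ψ g _
  split_ifs with hw
  · ring
  · rw [heckeSum_eq_zero ψ g hw]
    ring

variable (ψ) in
theorem intertwined_heckeOp (g : AxbGroup K) :
    Intertwined ψ (heckeOp (isHeckePair_integralAxbGroup K) g)
      (heckeElement ψ g : UniversalOperators (AdeleQuotient K) (PrincipalGroup K)) := by
  refine ⟨Finsupp.linearCombination ℂ fun c =>
    ∑ d ∈ cosetsIn (isHeckePair_integralAxbGroup K) g, Finsupp.single (cosetMul _ d c.out) 1,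
    fun ξ => ?_, fun w ξ => ?_⟩
  · induction ξ using Finsupp.induction_linear with
    | zero => simp
    | add ξ η hξ hη => simp only [map_add, hξ, hη]
    | single c z =>
      rw [Finsupp.linearCombination_single, Finsupp.linearCombination_single, map_smul, map_sum]
      conv_rhs => rw [← rightCoset_out _ c, map_smul, heckeOp_delta]
      congr 1
      refine Finset.sum_congr rfl fun d _ => ?_
      rw [Finsupp.linearCombination_single, one_smul]
  · induction ξ using Finsupp.induction_linear with
    | zero => simp
    | add ξ η hξ hη => simp only [map_add, hξ, hη]
    | single c z =>
      rw [Finsupp.linearCombination_single, Finsupp.linearCombination_single, map_smul, map_sum]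
      conv_rhs => rw [← rightCoset_out _ c, map_smul, orbitEval_heckeElement_cosetVector]
      congr 1
      refine Finset.sum_congr rfl fun d _ => ?_
      rw [Finsupp.linearCombination_single, one_smul]

variable (ψ) in
/-- The `*`-algebra generated by the pairs of a Hecke operator and the corresponding element of the
crossed product. -/
def heckeCorrespondence : NonUnitalStarSubalgebra ℂ
    ((CosetL2 (integralAxbGroup K) →L[ℂ] CosetL2 (integralAxbGroup K)) ×
      crossedProduct (AdeleQuotient K) (PrincipalGroup K)) :=
  NonUnitalStarAlgebra.adjoin ℂ (Set.range fun g =>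
    (heckeOp (isHeckePair_integralAxbGroup K) g, heckeElement ψ g))

theorem intertwined_of_mem {x : (CosetL2 (integralAxbGroup K) →L[ℂ] CosetL2 (integralAxbGroup K)) ×
      crossedProduct (AdeleQuotient K) (PrincipalGroup K)} (hx : x ∈ heckeCorrespondence ψ) :
    Intertwined ψ x.1 (x.2 : UniversalOperators (AdeleQuotient K) (PrincipalGroup K)) := by
  suffices h : Intertwined ψ x.1 (x.2 : UniversalOperators (AdeleQuotient K) (PrincipalGroup K)) ∧
      Intertwined ψ (star x).1 ((star x).2 : UniversalOperators (AdeleQuotient K) (PrincipalGroup K))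
    from h.1
  refine NonUnitalStarAlgebra.adjoin_induction (R := ℂ)
    (p := fun x _ => Intertwined ψ x.1 (x.2 : UniversalOperators (AdeleQuotient K) (PrincipalGroup K)) ∧
      Intertwined ψ (star x).1 ((star x).2 : UniversalOperators (AdeleQuotient K) (PrincipalGroup K)))
    ?_ ?_ ?_ ?_ ?_ ?_ hx
  · rintro _ ⟨g, rfl⟩
    refine ⟨intertwined_heckeOp ψ g, ?_⟩
    have h := intertwined_heckeOp ψ g⁻¹
    rwa [← star_heckeOp, ← star_heckeElement] at h
  · intro x y _ _ hx hy
    refine ⟨hx.1.add hy.1, ?_⟩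
    rw [star_add]
    exact hx.2.add hy.2
  · refine ⟨Intertwined.zero, ?_⟩
    rw [star_zero]
    exact Intertwined.zero
  · intro x y _ _ hx hy
    refine ⟨hx.1.mul hy.1, ?_⟩
    rw [star_mul]
    exact hy.2.mul hx.2
  · intro c x _ hx
    refine ⟨hx.1.smul c, ?_⟩
    rw [star_smul]
    exact hx.2.smul _
  · intro x _ hx
    refine ⟨hx.2, ?_⟩
    rw [star_star]
    exact hx.1

theorem fst_mem_reducedHeckeAlgebra
    {x : (CosetL2 (integralAxbGroup K) →L[ℂ] CosetL2 (integralAxbGroup K)) ×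
      crossedProduct (AdeleQuotient K) (PrincipalGroup K)} (hx : x ∈ heckeCorrespondence ψ) :
    x.1 ∈ reducedHeckeAlgebra (integralAxbGroup K) := by
  refine NonUnitalStarAlgebra.adjoin_induction (R := ℂ)
    (p := fun x _ => x.1 ∈ reducedHeckeAlgebra (integralAxbGroup K)) ?_ ?_ ?_ ?_ ?_ ?_ hx
  · rintro _ ⟨g, rfl⟩
    exact heckeOp_mem_reducedHeckeAlgebra _ g
  · exact fun x y _ _ hx hy => add_mem hx hy
  · exact zero_mem _
  · exact fun x y _ _ hx hy => mul_mem hx hy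
  · exact fun c x _ hx => SMulMemClass.smul_mem c hx
  · exact fun x _ hx => star_mem hx

theorem snd_mem_adelicCorner
    {x : (CosetL2 (integralAxbGroup K) →L[ℂ] CosetL2 (integralAxbGroup K)) ×
      crossedProduct (AdeleQuotient K) (PrincipalGroup K)} (hx : x ∈ heckeCorrespondence ψ) :
    x.2 ∈ adelicCorner K := by
  refine NonUnitalStarAlgebra.adjoin_induction (R := ℂ)
    (p := fun x _ => x.2 ∈ adelicCorner K) ?_ ?_ ?_ ?_ ?_ ?_ hx
  · rintro _ ⟨g, rfl⟩
    exact heckeElement_mem_adelicCorner ψ g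
  · exact fun x y _ _ hx hy => add_mem hx hy
  · exact zero_mem _
  · exact fun x y _ _ hx hy => mul_mem hx hy
  · exact fun c x _ hx => SMulMemClass.smul_mem c hx
  · exact fun x _ hx => star_mem hx

end Linking

/-! ### The Haar state on the corner -/

/-- The faithfulness of the conditional expectation, for groups not given as instances of
commutative groups. -/
theorem eq_zero_of_diagCoeff_star_mul_self_of_comm {X G : Type u} [TopologicalSpace X] [Group G]
    [MulAction G X] [ContinuousConstSMul G X] (hG : ∀ a b : G, a * b = b * a)
    {T : UniversalOperators X G} (hT : T ∈ crossedProduct X G)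
    (h : ∀ x, diagCoeff x (star T * T) = 0) : T = 0 := by
  let _ : CommGroup G := { ‹Group G› with mul_comm := hG }
  exact eq_zero_of_diagCoeff_star_mul_self hT h

theorem orbitEval_monomial_one_delta {X G : Type u} [TopologicalSpace X] [Group G]
    [MulAction G X] [ContinuousConstSMul G X] (x : X) (f : C₀(X, ℂ)) :
    orbitEval x (monomial f (1 : G)) (delta 1) = f x • delta 1 := by
  rw [orbitEval_monomial_delta, mul_one, one_smul]

section HaarState

open IsDedekindDomain HeightOneSpectrum NumberField MeasureTheory

variable (K : Type u) [Field K] [NumberField K]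

instance : MeasurableSpace (FiniteAdeles K) := borel _

instance : BorelSpace (FiniteAdeles K) := ⟨rfl⟩

/-- `Ô` as a compact set with nonempty interior. -/
def integralPositiveCompacts : TopologicalSpace.PositiveCompacts (FiniteAdeles K) where
  carrier := integralAdeles K
  isCompact' := integralAdeles_isCompact K
  interior_nonempty' := by
    rw [(integralAdeles_isOpen K).interior_eq]
    exact ⟨0, AdelicCharacter.zero_mem_integralAdeles K⟩

/-- The Haar measure of the finite adeles with total mass one on `Ô`. -/
def adelicHaar : Measure (FiniteAdeles K) := Measure.addHaarMeasure (integralPositiveCompacts K)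

instance : (adelicHaar K).IsAddHaarMeasure :=
  inferInstanceAs (Measure.addHaarMeasure (integralPositiveCompacts K)).IsAddHaarMeasure

/-- The Haar probability measure of `Ô`. -/
def integralHaar : Measure (FiniteAdeles K) := (adelicHaar K).restrict (integralAdeles K)

theorem measurableSet_integralAdeles : MeasurableSet (integralAdeles K) :=
  (integralAdeles_isOpen K).measurableSet

instance : IsProbabilityMeasure (integralHaar K) where
  measure_univ := by
    rw [integralHaar, Measure.restrict_apply_univ]
    exact Measure.addHaarMeasure_self (K₀ := integralPositiveCompacts K)

variable {K}

theorem integral_integralHaar_add {b : FiniteAdeles K} (hb : b ∈ integralAdeles K)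
    (f : FiniteAdeles K → ℂ) : ∫ w, f (w + b) ∂(integralHaar K) = ∫ w, f w ∂(integralHaar K) := by
  have h := integral_add_right_eq_self (μ := adelicHaar K) ((integralAdeles K).indicator f) b
  rw [integral_indicator (measurableSet_integralAdeles K)] at h
  rw [integralHaar, ← h, ← integral_indicator (measurableSet_integralAdeles K)]
  congr 1
  ext w
  have hiff : w + b ∈ integralAdeles K ↔ w ∈ integralAdeles K := by
    refine ⟨fun h' => ?_, fun h' => add_mem_integralAdeles h' hb⟩
    have := add_mem_integralAdeles h' (neg_mem_integralAdeles hb)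
    rwa [add_neg_cancel_right] at this
  by_cases hw : w ∈ integralAdeles K
  · rw [Set.indicator_of_mem hw, Set.indicator_of_mem (hiff.2 hw)]
  · rw [Set.indicator_of_notMem hw, Set.indicator_of_notMem (fun h' => hw (hiff.1 h'))]

/-- Orthogonality of characters on `Ô`. -/
theorem integral_adelicCharacter_eq_zero (ψ : AdelicCharacter K) {a : FiniteAdeles K}
    (ha : a ∉ integralAdeles K) : ∫ w, ψ (a * w) ∂(integralHaar K) = 0 := by
  have : ∃ b : 𝓞 K, ψ (diagonal K (algebraMap (𝓞 K) K b) * a) ≠ 1 := by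
    by_contra! h
    exact ha (ψ.mem_of_eq_one a h)
  obtain ⟨b, hb⟩ := this
  have h := integral_integralHaar_add (diagonal_integer_mem b) fun w => ψ (a * w)
  simp only [mul_add, ψ.map_add] at h
  rw [integral_mul_const, mul_comm a] at h
  by_contra h0
  exact hb (mul_left_cancel₀ h0 (h.trans (mul_one _).symm))

theorem integral_adelicCharacter_eq_one (ψ : AdelicCharacter K) {a : FiniteAdeles K}
    (ha : a ∈ integralAdeles K) : ∫ w, ψ (a * w) ∂(integralHaar K) = 1 := by
  have h : ∀ᵐ w ∂(integralHaar K), ψ (a * w) = 1 := by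
    filter_upwards [ae_restrict_mem (measurableSet_integralAdeles K)] with w hw
    exact ψ.eq_one_of_mem _ (mul_mem_integralAdeles ha hw)
  rw [integral_congr_ae h]
  simp

theorem continuous_diagCoeff_mk {T : UniversalOperators (AdeleQuotient K) (PrincipalGroup K)}
    (hT : T ∈ crossedProduct (AdeleQuotient K) (PrincipalGroup K)) :
    Continuous fun w => diagCoeff (AdeleQuotient.mk K w) T :=
  (continuous_diagCoeff hT).comp (continuous_mk K)

theorem integrable_diagCoeff_mk {T : UniversalOperators (AdeleQuotient K) (PrincipalGroup K)}
    (hT : T ∈ crossedProduct (AdeleQuotient K) (PrincipalGroup K)) :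
    Integrable (fun w => diagCoeff (AdeleQuotient.mk K w) T) (integralHaar K) :=
  Integrable.of_bound (continuous_diagCoeff_mk hT).aestronglyMeasurable ‖T‖
    (ae_of_all _ fun _ => norm_diagCoeff_le _ _)

variable (K) in
/-- The state of the crossed product given by the conditional expectation onto the functions on the
adele quotient, followed by the integral over `Ô`. -/
def adelicState : crossedProduct (AdeleQuotient K) (PrincipalGroup K) →ₗ[ℂ] ℂ where
  toFun T := ∫ w, diagCoeff (AdeleQuotient.mk K w)
    (T : UniversalOperators (AdeleQuotient K) (PrincipalGroup K)) ∂(integralHaar K)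
  map_add' S T := by
    rw [← integral_add (integrable_diagCoeff_mk S.2) (integrable_diagCoeff_mk T.2)]
    exact integral_congr_ae (ae_of_all _ fun w => map_add (diagCoeff _) S.1 T.1)
  map_smul' c T := by
    rw [RingHom.id_apply, ← integral_smul]
    exact integral_congr_ae (ae_of_all _ fun w => map_smul (diagCoeff _) c T.1)

theorem norm_adelicState_le (T : crossedProduct (AdeleQuotient K) (PrincipalGroup K)) :
    ‖adelicState K T‖ ≤ ‖T‖ := by
  have h := norm_integral_le_of_norm_le_const (μ := integralHaar K)
    (f := fun w => diagCoeff (AdeleQuotient.mk K w) T.1) (C := ‖T.1‖)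
    (ae_of_all _ fun _ => norm_diagCoeff_le _ _)
  rwa [probReal_univ, mul_one] at h

theorem adelicState_star_mul_self (T : crossedProduct (AdeleQuotient K) (PrincipalGroup K)) :
    adelicState K (star T * T) =
      ((∫ w, ‖orbitEval (AdeleQuotient.mk K w) T.1 (delta 1)‖ ^ 2 ∂(integralHaar K) : ℝ) : ℂ) := by
  refine Eq.trans ?_ integral_ofReal
  exact integral_congr_ae (ae_of_all _ fun w => diagCoeff_star_mul_self _ T.1)

open ComplexOrder in
theorem adelicState_nonneg (T : crossedProduct (AdeleQuotient K) (PrincipalGroup K)) :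
    0 ≤ adelicState K (star T * T) := by
  rw [adelicState_star_mul_self]
  exact Complex.zero_le_real.2 (integral_nonneg fun _ => sq_nonneg _)

theorem orbitEval_delta_one_eq_zero {T : UniversalOperators (AdeleQuotient K) (PrincipalGroup K)}
    (hT : T * monomial (integralIndicator K) 1 = T) {w : FiniteAdeles K} (hw : w ∉ integralAdeles K) :
    orbitEval (AdeleQuotient.mk K w) T (delta 1) = 0 := by
  have h : orbitEval (AdeleQuotient.mk K w) (monomial (integralIndicator K) (1 : PrincipalGroup K))
      (delta 1) = 0 := by
    rw [orbitEval_monomial_one_delta, integralIndicator_mk_of_notMem hw, zero_smul]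
  rw [← hT, map_mul, mul_apply_eq_comp, h, map_zero]

theorem eq_zero_of_diagCoeff_mk {T : UniversalOperators (AdeleQuotient K) (PrincipalGroup K)}
    (hT : T ∈ crossedProduct (AdeleQuotient K) (PrincipalGroup K))
    (h : ∀ w, orbitEval (AdeleQuotient.mk K w) T (delta 1) = 0) : T = 0 := by
  refine eq_zero_of_diagCoeff_star_mul_self_of_comm
    (fun a b => mul_comm (G := PrincipalGroup K) a b) hT fun x => ?_
  induction x using Quotient.ind with
  | _ w =>
  refine (diagCoeff_star_mul_self (AdeleQuotient.mk K w) T).trans ?_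
  rw [h w]
  simp

/-- A continuous nonnegative function with integral zero vanishes on the open set `Ô`. -/
theorem orbitEval_eq_zero_of_adelicState
    {T : crossedProduct (AdeleQuotient K) (PrincipalGroup K)}
    (h : adelicState K (star T * T) = 0) {w : FiniteAdeles K} (hw : w ∈ integralAdeles K) :
    orbitEval (AdeleQuotient.mk K w) T.1 (delta 1) = 0 := by
  have hmem : star T.1 * T.1 ∈ crossedProduct (AdeleQuotient K) (PrincipalGroup K) :=
    mul_mem (star_mem T.2) T.2
  have heq : ∀ w, (diagCoeff (AdeleQuotient.mk K w) (star T.1 * T.1)).re =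
      ‖orbitEval (AdeleQuotient.mk K w) T.1 (delta 1)‖ ^ 2 := by
    intro w
    rw [diagCoeff_star_mul_self, Complex.ofReal_re]
  have hcont : Continuous fun w => ‖orbitEval (AdeleQuotient.mk K w) T.1 (delta 1)‖ ^ 2 :=
    (Complex.continuous_re.comp (continuous_diagCoeff_mk hmem)).congr heq
  have hint : Integrable (fun w => ‖orbitEval (AdeleQuotient.mk K w) T.1 (delta 1)‖ ^ 2)
      (integralHaar K) :=
    (integrable_diagCoeff_mk hmem).re.congr (ae_of_all _ heq)
  rw [adelicState_star_mul_self, Complex.ofReal_eq_zero,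
    integral_eq_zero_iff_of_nonneg (fun _ => sq_nonneg _) hint] at h
  have hzero : Set.EqOn (fun w => ‖orbitEval (AdeleQuotient.mk K w) T.1 (delta 1)‖ ^ 2) 0
      (integralAdeles K) :=
    Measure.eqOn_open_of_ae_eq (μ := adelicHaar K) h (integralAdeles_isOpen K) hcont.continuousOn
      continuous_const.continuousOn
  exact norm_eq_zero.1 (pow_eq_zero_iff two_ne_zero |>.1 (hzero hw))

/-- The state is faithful on the corner: it controls the conditional expectation at the points of `Ô`,
and the conditional expectation of `star T * T` vanishes at all other points. -/
theorem eq_zero_of_adelicState {T : crossedProduct (AdeleQuotient K) (PrincipalGroup K)}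
    (hT : T ∈ adelicCorner K) (h : adelicState K (star T * T) = 0) : T = 0 := by
  refine Subtype.ext (eq_zero_of_diagCoeff_mk T.2 fun w => ?_)
  by_cases hw : w ∈ integralAdeles K
  · exact orbitEval_eq_zero_of_adelicState h hw
  · exact orbitEval_delta_one_eq_zero (congrArg Subtype.val hT.2) hw

/-- The vector state of `δ_Γ`. -/
def cosetState {G : Type u} [Group G] (Γ : Subgroup G) : (CosetL2 Γ →L[ℂ] CosetL2 Γ) →ₗ[ℂ] ℂ where
  toFun T := T (delta (rightCoset Γ 1)) (rightCoset Γ 1)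
  map_add' S T := by simp
  map_smul' c T := by simp

theorem norm_cosetState_le {G : Type u} [Group G] (Γ : Subgroup G) (T : CosetL2 Γ →L[ℂ] CosetL2 Γ) :
    ‖cosetState Γ T‖ ≤ ‖T‖ := by
  change ‖T (delta (rightCoset Γ 1)) (rightCoset Γ 1)‖ ≤ _
  refine (lp.norm_apply_le_norm (by simp) _ _).trans ((ContinuousLinearMap.le_opNorm _ _).trans ?_)
  rw [norm_delta, mul_one]

theorem cosetState_star_mul_self {G : Type u} [Group G] (Γ : Subgroup G)
    (T : CosetL2 Γ →L[ℂ] CosetL2 Γ) :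
    cosetState Γ (star T * T) = ((‖T (delta (rightCoset Γ 1))‖ ^ 2 : ℝ) : ℂ) := by
  change (star T * T) (delta (rightCoset Γ 1)) (rightCoset Γ 1) = _
  rw [← inner_delta_left, mul_apply_eq_comp,
    ContinuousLinearMap.star_eq_adjoint, ContinuousLinearMap.adjoint_inner_right]
  simp

theorem linearCombination_delta_apply {α : Type*} (ξ : α →₀ ℂ) (a : α) :
    (Finsupp.linearCombination ℂ (delta : α → lp (fun _ : α => ℂ) 2) ξ) a = ξ a := by
  classical
  induction ξ using Finsupp.induction_linear with
  | zero => simp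
  | add ξ η hξ hη => rw [map_add, lp.coeFn_add, Pi.add_apply, hξ, hη, Finsupp.add_apply]
  | single c z =>
    rw [Finsupp.linearCombination_single, lp.coeFn_smul, Pi.smul_apply, delta_apply,
      Finsupp.single_apply, smul_eq_mul]
    simp [eq_comm]

/-- The integral over `Ô` recovers the coefficient of the trivial coset. -/
theorem integral_cosetVector (ψ : AdelicCharacter K) (c : RightCosets (integralAxbGroup K)) :
    ∫ w, cosetVector ψ w c 1 ∂(integralHaar K) = (delta (rightCoset _ 1) : CosetL2 (integralAxbGroup K)) c := by
  classical
  have hval : ∀ w, cosetVector ψ w c 1 = normWeight (cosetClass c) * cosetCharacter ψ c w *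
      (delta (cosetClass c) : lp (fun _ : PrincipalGroup K => ℂ) 2) 1 := fun w => rfl
  simp only [hval]
  by_cases hc : cosetClass c = 1
  · obtain ⟨h, rfl⟩ : ∃ h, rightCoset _ h = c := ⟨c.out, rightCoset_out _ c⟩
    have hu : h.x ∈ totallyPositiveUnits K := (QuotientGroup.eq_one_iff h.x).1 hc
    rw [hc, delta_apply_self, normWeight_one]
    have he : ∀ᵐ w ∂(integralHaar K), 1 * cosetCharacter ψ (rightCoset _ h) w * 1 =
        ψ (-(diagonal K h.y) * w) := by
      filter_upwards [ae_restrict_mem (measurableSet_integralAdeles K)] with w hw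
      rw [cosetCharacter_mk, if_pos ((diagonal_unit_mul_mem_iff hu).2 hw), one_mul, mul_one, neg_mul]
    rw [integral_congr_ae he]
    have hiff : -(diagonal K h.y) ∈ integralAdeles K ↔
        rightCoset (integralAxbGroup K) h = rightCoset _ 1 := by
      rw [eq_comm, rightCoset_eq_iff, inv_one, mul_one, mem_integralAxbGroup, and_iff_left hu,
        ← diagonal_mem_iff]
      exact ⟨fun h => by simpa using neg_mem_integralAdeles h, neg_mem_integralAdeles⟩
    by_cases hO : -(diagonal K h.y) ∈ integralAdeles K
    · rw [integral_adelicCharacter_eq_one ψ hO, hiff.1 hO, delta_apply_self]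
    · rw [integral_adelicCharacter_eq_zero ψ hO, delta_apply_ne fun h' => hO (hiff.2 h')]
  · rw [delta_apply_ne (Ne.symm hc), delta_apply_ne]
    · simp
    · rintro rfl
      exact hc rfl

theorem integrable_cosetVector (ψ : AdelicCharacter K) (c : RightCosets (integralAxbGroup K)) :
    Integrable (fun w => cosetVector ψ w c 1) (integralHaar K) := by
  have h : Continuous fun w => cosetVector ψ w c 1 :=
    (continuous_const.mul (continuous_cosetCharacter ψ c)).mul continuous_const
  exact h.continuousOn.integrableOn_compact (integralAdeles_isCompact K)

theorem cosetVector_one (ψ : AdelicCharacter K) {w : FiniteAdeles K} (hw : w ∈ integralAdeles K) :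
    cosetVector ψ w (rightCoset _ 1) = delta 1 := by
  classical
  have h1 : cosetCharacter ψ (rightCoset _ 1) w = 1 := by
    rw [cosetCharacter_mk, if_pos (by simpa using hw), AxbGroup.one_y, _root_.map_zero, zero_mul,
      neg_zero, ψ.map_zero]
  have h2 : cosetClass (rightCoset (integralAxbGroup K) 1) = 1 := rfl
  rw [cosetVector, h1, h2, normWeight_one, mul_one, one_smul]

/-- Intertwined elements have the same expectation. -/
theorem Intertwined.cosetState_eq {ψ : AdelicCharacter K}
    {T : CosetL2 (integralAxbGroup K) →L[ℂ] CosetL2 (integralAxbGroup K)}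
    {a : crossedProduct (AdeleQuotient K) (PrincipalGroup K)}
    (h : Intertwined ψ T a.1) : cosetState _ T = adelicState K a := by
  classical
  obtain ⟨T₀, h1, h2⟩ := h
  obtain ⟨ξ, hξ⟩ : ∃ ξ, T₀ (Finsupp.single (rightCoset _ 1) 1) = ξ := ⟨_, rfl⟩
  have e1 : cosetState _ T = ξ (rightCoset _ 1) := by
    rw [← linearCombination_delta_apply, ← hξ, h1, Finsupp.linearCombination_single, one_smul]
    rfl
  have e2 : ∀ᵐ w ∂(integralHaar K), diagCoeff (AdeleQuotient.mk K w) a.1 =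
      ∑ c ∈ ξ.support, ξ c * cosetVector ψ w c 1 := by
    filter_upwards [ae_restrict_mem (measurableSet_integralAdeles K)] with w hw
    have h3 := h2 w (Finsupp.single (rightCoset _ 1) 1)
    rw [Finsupp.linearCombination_single, one_smul, cosetVector_one ψ hw, hξ] at h3
    rw [diagCoeff_eq, ← h3, Finsupp.linearCombination_apply, Finsupp.sum, lp.coeFn_sum,
      Finset.sum_apply]
    rfl
  have e3 : adelicState K a = ∫ w, ∑ c ∈ ξ.support, ξ c * cosetVector ψ w c 1 ∂(integralHaar K) :=
    integral_congr_ae e2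
  rw [e1, e3, integral_finsetSum _ fun c _ => (integrable_cosetVector ψ c).const_mul _]
  have e4 : ∀ c, ∫ w, ξ c * cosetVector ψ w c 1 ∂(integralHaar K) =
      ξ c * (delta (rightCoset _ 1) : CosetL2 (integralAxbGroup K)) c := fun c => by
    rw [integral_const_mul, integral_cosetVector]
  rw [Finset.sum_congr rfl fun c _ => e4 c, Finset.sum_eq_single (rightCoset _ 1)]
  · rw [delta_apply_self, mul_one]
  · intro c _ hc
    rw [delta_apply_ne hc, mul_zero]
  · intro hc
    rw [Finsupp.notMem_support_iff.1 hc, zero_mul]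

end HaarState

/-! ### The isomorphism onto the closure of the correspondence -/

/-- The crossed product as a C*-algebra. -/
abbrev crossedProductCStarAlgebra {X G : Type u} [TopologicalSpace X] [Group G]
    [MulAction G X] [ContinuousConstSMul G X] : NonUnitalCStarAlgebra (crossedProduct X G) :=
  NonUnitalStarSubalgebra.nonUnitalCStarAlgebra (crossedProduct X G)
    (h_closed := isClosed_crossedProduct X G)

instance {X G : Type u} [TopologicalSpace X] [Group G]
    [MulAction G X] [ContinuousConstSMul G X] : CompleteSpace (crossedProduct X G) :=
  (isClosed_crossedProduct X G).completeSpace_coe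

instance {X G : Type u} [TopologicalSpace X] [Group G]
    [MulAction G X] [ContinuousConstSMul G X] : CStarRing (crossedProduct X G) where
  norm_mul_self_le a := CStarRing.norm_mul_self_le (a : UniversalOperators X G)

theorem isClosed_reducedHeckeAlgebra {G : Type u} [Group G] (Γ : Subgroup G) :
    IsClosed (reducedHeckeAlgebra Γ : Set (CosetL2 Γ →L[ℂ] CosetL2 Γ)) :=
  NonUnitalStarSubalgebra.isClosed_topologicalClosure _

/-- The reduced Hecke algebra as a C*-algebra. -/
abbrev reducedHeckeCStarAlgebra {G : Type u} [Group G] (Γ : Subgroup G) :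
    NonUnitalCStarAlgebra (reducedHeckeAlgebra Γ) :=
  NonUnitalStarSubalgebra.nonUnitalCStarAlgebra (reducedHeckeAlgebra Γ)
    (h_closed := isClosed_reducedHeckeAlgebra Γ)

section NormEquality

open NumberField

variable (K : Type u) [Field K] [NumberField K]

theorem isClosed_adelicCorner :
    IsClosed (adelicCorner K : Set (crossedProduct (AdeleQuotient K) (PrincipalGroup K))) :=
  (isClosed_eq (continuous_const.mul continuous_id) continuous_id).inter
    (isClosed_eq (continuous_id.mul continuous_const) continuous_id)

/-- The corner as a C*-algebra. -/
abbrev adelicCornerCStarAlgebra : NonUnitalCStarAlgebra (adelicCorner K) :=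
  let _ := crossedProductCStarAlgebra (X := AdeleQuotient K) (G := PrincipalGroup K)
  NonUnitalStarSubalgebra.nonUnitalCStarAlgebra (adelicCorner K)
    (h_closed := isClosed_adelicCorner K)

variable {K} {ψ : AdelicCharacter K}

theorem cosetState_eq_adelicState
    {x : (CosetL2 (integralAxbGroup K) →L[ℂ] CosetL2 (integralAxbGroup K)) ×
      crossedProduct (AdeleQuotient K) (PrincipalGroup K)} (hx : x ∈ heckeCorrespondence ψ) :
    cosetState _ x.1 = adelicState K x.2 :=
  (intertwined_of_mem hx).cosetState_eq

theorem iterate_sq_mem {S A : Type*} [NonUnitalNonAssocSemiring A] [SetLike S A] [MulMemClass S A]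
    {s : S} {x : A} (hx : x ∈ s) (k : ℕ) : (fun y => y * y)^[k] x ∈ s := by
  induction k with
  | zero => exact hx
  | succ k ih =>
    rw [Function.iterate_succ_apply']
    exact mul_mem ih ih

theorem map_iterate_sq {A B : Type*} [Mul A] [Mul B] (f : A → B) (hf : ∀ x y, f (x * y) = f x * f y)
    (x : A) (k : ℕ) : f ((fun y => y * y)^[k] x) = (fun y => y * y)^[k] (f x) := by
  induction k with
  | zero => rfl
  | succ k ih =>
    rw [Function.iterate_succ_apply', Function.iterate_succ_apply', hf, ih]

theorem cosetState_iterate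
    {x : (CosetL2 (integralAxbGroup K) →L[ℂ] CosetL2 (integralAxbGroup K)) ×
      crossedProduct (AdeleQuotient K) (PrincipalGroup K)} (hx : x ∈ heckeCorrespondence ψ) (k : ℕ) :
    cosetState _ ((fun y => y * y)^[k] (star x.1 * x.1)) =
      adelicState K ((fun y => y * y)^[k] (star x.2 * x.2)) := by
  have h := cosetState_eq_adelicState
    (iterate_sq_mem (mul_mem (star_mem hx) hx : star x * x ∈ heckeCorrespondence ψ) k)
  rw [map_iterate_sq Prod.fst (fun _ _ => rfl), map_iterate_sq Prod.snd (fun _ _ => rfl)] at h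
  exact h

open ComplexOrder in
theorem norm_snd_le
    {x : (CosetL2 (integralAxbGroup K) →L[ℂ] CosetL2 (integralAxbGroup K)) ×
      crossedProduct (AdeleQuotient K) (PrincipalGroup K)} (hx : x ∈ heckeCorrespondence ψ) :
    ‖x.2‖ ≤ ‖x.1‖ := by
  let _ := adelicCornerCStarAlgebra K
  let ω₂ : adelicCorner K →ₗ[ℂ] ℂ :=
    { toFun := fun b => adelicState K b.1
      map_add' := fun a b => map_add (adelicState K) a.1 b.1
      map_smul' := fun c b => map_smul (adelicState K) c b.1 }
  refine norm_le_norm_of_functional_eq (ω₁ := cosetState (integralAxbGroup K)) (ω₂ := ω₂) (C := 1)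
    (T := x.1) (a := (⟨x.2, snd_mem_adelicCorner hx⟩ : adelicCorner K))
    (fun b => by rw [one_mul]; exact norm_cosetState_le _ b)
    (fun b => adelicState_nonneg b.1)
    (fun b hb => Subtype.ext (eq_zero_of_adelicState b.2 hb)) (fun k => ?_)
  refine (cosetState_iterate hx k).trans ?_
  change _ = adelicState K (((fun y => y * y)^[k] (star (⟨x.2, snd_mem_adelicCorner hx⟩ : adelicCorner K) *
    ⟨x.2, snd_mem_adelicCorner hx⟩) : adelicCorner K)).1
  rw [map_iterate_sq Subtype.val (fun _ _ => rfl)]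
  rfl

open ComplexOrder in
theorem norm_fst_le
    {x : (CosetL2 (integralAxbGroup K) →L[ℂ] CosetL2 (integralAxbGroup K)) ×
      crossedProduct (AdeleQuotient K) (PrincipalGroup K)} (hx : x ∈ heckeCorrespondence ψ) :
    ‖x.1‖ ≤ ‖x.2‖ := by
  let _ := crossedProductCStarAlgebra (X := AdeleQuotient K) (G := PrincipalGroup K)
  let _ := reducedHeckeCStarAlgebra (integralAxbGroup K)
  let ω₂ : reducedHeckeAlgebra (integralAxbGroup K) →ₗ[ℂ] ℂ :=
    { toFun := fun b => cosetState _ b.1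
      map_add' := fun a b => map_add (cosetState _) a.1 b.1
      map_smul' := fun c b => map_smul (cosetState _) c b.1 }
  refine norm_le_norm_of_functional_eq (ω₁ := adelicState K) (ω₂ := ω₂) (C := 1)
    (T := x.2) (a := (⟨x.1, fst_mem_reducedHeckeAlgebra hx⟩ : reducedHeckeAlgebra (integralAxbGroup K)))
    (fun b => by rw [one_mul]; exact norm_adelicState_le b)
    (fun b => ?_) (fun b hb => Subtype.ext ?_) (fun k => ?_)
  · change 0 ≤ cosetState _ (star b.1 * b.1)
    rw [cosetState_star_mul_self]
    exact Complex.zero_le_real.2 (sq_nonneg _)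
  · have hb' : cosetState _ (star b.1 * b.1) = 0 := hb
    rw [cosetState_star_mul_self, Complex.ofReal_eq_zero] at hb'
    exact eq_zero_of_apply_delta_one (isHeckePair_integralAxbGroup K) b.2
      (norm_eq_zero.1 (pow_eq_zero_iff two_ne_zero |>.1 hb'))
  · refine (cosetState_iterate hx k).symm.trans ?_
    change _ = cosetState _ (((fun y => y * y)^[k]
      (star (⟨x.1, fst_mem_reducedHeckeAlgebra hx⟩ : reducedHeckeAlgebra (integralAxbGroup K)) *
        ⟨x.1, fst_mem_reducedHeckeAlgebra hx⟩) : reducedHeckeAlgebra (integralAxbGroup K))).1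
    rw [map_iterate_sq Subtype.val (fun _ _ => rfl)]
    rfl

/-- The correspondence is isometric, because both sides carry faithful states and the states agree. -/
theorem norm_fst_eq_norm_snd
    {x : (CosetL2 (integralAxbGroup K) →L[ℂ] CosetL2 (integralAxbGroup K)) ×
      crossedProduct (AdeleQuotient K) (PrincipalGroup K)} (hx : x ∈ heckeCorrespondence ψ) :
    ‖x.1‖ = ‖x.2‖ :=
  le_antisymm (norm_fst_le hx) (norm_snd_le hx)

theorem closure_fst_heckeCorrespondence :
    (reducedHeckeAlgebra (integralAxbGroup K) : Set (CosetL2 (integralAxbGroup K) →L[ℂ] CosetL2 (integralAxbGroup K))) =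
      closure (Prod.fst '' ((heckeCorrespondence ψ : NonUnitalStarSubalgebra ℂ
    ((CosetL2 (integralAxbGroup K) →L[ℂ] CosetL2 (integralAxbGroup K)) ×
      crossedProduct (AdeleQuotient K) (PrincipalGroup K))) : Set ((CosetL2 (integralAxbGroup K) →L[ℂ] CosetL2 (integralAxbGroup K)) ×
      crossedProduct (AdeleQuotient K) (PrincipalGroup K)))) := by
  refine Set.Subset.antisymm ?_ (closure_minimal ?_ (isClosed_reducedHeckeAlgebra _))
  · rw [reducedHeckeAlgebra_eq (isHeckePair_integralAxbGroup K)]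
    refine closure_mono ?_
    intro T hT
    let S := (heckeCorrespondence ψ).map (NonUnitalStarAlgHom.fst ℂ
      (CosetL2 (integralAxbGroup K) →L[ℂ] CosetL2 (integralAxbGroup K))
      (crossedProduct (AdeleQuotient K) (PrincipalGroup K)))
    have hS : NonUnitalStarAlgebra.adjoin ℂ
        (Set.range (heckeOp (isHeckePair_integralAxbGroup K))) ≤ S := by
      refine NonUnitalStarAlgebra.adjoin_le ?_
      rintro _ ⟨g, rfl⟩
      exact ⟨(heckeOp (isHeckePair_integralAxbGroup K) g, heckeElement ψ g),
        NonUnitalStarAlgebra.subset_adjoin ℂ _ ⟨g, rfl⟩, rfl⟩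
    obtain ⟨x, hx, rfl⟩ := hS hT
    exact ⟨x, hx, rfl⟩
  · rintro _ ⟨x, hx, rfl⟩
    exact fst_mem_reducedHeckeAlgebra hx

variable (ψ) in
/-- The C*-algebra generated by the elements which correspond to double cosets. -/
def heckeClosure : NonUnitalStarSubalgebra ℂ (crossedProduct (AdeleQuotient K) (PrincipalGroup K)) :=
  (NonUnitalStarAlgebra.adjoin ℂ (Set.range (heckeElement ψ))).topologicalClosure

variable (ψ) in
theorem isClosed_heckeClosure :
    IsClosed (heckeClosure ψ : Set (crossedProduct (AdeleQuotient K) (PrincipalGroup K))) :=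
  NonUnitalStarSubalgebra.isClosed_topologicalClosure _

theorem closure_snd_heckeCorrespondence
    (h : adelicCorner K ≤ heckeClosure ψ) :
    (adelicCorner K : Set (crossedProduct (AdeleQuotient K) (PrincipalGroup K))) =
      closure (Prod.snd '' ((heckeCorrespondence ψ : NonUnitalStarSubalgebra ℂ
    ((CosetL2 (integralAxbGroup K) →L[ℂ] CosetL2 (integralAxbGroup K)) ×
      crossedProduct (AdeleQuotient K) (PrincipalGroup K))) : Set ((CosetL2 (integralAxbGroup K) →L[ℂ] CosetL2 (integralAxbGroup K)) ×
      crossedProduct (AdeleQuotient K) (PrincipalGroup K)))) := by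
  refine Set.Subset.antisymm (Set.Subset.trans h (closure_mono ?_))
    (closure_minimal ?_ (isClosed_adelicCorner K))
  · intro T hT
    let S := (heckeCorrespondence ψ).map (NonUnitalStarAlgHom.snd ℂ
      (CosetL2 (integralAxbGroup K) →L[ℂ] CosetL2 (integralAxbGroup K))
      (crossedProduct (AdeleQuotient K) (PrincipalGroup K)))
    have hS : NonUnitalStarAlgebra.adjoin ℂ (Set.range (heckeElement ψ)) ≤ S := by
      refine NonUnitalStarAlgebra.adjoin_le ?_
      rintro _ ⟨g, rfl⟩
      exact ⟨(heckeOp (isHeckePair_integralAxbGroup K) g, heckeElement ψ g),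
        NonUnitalStarAlgebra.subset_adjoin ℂ _ ⟨g, rfl⟩, rfl⟩
    obtain ⟨x, hx, rfl⟩ := hS hT
    exact ⟨x, hx, rfl⟩
  · rintro _ ⟨x, hx, rfl⟩
    exact snd_mem_adelicCorner hx

/-- The isomorphism, assuming that the elements `heckeElement ψ g` generate the corner. -/
theorem exists_starAlgEquiv_of_dense
    (h : adelicCorner K ≤ heckeClosure ψ) :
    ∃ φ : reducedHeckeAlgebra (integralAxbGroup K) ≃⋆ₐ[ℂ] adelicCorner K,
      (∀ b, ‖φ b‖ = ‖b‖) ∧ ∀ (g : AxbGroup K) (b : reducedHeckeAlgebra (integralAxbGroup K)),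
        (b : CosetL2 (integralAxbGroup K) →L[ℂ] CosetL2 (integralAxbGroup K)) =
          heckeOp (isHeckePair_integralAxbGroup K) g →
        (φ b : crossedProduct (AdeleQuotient K) (PrincipalGroup K)) = heckeElement ψ g := by
  have h1 := @exists_starAlgEquiv_of_isometric_correspondence _ _ _ _ _ _ _ _ _ _ _ _
    (heckeCorrespondence ψ)
  have h2 := h1 (fun x hx => norm_fst_eq_norm_snd hx) (reducedHeckeAlgebra (integralAxbGroup K))
    (adelicCorner K) closure_fst_heckeCorrespondence (closure_snd_heckeCorrespondence h)
  obtain ⟨φ, hφ, hφ'⟩ := h2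
  refine ⟨φ, hφ, fun g b hb => ?_⟩
  exact hφ' (_, heckeElement ψ g) (NonUnitalStarAlgebra.subset_adjoin ℂ _ ⟨g, rfl⟩) b hb

end NormEquality

/-! ### Trigonometric polynomials on the integral adeles -/

section Density

open IsDedekindDomain HeightOneSpectrum NumberField

variable {K : Type u} [Field K] [NumberField K]

theorem eq_zero_of_forall_diagonal_mul_mem {a : FiniteAdeles K}
    (h : ∀ y : K, diagonal K y * a ∈ integralAdeles K) : a = 0 := by
  refine DFunLike.ext _ _ fun v => ?_
  change a v = 0
  by_contra hv
  obtain ⟨π, hπ⟩ := v.valuation_exists_uniformizer K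
  have hv' : Valued.v (a v) ≠ 0 := (map_ne_zero _).2 hv
  let n : ℕ := (1 - WithZero.log (Valued.v (a v))).toNat
  have h1 := h (π⁻¹ ^ n) v
  change ((π⁻¹ ^ n : K) : v.adicCompletion K) * a v ∈ v.adicCompletionIntegers K at h1
  rw [mem_adicCompletionIntegers, map_mul, valuedAdicCompletion_eq_valuation', map_pow, map_inv₀, hπ,
    ← WithZero.exp_neg, neg_neg, ← WithZero.exp_log hv', ← WithZero.exp_nsmul, ← WithZero.exp_add,
    ← WithZero.exp_zero, WithZero.exp_le_exp] at h1
  have := Int.self_le_toNat (1 - WithZero.log (Valued.v (a v)))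
  simp only [nsmul_eq_mul, mul_one] at h1
  change ((n : ℕ) : ℤ) + _ ≤ 0 at h1
  omega

variable (ψ : AdelicCharacter K)

/-- The characters of the finite adeles with rational frequencies. -/
def rationalCharacter (y : K) (w : FiniteAdeles K) : ℂ := ψ (-(diagonal K y * w))

theorem continuous_rationalCharacter (y : K) : Continuous (rationalCharacter ψ y) :=
  ψ.continuous.comp (continuous_const.mul continuous_id).neg

theorem rationalCharacter_add (y z : K) (w : FiniteAdeles K) :
    rationalCharacter ψ (y + z) w = rationalCharacter ψ y w * rationalCharacter ψ z w := by
  rw [rationalCharacter, map_add, add_mul, neg_add, ψ.map_add]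
  rfl

theorem rationalCharacter_neg (y : K) (w : FiniteAdeles K) :
    rationalCharacter ψ (-y) w = star (rationalCharacter ψ y w) := by
  rw [rationalCharacter, map_neg, neg_mul, ψ.map_neg]
  rfl

theorem rationalCharacter_zero (w : FiniteAdeles K) : rationalCharacter ψ 0 w = 1 := by
  rw [rationalCharacter, map_zero, zero_mul, neg_zero, ψ.map_zero]

/-- The rational characters separate the points of the finite adeles, since an adele all of whose
rational multiples are integral is zero. -/
theorem rationalCharacter_separates {w w' : FiniteAdeles K}
    (h : ∀ y, rationalCharacter ψ y w = rationalCharacter ψ y w') : w = w' := by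
  rw [← sub_eq_zero]
  refine eq_zero_of_forall_diagonal_mul_mem fun y => ψ.mem_of_eq_one _ fun b => ?_
  have h1 := h (-(algebraMap (𝓞 K) K b * y))
  rw [rationalCharacter, rationalCharacter, map_neg, neg_mul, neg_mul, neg_neg, neg_neg] at h1
  rw [← mul_assoc, ← map_mul, mul_sub, sub_eq_add_neg, ψ.map_add, h1, ← ψ.map_add, add_neg_cancel,
    ψ.map_zero]

/-- The restriction of a rational character to `Ô`. -/
def integralCharacter (y : K) : C(integralAdeles K, ℂ) :=
  ⟨fun w => rationalCharacter ψ y w, (continuous_rationalCharacter ψ y).comp continuous_subtype_val⟩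

/-- The trigonometric polynomials on `Ô`. -/
def trigPolynomials : StarSubalgebra ℂ C(integralAdeles K, ℂ) where
  carrier := Submodule.span ℂ (Set.range (integralCharacter ψ))
  mul_mem' := by
    intro a b ha hb
    have h := Submodule.mul_mem_mul ha hb
    rw [Submodule.span_mul_span] at h
    refine Submodule.span_mono ?_ h
    rintro _ ⟨_, ⟨y, rfl⟩, _, ⟨z, rfl⟩, rfl⟩
    exact ⟨y + z, ContinuousMap.ext fun w => rationalCharacter_add ψ y z w⟩
  add_mem' := add_mem
  algebraMap_mem' c := by
    have h : algebraMap ℂ C(integralAdeles K, ℂ) c = c • integralCharacter ψ 0 :=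
      ContinuousMap.ext fun w => by
        change c = c * rationalCharacter ψ 0 w
        rw [rationalCharacter_zero, mul_one]
    rw [h]
    exact Submodule.smul_mem _ _ (Submodule.subset_span ⟨0, rfl⟩)
  star_mem' := by
    intro a ha
    induction ha using Submodule.span_induction with
    | mem a h =>
      obtain ⟨y, rfl⟩ := h
      exact Submodule.subset_span ⟨-y, ContinuousMap.ext fun w => rationalCharacter_neg ψ y w⟩
    | zero => rw [star_zero]; exact zero_mem _
    | add a b _ _ ha hb => rw [star_add]; exact add_mem ha hb
    | smul c a _ ha => rw [star_smul]; exact Submodule.smul_mem _ _ ha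

/-- Approximation by trigonometric polynomials on `Ô`. -/
theorem exists_trigonometric_approx {f : FiniteAdeles K → ℂ} (hf : Continuous f) {ε : ℝ} (hε : 0 < ε) :
    ∃ F ∈ Submodule.span ℂ (Set.range (rationalCharacter ψ)),
      ∀ w ∈ integralAdeles K, ‖f w - F w‖ ≤ ε := by
  have : CompactSpace (integralAdeles K) := isCompact_iff_compactSpace.1 (integralAdeles_isCompact K)
  have hsep : (trigPolynomials ψ).SeparatesPoints := by
    intro w w' hww
    by_contra! h
    refine hww (Subtype.ext (rationalCharacter_separates ψ fun y => ?_))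
    exact h _ ⟨integralCharacter ψ y, Submodule.subset_span ⟨y, rfl⟩, rfl⟩
  have htop := ContinuousMap.starSubalgebra_topologicalClosure_eq_top_of_separatesPoints _ hsep
  let f' : C(integralAdeles K, ℂ) := ⟨fun w => f w, hf.comp continuous_subtype_val⟩
  have hf' : f' ∈ closure ((trigPolynomials ψ : StarSubalgebra ℂ C(integralAdeles K, ℂ)) :
      Set C(integralAdeles K, ℂ)) := by
    have : f' ∈ (trigPolynomials ψ).topologicalClosure := by rw [htop]; trivial
    exact this
  obtain ⟨g, hg, hfg⟩ := Metric.mem_closure_iff.1 hf' ε hε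
  have hlift : ∃ F ∈ Submodule.span ℂ (Set.range (rationalCharacter ψ)),
      ∀ w : integralAdeles K, g w = F w := by
    have hg' : g ∈ Submodule.span ℂ (Set.range (integralCharacter ψ)) := hg
    clear hfg hg
    induction hg' using Submodule.span_induction with
    | mem a h =>
      obtain ⟨y, rfl⟩ := h
      exact ⟨rationalCharacter ψ y, Submodule.subset_span ⟨y, rfl⟩, fun w => rfl⟩
    | zero => exact ⟨0, zero_mem _, fun w => rfl⟩
    | add a b _ _ ha hb =>
      obtain ⟨F, hF, h1⟩ := ha
      obtain ⟨F', hF', h2⟩ := hb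
      exact ⟨F + F', add_mem hF hF', fun w => by
        rw [ContinuousMap.add_apply, h1, h2, Pi.add_apply]⟩
    | smul c a _ ha =>
      obtain ⟨F, hF, h1⟩ := ha
      exact ⟨c • F, Submodule.smul_mem _ _ hF, fun w => by
        rw [ContinuousMap.smul_apply, h1, Pi.smul_apply]⟩
  obtain ⟨F, hF, h⟩ := hlift
  refine ⟨F, hF, fun w hw => ?_⟩
  rw [← h ⟨w, hw⟩, ← dist_eq_norm]
  exact (ContinuousMap.dist_apply_le_dist (f := f') (g := g) ⟨w, hw⟩).trans hfg.le

/-! ### Congruence subgroups of the totally positive units -/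

variable (K) in
/-- The totally positive units, as a subgroup of the units of the ring of integers. -/
def positiveUnits : Subgroup (𝓞 K)ˣ :=
  (totallyPositive K).comap (Units.map (algebraMap (𝓞 K) K).toMonoidHom)

/-- A totally positive unit as an element of `K^*_+`. -/
def positiveUnits.toTotallyPositive (v : positiveUnits K) : totallyPositive K :=
  ⟨Units.map (algebraMap (𝓞 K) K).toMonoidHom v.1, v.2⟩

theorem positiveUnits.toTotallyPositive_mem (v : positiveUnits K) :
    toTotallyPositive v ∈ totallyPositiveUnits K := ⟨v.1, rfl⟩

theorem positiveUnits.exists_of_mem {u : totallyPositive K} (hu : u ∈ totallyPositiveUnits K) :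
    ∃ v, toTotallyPositive v = u := by
  obtain ⟨v, hv⟩ := hu
  refine ⟨⟨v, ?_⟩, Subtype.ext hv⟩
  change Units.map _ v ∈ totallyPositive K
  have : Units.map (algebraMap (𝓞 K) K).toMonoidHom v = u := hv
  rw [this]
  exact u.2

/-- The totally positive units congruent to one modulo `m`. -/
def congruenceUnits (m : 𝓞 K) : Subgroup (positiveUnits K) :=
  ((Units.map (Ideal.Quotient.mk (Ideal.span {m})).toMonoidHom).comp (positiveUnits K).subtype).ker

theorem finite_quotient_congruenceUnits {m : 𝓞 K} (hm : m ≠ 0) :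
    Finite (positiveUnits K ⧸ congruenceUnits m) := by
  have hI : Ideal.span {m} ≠ ⊥ := by rwa [Ne, Ideal.span_singleton_eq_bot]
  have : Finite (𝓞 K ⧸ Ideal.span {m}) := Ideal.finiteQuotientOfFreeOfNeBot _ hI
  have : (congruenceUnits m).FiniteIndex := by
    rw [congruenceUnits]
    infer_instance
  exact Subgroup.finite_quotient_of_finiteIndex

theorem sub_mem_of_mem_congruenceUnits {m : 𝓞 K} {u : positiveUnits K} (hu : u ∈ congruenceUnits m) :
    (u.1 : 𝓞 K) - 1 ∈ Ideal.span {m} := by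
  rw [← Ideal.Quotient.eq, map_one]
  exact congrArg Units.val hu

end Density

/-! ### Averages over the totally positive units -/

theorem finsum_quotient_mul_left {G : Type*} [Group G] {N : Subgroup G} {φ : G → ℂ}
    (hφ : ∀ g, ∀ n ∈ N, φ (g * n) = φ g) (v : G) :
    ∑ᶠ q : G ⧸ N, φ (v * q.out) = ∑ᶠ q : G ⧸ N, φ q.out := by
  have h : ∀ q : G ⧸ N, φ (v * q.out) = φ ((MulAction.toPerm v : Equiv.Perm (G ⧸ N)) q).out := by
    intro q
    induction q using QuotientGroup.induction_on with
    | _ g =>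
      obtain ⟨n, hn⟩ := QuotientGroup.mk_out_eq_mul N g
      obtain ⟨n', hn'⟩ := QuotientGroup.mk_out_eq_mul N (v * g)
      change _ = φ (Quotient.out ((v * g : G) : G ⧸ N))
      rw [hn, hn', ← mul_assoc, hφ _ _ n.2, hφ _ _ n'.2]
  rw [finsum_congr h]
  exact finsum_comp_equiv (MulAction.toPerm v : Equiv.Perm (G ⧸ N)) (f := fun q => φ q.out)

section Averages

open IsDedekindDomain HeightOneSpectrum NumberField

variable {K : Type u} [Field K] [NumberField K] (ψ : AdelicCharacter K)

/-- The average of a function over the totally positive units modulo those congruent to one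
modulo `m`. -/
def unitAverage (m : 𝓞 K) (F : FiniteAdeles K → ℂ) (w : FiniteAdeles K) : ℂ :=
  (Nat.card (positiveUnits K ⧸ congruenceUnits m) : ℂ)⁻¹ *
    ∑ᶠ q : positiveUnits K ⧸ congruenceUnits m, F (diagonal K (algebraMap (𝓞 K) K (q.out.1 : 𝓞 K)) * w)

theorem card_quotient_ne_zero {m : 𝓞 K} (hm : m ≠ 0) :
    (Nat.card (positiveUnits K ⧸ congruenceUnits m) : ℂ) ≠ 0 := by
  have := finite_quotient_congruenceUnits hm
  exact Nat.cast_ne_zero.2 Nat.card_pos.ne'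

theorem unitAverage_add {m : 𝓞 K} (hm : m ≠ 0) (F F' : FiniteAdeles K → ℂ) (w : FiniteAdeles K) :
    unitAverage m (F + F') w = unitAverage m F w + unitAverage m F' w := by
  have := finite_quotient_congruenceUnits hm
  rw [unitAverage, unitAverage, unitAverage, ← mul_add, ← finsum_add_distrib (Set.toFinite _)
    (Set.toFinite _)]
  rfl

theorem unitAverage_smul (m : 𝓞 K) (c : ℂ) (F : FiniteAdeles K → ℂ) (w : FiniteAdeles K) :
    unitAverage m (c • F) w = c * unitAverage m F w := by
  rw [unitAverage, unitAverage, mul_left_comm, ← smul_eq_mul c (∑ᶠ _, _), smul_finsum]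
  rfl

/-- Averaging does not spoil the approximation of a function which is invariant under units. -/
theorem norm_sub_unitAverage_le {m : 𝓞 K} (hm : m ≠ 0) {f F : FiniteAdeles K → ℂ}
    (hf : ∀ v : positiveUnits K, ∀ w, f (diagonal K (algebraMap (𝓞 K) K (v.1 : 𝓞 K)) * w) = f w) {ε : ℝ}
    (h : ∀ w ∈ integralAdeles K, ‖f w - F w‖ ≤ ε) {w : FiniteAdeles K} (hw : w ∈ integralAdeles K) :
    ‖f w - unitAverage m F w‖ ≤ ε := by
  have := finite_quotient_congruenceUnits hm
  have : Fintype (positiveUnits K ⧸ congruenceUnits m) := Fintype.ofFinite _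
  have hc := card_quotient_ne_zero hm
  rw [Nat.card_eq_fintype_card] at hc
  have e : f w - unitAverage m F w = (Fintype.card (positiveUnits K ⧸ congruenceUnits m) : ℂ)⁻¹ *
      ∑ q : positiveUnits K ⧸ congruenceUnits m,
        (f (diagonal K (algebraMap (𝓞 K) K (q.out.1 : 𝓞 K)) * w) -
          F (diagonal K (algebraMap (𝓞 K) K (q.out.1 : 𝓞 K)) * w)) := by
    rw [unitAverage, finsum_eq_sum_of_fintype, Finset.sum_sub_distrib, mul_sub,
      Nat.card_eq_fintype_card]
    simp only [hf]
    rw [Finset.sum_const, Finset.card_univ, nsmul_eq_mul, inv_mul_cancel_left₀ hc]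
  have hb : ‖∑ q : positiveUnits K ⧸ congruenceUnits m,
        (f (diagonal K (algebraMap (𝓞 K) K (q.out.1 : 𝓞 K)) * w) -
          F (diagonal K (algebraMap (𝓞 K) K (q.out.1 : 𝓞 K)) * w))‖ ≤
      Fintype.card (positiveUnits K ⧸ congruenceUnits m) * ε := by
    refine (norm_sum_le_of_le _ fun q _ =>
      h _ (mul_mem_integralAdeles (diagonal_integer_mem _) hw)).trans ?_
    rw [Finset.sum_const, Finset.card_univ, nsmul_eq_mul]
  have hc' : (0 : ℝ) < Fintype.card (positiveUnits K ⧸ congruenceUnits m) :=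
    Nat.cast_pos.2 (Nat.pos_of_ne_zero (Nat.cast_ne_zero.1 hc))
  rw [e, norm_mul, norm_inv, Complex.norm_natCast, inv_mul_le_iff₀ hc']
  exact hb

/-- The averages of a rational character are, on `Ô`, multiples of the sum of the characters of a
double coset: the totally positive units act transitively on the right cosets in the double coset of
`(1, y; 0, 1)`, through a finite quotient. -/
theorem unitAverage_rationalCharacter {y : K} {m : 𝓞 K} (hm : m ≠ 0)
    (hy : ∃ b, algebraMap (𝓞 K) K b = y * algebraMap (𝓞 K) K m) {w : FiniteAdeles K}
    (hw : w ∈ integralAdeles K) :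
    unitAverage m (rationalCharacter ψ y) w =
      ((cosetsIn (isHeckePair_integralAxbGroup K) ⟨y, 1⟩).card : ℂ)⁻¹ * heckeSum ψ ⟨y, 1⟩ w := by
  classical
  have hfin := finite_quotient_congruenceUnits hm
  have hft : Fintype (positiveUnits K ⧸ congruenceUnits m) := Fintype.ofFinite _
  let φ : positiveUnits K → ℂ := fun v =>
    rationalCharacter ψ y (diagonal K (algebraMap (𝓞 K) K (v.1 : 𝓞 K)) * w)
  have hφ : ∀ v, ∀ n ∈ congruenceUnits m, φ (v * n) = φ v := by
    intro v n hn
    obtain ⟨t, ht⟩ := Ideal.mem_span_singleton.1 (sub_mem_of_mem_congruenceUnits hn)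
    obtain ⟨b, hb⟩ := hy
    have e1 : y * algebraMap (𝓞 K) K (((v * n).1 : (𝓞 K)ˣ) : 𝓞 K) =
        y * algebraMap (𝓞 K) K (v.1 : 𝓞 K) + algebraMap (𝓞 K) K (b * t * (v.1 : 𝓞 K)) := by
      have hn' : (n.1 : 𝓞 K) = 1 + m * t := by rw [← ht]; ring
      rw [Subgroup.coe_mul, Units.val_mul, hn']
      simp only [map_mul, map_add, map_one, hb]
      ring
    change ψ (-(diagonal K y * (diagonal K _ * w))) = ψ (-(diagonal K y * (diagonal K _ * w)))
    rw [← mul_assoc, ← mul_assoc, ← map_mul, ← map_mul, e1, map_add, add_mul, neg_add,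
      ψ.map_add_of_mem]
    exact neg_mem_integralAdeles (mul_mem_integralAdeles (diagonal_integer_mem _) hw)
  -- the sum over the double coset does not change under right multiplication by units
  have h1 : (Nat.card (positiveUnits K ⧸ congruenceUnits m) : ℂ) * heckeSum ψ ⟨y, 1⟩ w =
      ((cosetsIn (isHeckePair_integralAxbGroup K) ⟨y, 1⟩).card : ℂ) *
        ∑ q : positiveUnits K ⧸ congruenceUnits m, φ q.out := by
    have hq : ∀ q : positiveUnits K ⧸ congruenceUnits m, heckeSum ψ ⟨y, 1⟩ w =
        ∑ d ∈ cosetsIn (isHeckePair_integralAxbGroup K) ⟨y, 1⟩,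
          cosetCharacter ψ d (diagonal K (algebraMap (𝓞 K) K (q.out.1 : 𝓞 K)) * w) := by
      intro q
      rw [← heckeSum_unit_mul ψ _ (positiveUnits.toTotallyPositive_mem q.out)]
      rfl
    rw [Nat.card_eq_fintype_card, ← nsmul_eq_mul, ← Finset.card_univ, ← Finset.sum_const,
      Finset.sum_congr rfl fun q _ => hq q, Finset.sum_comm, ← nsmul_eq_mul, ← Finset.sum_const]
    refine Finset.sum_congr rfl fun d hd => ?_
    induction d using Quotient.ind with
    | _ h =>
    obtain ⟨b, u, hu, e⟩ := exists_rightCoset_mk ((mem_cosetsIn _).1 hd)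
    obtain ⟨v, rfl⟩ := positiveUnits.exists_of_mem hu
    have hd' : ∀ q : positiveUnits K ⧸ congruenceUnits m,
        cosetCharacter ψ (rightCoset _ h) (diagonal K (algebraMap (𝓞 K) K (q.out.1 : 𝓞 K)) * w) =
          φ (v * q.out) := by
      intro q
      have hqw : diagonal K (algebraMap (𝓞 K) K (q.out.1 : 𝓞 K)) * w ∈ integralAdeles K :=
        mul_mem_integralAdeles (diagonal_integer_mem _) hw
      rw [e, cosetCharacter_mk, if_pos (by simpa using hqw), map_add, add_mul, neg_add, add_comm,
        ψ.map_add_of_mem (neg_mem_integralAdeles (mul_mem_integralAdeles (diagonal_integer_mem _) hqw))]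
      change _ = ψ (-(diagonal K y * (diagonal K (algebraMap (𝓞 K) K ((v.1 * q.out.1 : (𝓞 K)ˣ) : 𝓞 K)) * w)))
      rw [Units.val_mul, map_mul, map_mul, map_mul, mul_assoc, mul_assoc]
      rfl
    change ∑ q : positiveUnits K ⧸ congruenceUnits m, cosetCharacter ψ (rightCoset _ h) _ = _
    rw [Finset.sum_congr rfl fun q _ => hd' q, ← finsum_eq_sum_of_fintype,
      ← finsum_eq_sum_of_fintype, finsum_quotient_mul_left hφ]
  have hD : ((cosetsIn (isHeckePair_integralAxbGroup K) ⟨y, 1⟩).card : ℂ) ≠ 0 := by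
    rw [Nat.cast_ne_zero, Finset.card_ne_zero]
    exact ⟨rightCoset _ ⟨y, 1⟩, (mem_cosetsIn _).2 ((mem_doubleCoset_iff _).2
      ⟨1, one_mem _, 1, one_mem _, by simp⟩)⟩
  rw [unitAverage, finsum_eq_sum_of_fintype, inv_mul_eq_iff_eq_mul₀ (card_quotient_ne_zero hm),
    mul_left_comm, h1, inv_mul_cancel_left₀ hD]

end Averages

/-! ### The double cosets generate the corner -/

section Crossed

variable {X G : Type u} [TopologicalSpace X] [Group G] [MulAction G X] [ContinuousConstSMul G X]

theorem norm_le_of_forall_apply {f : C₀(X, ℂ)} {C : ℝ} (hC : 0 ≤ C) (h : ∀ x, ‖f x‖ ≤ C) :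
    ‖f‖ ≤ C :=
  (BoundedContinuousFunction.norm_le hC (f := f.toBCF)).2 h

theorem norm_crossedMonomial_sub_le (f f' : C₀(X, ℂ)) (g : G) :
    ‖crossedMonomial f g - crossedMonomial f' g‖ ≤ ‖f - f'‖ := by
  have h := norm_monomial_le (f - f') g
  rw [monomial_sub] at h
  exact h

theorem crossedMonomial_mul (f f' : C₀(X, ℂ)) (g g' : G) :
    crossedMonomial f g * crossedMonomial f' g' = crossedMonomial (f * translate g f') (g * g') :=
  Subtype.ext (monomial_mul f f' g g')

theorem crossedMonomial_one_mul (f f' : C₀(X, ℂ)) (g : G) :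
    crossedMonomial f 1 * crossedMonomial f' g = crossedMonomial (f * f') g :=
  Subtype.ext (monomial_one_mul f f' g)

theorem crossedMonomial_mul_one (f f' : C₀(X, ℂ)) (g : G) :
    crossedMonomial f g * crossedMonomial f' 1 = crossedMonomial (f * translate g f') g := by
  rw [crossedMonomial_mul, mul_one]

theorem crossedMonomial_smul (c : ℂ) (f : C₀(X, ℂ)) (g : G) :
    crossedMonomial (c • f) g = c • crossedMonomial f g :=
  Subtype.ext (monomial_smul c f g)

theorem crossedMonomial_add (f f' : C₀(X, ℂ)) (g : G) :
    crossedMonomial (f + f') g = crossedMonomial f g + crossedMonomial f' g :=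
  Subtype.ext (monomial_add f f' g)

/-- A closed subspace of the crossed product which contains the monomials is everything. -/
theorem mem_of_isClosed_of_monomial {D : Set (crossedProduct X G)} (hD : IsClosed D)
    (h0 : (0 : crossedProduct X G) ∈ D) (hadd : ∀ a ∈ D, ∀ b ∈ D, a + b ∈ D)
    (hsmul : ∀ (c : ℂ), ∀ a ∈ D, c • a ∈ D)
    (h : ∀ (f : C₀(X, ℂ)) (g : G), crossedMonomial f g ∈ D) (a : crossedProduct X G) : a ∈ D := by
  let S : Set (crossedProduct X G) := {a | (a : UniversalOperators X G) ∈
    Submodule.span ℂ {T | ∃ (f : C₀(X, ℂ)) (g : G), T = monomial f g}}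
  have ha : a ∈ closure S := by
    rw [closure_subtype]
    have h1 : (a : UniversalOperators X G) ∈ (crossedProduct X G : Set (UniversalOperators X G)) := a.2
    rw [coe_crossedProduct] at h1
    refine closure_mono ?_ h1
    intro T hT
    exact ⟨⟨T, mem_crossedProduct_of_mem_span hT⟩, hT, rfl⟩
  have key : ∀ T ∈ Submodule.span ℂ {T : UniversalOperators X G |
      ∃ (f : C₀(X, ℂ)) (g : G), T = monomial f g},
      ∃ b ∈ D, (b : UniversalOperators X G) = T := by
    intro T hT
    induction hT using Submodule.span_induction with
    | mem T h' =>
      obtain ⟨f, g, rfl⟩ := h'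
      exact ⟨_, h f g, rfl⟩
    | zero => exact ⟨0, h0, rfl⟩
    | add S T _ _ h1 h2 =>
      obtain ⟨b, hb, rfl⟩ := h1
      obtain ⟨b', hb', rfl⟩ := h2
      exact ⟨b + b', hadd b hb b' hb', rfl⟩
    | smul c T _ h1 =>
      obtain ⟨b, hb, rfl⟩ := h1
      exact ⟨c • b, hsmul c b hb, rfl⟩
  refine closure_minimal ?_ hD ha
  intro b hb
  obtain ⟨b', hb', e⟩ := key b hb
  rwa [← Subtype.ext e]

end Crossed

section Generation

open IsDedekindDomain HeightOneSpectrum NumberField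

variable {K : Type u} [Field K] [NumberField K] (ψ : AdelicCharacter K)

theorem heckeElement_mem_heckeClosure (g : AxbGroup K) : heckeElement ψ g ∈ heckeClosure ψ :=
  NonUnitalStarSubalgebra.le_topologicalClosure _ (NonUnitalStarAlgebra.subset_adjoin ℂ _ ⟨g, rfl⟩)

/-- The functions in the C*-algebra generated by the elements which correspond to double cosets. -/
def heckeFunctions : Submodule ℂ C₀(AdeleQuotient K, ℂ) where
  carrier := {f | crossedMonomial f (1 : PrincipalGroup K) ∈ heckeClosure ψ}
  add_mem' := by
    intro f f' h h'
    change crossedMonomial (f + f') (1 : PrincipalGroup K) ∈ heckeClosure ψ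
    rw [crossedMonomial_add]
    exact add_mem h h'
  zero_mem' := by
    have h := crossedMonomial_smul 0 (0 : C₀(AdeleQuotient K, ℂ)) (1 : PrincipalGroup K)
    rw [zero_smul, zero_smul] at h
    change crossedMonomial (0 : C₀(AdeleQuotient K, ℂ)) (1 : PrincipalGroup K) ∈ heckeClosure ψ
    rw [h]
    exact zero_mem _
  smul_mem' := by
    intro c f h
    change crossedMonomial (c • f) (1 : PrincipalGroup K) ∈ heckeClosure ψ
    rw [crossedMonomial_smul]
    exact SMulMemClass.smul_mem c h

theorem heckeSymbol_mem_heckeFunctions (y : K) : heckeSymbol ψ ⟨y, 1⟩ ∈ heckeFunctions ψ :=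
  heckeElement_mem_heckeClosure ψ ⟨y, 1⟩

theorem heckeSymbol_mk_one (y : K) (w : FiniteAdeles K) :
    heckeSymbol ψ ⟨y, 1⟩ (AdeleQuotient.mk K w) = heckeSum ψ ⟨y, 1⟩ w := by
  have h1 : normWeight (((1 : totallyPositive K)) : PrincipalGroup K) = 1 := normWeight_one
  have h2 : diagonal K (((1 : totallyPositive K) : Kˣ) : K)⁻¹ * w = w := by
    rw [Subgroup.coe_one, Units.val_one, inv_one, map_one, one_mul]
  refine (heckeSymbol_mk ψ ⟨y, 1⟩ w).trans ?_
  change _ * heckeSum ψ ⟨y, 1⟩ (diagonal K (((1 : totallyPositive K) : Kˣ) : K)⁻¹ * w) = _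
  rw [h2]
  exact (congrArg (· * heckeSum ψ ⟨y, 1⟩ w) h1).trans (one_mul _)

/-- The averages of `F` over sufficiently large finite quotients of the group of totally positive
units define an element of `heckeFunctions`. -/
def HasHeckeAverage (F : FiniteAdeles K → ℂ) : Prop :=
  ∃ f ∈ heckeFunctions ψ, (∀ w ∉ integralAdeles K, f (AdeleQuotient.mk K w) = 0) ∧
    ∃ m : 𝓞 K, m ≠ 0 ∧ ∀ m', m ∣ m' → m' ≠ 0 → ∀ w ∈ integralAdeles K,
      f (AdeleQuotient.mk K w) = unitAverage m' F w

variable {ψ}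

theorem HasHeckeAverage.zero : HasHeckeAverage ψ (0 : FiniteAdeles K → ℂ) := by
  refine ⟨0, zero_mem _, fun w _ => rfl, 1, one_ne_zero, fun m' _ hm w _ => ?_⟩
  have h := unitAverage_smul m' 0 (0 : FiniteAdeles K → ℂ) w
  rw [zero_smul, zero_mul] at h
  rw [h]
  rfl

theorem HasHeckeAverage.add {F F' : FiniteAdeles K → ℂ} (h : HasHeckeAverage ψ F)
    (h' : HasHeckeAverage ψ F') : HasHeckeAverage ψ (F + F') := by
  obtain ⟨f, hf, h0, m, hm, hfm⟩ := h
  obtain ⟨f', hf', h0', n, hn, hfn⟩ := h'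
  refine ⟨f + f', add_mem hf hf', fun w hw => ?_, m * n, mul_ne_zero hm hn, fun m' hd hm' w hw => ?_⟩
  · rw [ZeroAtInftyContinuousMap.add_apply, h0 w hw, h0' w hw, add_zero]
  · rw [ZeroAtInftyContinuousMap.add_apply, hfm m' (dvd_of_mul_right_dvd hd) hm' w hw,
      hfn m' (dvd_of_mul_left_dvd hd) hm' w hw, unitAverage_add hm']

theorem HasHeckeAverage.smul (c : ℂ) {F : FiniteAdeles K → ℂ} (h : HasHeckeAverage ψ F) :
    HasHeckeAverage ψ (c • F) := by
  obtain ⟨f, hf, h0, m, hm, hfm⟩ := h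
  refine ⟨c • f, Submodule.smul_mem _ _ hf, fun w hw => ?_, m, hm, fun m' hd hm' w hw => ?_⟩
  · rw [ZeroAtInftyContinuousMap.smul_apply, h0 w hw, smul_zero]
  · rw [ZeroAtInftyContinuousMap.smul_apply, hfm m' hd hm' w hw, unitAverage_smul, smul_eq_mul]

variable (ψ)

/-- The average of the character with frequency `y` is a multiple of the symbol of the double coset of
`(1, y; 0, 1)`. -/
theorem hasHeckeAverage_rationalCharacter (y : K) : HasHeckeAverage ψ (rationalCharacter ψ y) := by
  refine ⟨((cosetsIn (isHeckePair_integralAxbGroup K) ⟨y, 1⟩).card : ℂ)⁻¹ • heckeSymbol ψ ⟨y, 1⟩,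
    Submodule.smul_mem _ _ (heckeSymbol_mem_heckeFunctions ψ y), fun w hw => ?_, ?_⟩
  · rw [ZeroAtInftyContinuousMap.smul_apply, heckeSymbol_mk_one, heckeSum_eq_zero ψ _ hw, smul_zero]
  · obtain ⟨p, q, hq, hy⟩ := IsFractionRing.div_surjective (A := 𝓞 K) y
    have hq0 : algebraMap (𝓞 K) K q ≠ 0 := IsFractionRing.to_map_ne_zero_of_mem_nonZeroDivisors hq
    refine ⟨q, nonZeroDivisors.ne_zero hq, ?_⟩
    rintro _ ⟨t, rfl⟩ hm w hw
    rw [unitAverage_rationalCharacter ψ hm ⟨p * t, ?_⟩ hw, ZeroAtInftyContinuousMap.smul_apply,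
      heckeSymbol_mk_one, smul_eq_mul]
    rw [← hy, map_mul, map_mul, ← mul_assoc, div_mul_cancel₀ _ hq0]

theorem hasHeckeAverage_of_mem_span {F : FiniteAdeles K → ℂ}
    (hF : F ∈ Submodule.span ℂ (Set.range (rationalCharacter ψ))) : HasHeckeAverage ψ F := by
  refine Submodule.span_induction (p := fun F _ => HasHeckeAverage ψ F) ?_ HasHeckeAverage.zero
    (fun _ _ _ _ h h' => h.add h') (fun c _ _ h => h.smul c) hF
  rintro _ ⟨y, rfl⟩
  exact hasHeckeAverage_rationalCharacter ψ y

/-- The functions supported in `Ô / closure(O^*_+)` belong to the algebra generated by the double cosets: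
approximate by trigonometric polynomials and average over the units. -/
theorem crossedMonomial_integral_mem (f : C₀(AdeleQuotient K, ℂ)) :
    crossedMonomial (integralIndicator K * f) (1 : PrincipalGroup K) ∈ heckeClosure ψ := by
  rw [← SetLike.mem_coe, ← (isClosed_heckeClosure ψ).closure_eq, Metric.mem_closure_iff]
  intro ε hε
  obtain ⟨F, hF, hfF⟩ := exists_trigonometric_approx ψ (f.continuous.comp (continuous_mk K))
    (half_pos hε)
  obtain ⟨f', hf', h0, m, hm, hfm⟩ := hasHeckeAverage_of_mem_span ψ hF
  refine ⟨_, hf', ?_⟩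
  rw [dist_eq_norm]
  refine ((norm_crossedMonomial_sub_le _ _ _).trans
    (norm_le_of_forall_apply (half_pos hε).le fun x => ?_)).trans_lt (half_lt_self hε)
  induction x using Quotient.ind with
  | _ w =>
  change ‖integralIndicator K (AdeleQuotient.mk K w) * f (AdeleQuotient.mk K w) -
    f' (AdeleQuotient.mk K w)‖ ≤ ε / 2
  by_cases hw : w ∈ integralAdeles K
  · rw [integralIndicator_mk hw, one_mul, hfm m dvd_rfl hm w hw]
    refine norm_sub_unitAverage_le hm (f := fun w => f (AdeleQuotient.mk K w)) (fun v w => ?_) hfF hw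
    refine congrArg f (AdeleQuotient.mk_smul K (FiniteAdeleRing.unitEmbedding (𝓞 K) K
      (positiveUnits.toTotallyPositive v : Kˣ)) ?_ w)
    exact Subgroup.le_topologicalClosure _ (Subgroup.mem_map_of_mem _
      (Subgroup.mem_map_of_mem _ (positiveUnits.toTotallyPositive_mem v)))
  · rw [integralIndicator_mk_of_notMem hw, h0 w hw, zero_mul, sub_zero, norm_zero]
    exact (half_pos hε).le

/-- For a diagonal matrix, all characters in the sum over the double coset are trivial. -/
theorem heckeSum_diagonal (x : totallyPositive K) {w : FiniteAdeles K} (hw : w ∈ integralAdeles K)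
    (hxw : diagonal K ((x : Kˣ) : K) * w ∈ integralAdeles K) :
    heckeSum ψ ⟨0, x⟩ w = (cosetsIn (isHeckePair_integralAxbGroup K) ⟨0, x⟩).card := by
  classical
  rw [heckeSum, Finset.sum_congr rfl (g := fun _ => (1 : ℂ)), Finset.sum_const, nsmul_one]
  intro d hd
  induction d using Quotient.ind with
  | _ h =>
  obtain ⟨b, u, -, e⟩ := exists_rightCoset_mk ((mem_cosetsIn _).1 hd)
  change cosetCharacter ψ (rightCoset _ h) w = 1
  rw [e, cosetCharacter_mk, if_pos hxw, zero_mul, add_zero]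
  exact ψ.eq_one_of_mem _
    (neg_mem_integralAdeles (mul_mem_integralAdeles (diagonal_integer_mem b) hw))

/-- Up to a scalar, the double coset of the diagonal matrix with entry `x` corresponds to `p u_x p`. -/
theorem crossedMonomial_indicator_mem (x : totallyPositive K) :
    crossedMonomial (integralIndicator K * translate (x : PrincipalGroup K) (integralIndicator K))
      (x : PrincipalGroup K) ∈ heckeClosure ψ := by
  have hD : ((cosetsIn (isHeckePair_integralAxbGroup K) ⟨0, x⟩).card : ℂ) ≠ 0 := by
    rw [Nat.cast_ne_zero, Finset.card_ne_zero]
    exact ⟨rightCoset _ ⟨0, x⟩, (mem_cosetsIn _).2 ((mem_doubleCoset_iff _).2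
      ⟨1, one_mem _, 1, one_mem _, by simp⟩)⟩
  obtain ⟨c, hc⟩ : ∃ c : ℂ, c = normWeight (x : PrincipalGroup K) *
    (cosetsIn (isHeckePair_integralAxbGroup K) ⟨0, x⟩).card := ⟨_, rfl⟩
  have hc0 : c ≠ 0 := by
    rw [hc]
    exact mul_ne_zero (normWeight_ne_zero _) hD
  have e : integralIndicator K * translate (x : PrincipalGroup K) (integralIndicator K) =
      c⁻¹ • heckeSymbol ψ ⟨0, x⟩ := by
    refine adeleQuotient_ext fun w => ?_
    rw [ZeroAtInftyContinuousMap.smul_apply, heckeSymbol_mk, ZeroAtInftyContinuousMap.coe_mul,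
      Pi.mul_apply, translate_apply, inv_smul_mk, smul_eq_mul]
    by_cases hw : w ∈ integralAdeles K
    · by_cases hxw : diagonal K (((x : Kˣ) : K)⁻¹) * w ∈ integralAdeles K
      · rw [integralIndicator_mk hw, integralIndicator_mk hxw,
          heckeSum_diagonal ψ x hxw (by rwa [diagonal_mul_inv_cancel]), ← hc, inv_mul_cancel₀ hc0,
          one_mul]
      · rw [integralIndicator_mk_of_notMem hxw, heckeSum_eq_zero ψ _ hxw, mul_zero, mul_zero, mul_zero]
    · rw [integralIndicator_mk_of_notMem hw, heckeSum_eq_zero' ψ _ (by rwa [diagonal_mul_inv_cancel]),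
        mul_zero, mul_zero, zero_mul]
  rw [e, crossedMonomial_smul]
  exact SMulMemClass.smul_mem _ (heckeElement_mem_heckeClosure ψ ⟨0, x⟩)

/-- The elements which correspond to double cosets generate the corner. -/
theorem adelicCorner_le_heckeClosure : adelicCorner K ≤ heckeClosure ψ := by
  rintro a ⟨h1, h2⟩
  have h : integralProjection K * a * integralProjection K ∈ heckeClosure ψ := by
    refine mem_of_isClosed_of_monomial
      (D := {a | integralProjection K * a * integralProjection K ∈ heckeClosure ψ})
      ((isClosed_heckeClosure ψ).preimage
        ((continuous_const.mul continuous_id).mul continuous_const)) ?_ ?_ ?_ ?_ a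
    · change integralProjection K * 0 * integralProjection K ∈ heckeClosure ψ
      rw [mul_zero, zero_mul]
      exact zero_mem _
    · intro a ha b hb
      change integralProjection K * (a + b) * integralProjection K ∈ heckeClosure ψ
      rw [mul_add, add_mul]
      exact add_mem ha hb
    · intro c a ha
      change integralProjection K * (c • a) * integralProjection K ∈ heckeClosure ψ
      rw [mul_smul_comm, smul_mul_assoc]
      exact SMulMemClass.smul_mem c ha
    · intro f q
      induction q using QuotientGroup.induction_on with
      | _ x =>
      have e : integralProjection K * crossedMonomial f (x : PrincipalGroup K) * integralProjection K =
          crossedMonomial (integralIndicator K * f) 1 * crossedMonomial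
            (integralIndicator K * translate (x : PrincipalGroup K) (integralIndicator K))
              (x : PrincipalGroup K) := by
        rw [integralProjection, crossedMonomial_one_mul, crossedMonomial_mul_one,
          crossedMonomial_one_mul]
        congr 1
        ext z
        by_cases hz : z ∈ integralQuotient K <;> simp [integralIndicator, hz]
      change integralProjection K * crossedMonomial f (x : PrincipalGroup K) *
        integralProjection K ∈ heckeClosure ψ
      rw [e]
      exact mul_mem (crossedMonomial_integral_mem ψ f) (crossedMonomial_indicator_mem ψ x)
  rw [h1, h2] at h
  exact h

end Generation

/-! ### The dynamics -/

section Corner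

variable {A : Type*} [NonUnitalRing A] [Module ℂ A] [IsScalarTower ℂ A A] [SMulCommClass ℂ A A]
  [StarRing A] [StarModule ℂ A]

theorem map_mem_corner {p : A} (hp : IsStarProjection p) {σ : A ≃⋆ₐ[ℂ] A} (h : σ p = p) {a : A}
    (ha : a ∈ corner p hp) : σ a ∈ corner p hp := by
  refine ⟨?_, ?_⟩
  · conv_lhs => rw [← h, ← map_mul, ha.1]
  · conv_lhs => rw [← h, ← map_mul, ha.2]

/-- The restriction of an automorphism which fixes a projection to the corner of the projection. -/
def cornerEquiv {p : A} (hp : IsStarProjection p) (σ : A ≃⋆ₐ[ℂ] A) (h : σ p = p) :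
    corner p hp ≃⋆ₐ[ℂ] corner p hp where
  toFun a := ⟨σ a, map_mem_corner hp h a.2⟩
  invFun a := ⟨σ.symm a, map_mem_corner hp
    (by conv_lhs => rw [← h, StarAlgEquiv.symm_apply_apply]) a.2⟩
  left_inv a := Subtype.ext (σ.symm_apply_apply a.1)
  right_inv a := Subtype.ext (σ.apply_symm_apply a.1)
  map_mul' a b := Subtype.ext (map_mul σ a.1 b.1)
  map_add' a b := Subtype.ext (map_add σ a.1 b.1)
  map_smul' c a := Subtype.ext (map_smul σ c a.1)
  map_star' a := Subtype.ext (map_star σ a.1)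

theorem isRealAction_cornerEquiv [TopologicalSpace A] {p : A} (hp : IsStarProjection p)
    {σ : ℝ → (A ≃⋆ₐ[ℂ] A)} (hσ : IsRealAction σ) (h : ∀ t, σ t p = p) :
    IsRealAction fun t => cornerEquiv hp (σ t) (h t) where
  zero a := Subtype.ext (hσ.zero a.1)
  add s t a := Subtype.ext (hσ.add s t a.1)
  continuous a := (hσ.continuous a.1).subtype_mk _

end Corner

/-- The transport of an action along an isomorphism with continuous inverse. -/
theorem IsRealAction.conj {A B : Type*} [NonUnitalRing A] [Module ℂ A] [Star A]
    [TopologicalSpace A] [NonUnitalRing B] [Module ℂ B] [Star B] [TopologicalSpace B]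
    {σ : ℝ → (B ≃⋆ₐ[ℂ] B)} (hσ : IsRealAction σ) (φ : A ≃⋆ₐ[ℂ] B) (hφ : Continuous φ.symm) :
    IsRealAction fun t => (φ.trans (σ t)).trans φ.symm where
  zero a := by
    change φ.symm (σ 0 (φ a)) = a
    rw [hσ.zero, StarAlgEquiv.symm_apply_apply]
  add s t a := by
    change φ.symm (σ (s + t) (φ a)) = φ.symm (σ s (φ (φ.symm (σ t (φ a)))))
    rw [hσ.add, StarAlgEquiv.apply_symm_apply]
  continuous a := hφ.comp (hσ.continuous (φ a))

theorem continuous_symm_of_norm_map {A B : Type*} [NonUnitalNormedRing A] [StarRing A]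
    [NormedSpace ℂ A] [NonUnitalNormedRing B] [StarRing B] [NormedSpace ℂ B]
    {S : NonUnitalStarSubalgebra ℂ A} {T : NonUnitalStarSubalgebra ℂ B} (φ : S ≃⋆ₐ[ℂ] T)
    (hφ : ∀ b, ‖φ b‖ = ‖b‖) : Continuous φ.symm :=
  (AddMonoidHomClass.isometry_of_norm φ.symm fun b => by
    rw [← hφ, StarAlgEquiv.apply_symm_apply]).continuous

theorem symm_conj_eq_smul {A B : Type*} [NonUnitalRing A] [Module ℂ A] [Star A]
    [NonUnitalRing B] [Module ℂ B] [Star B] (φ : A ≃⋆ₐ[ℂ] B) (σ : B ≃⋆ₐ[ℂ] B) {a : A} {c : ℂ}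
    (h : σ (φ a) = c • φ a) : (φ.trans σ).trans φ.symm a = c • a := by
  change φ.symm (σ (φ a)) = c • a
  rw [h, map_smul, StarAlgEquiv.symm_apply_apply]

section Norm

variable {K : Type u} [Field K] [NumberField K]

variable (K) in
/-- The character `x ↦ N_K(x)^{it}` of `K^*_+ / O^*_+`. -/
def normPhase (t : ℝ) : PrincipalGroup K →* Circle where
  toFun q := Circle.exp (t * Real.log (classNorm K q))
  map_one' := by rw [map_one, Real.log_one, mul_zero, Circle.exp_zero]
  map_mul' p q := by
    rw [map_mul (classNorm K) p q, Real.log_mul (classNorm_pos p).ne' (classNorm_pos q).ne', mul_add, Circle.exp_add]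

theorem coe_normPhase (t : ℝ) (x : totallyPositive K) :
    (normPhase K t (x : PrincipalGroup K) : ℂ) =
      (absoluteNorm K (x : Kˣ) : ℂ) ^ (Complex.I * t) := by
  have h : 0 < absoluteNorm K (x : Kˣ) := classNorm_pos (x : PrincipalGroup K)
  change (Circle.exp (t * Real.log (absoluteNorm K (x : Kˣ))) : ℂ) = _
  rw [Circle.coe_exp, Complex.cpow_def_of_ne_zero (Complex.ofReal_ne_zero.2 h.ne'),
    ← Complex.ofReal_log h.le]
  push_cast
  congr 1
  ring

variable (K) in
/-- The dual action `σ_t (f u_x) = N_K(x)^{it} f u_x`. -/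
def normDynamics (t : ℝ) : crossedProduct (AdeleQuotient K) (PrincipalGroup K) ≃⋆ₐ[ℂ]
    crossedProduct (AdeleQuotient K) (PrincipalGroup K) :=
  dualAction (normPhase K t)

theorem normDynamics_crossedMonomial (t : ℝ) (f : C₀(AdeleQuotient K, ℂ)) (q : PrincipalGroup K) :
    normDynamics K t (crossedMonomial f q) = (normPhase K t q : ℂ) • crossedMonomial f q :=
  Subtype.ext (dualHom_monomial (normPhase K t) f q)

theorem isRealAction_normDynamics : IsRealAction (normDynamics K) :=
  isRealAction_dualAction (χ := normPhase K)
    (fun _ => Circle.exp.continuous.comp (continuous_id.mul continuous_const))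
    (MonoidHom.ext fun q => by
      change Circle.exp (0 * Real.log (classNorm K q)) = 1
      rw [zero_mul, Circle.exp_zero])
    (fun s t => MonoidHom.ext fun q => by
      change Circle.exp ((s + t) * Real.log (classNorm K q)) = Circle.exp _ * Circle.exp _
      rw [add_mul, Circle.exp_add])

theorem isNormDynamics_normDynamics : IsNormDynamics K (normDynamics K) where
  isRealAction := isRealAction_normDynamics
  apply_monomial t f x := by
    rw [normDynamics_crossedMonomial, coe_normPhase]

theorem normDynamics_integralProjection (t : ℝ) :
    normDynamics K t (integralProjection K) = integralProjection K := by
  refine (normDynamics_crossedMonomial t (integralIndicator K) 1).trans ?_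
  rw [map_one, Circle.coe_one]
  exact one_smul ℂ _

variable (K) in
/-- The restriction of `normDynamics` to the corner. -/
def cornerDynamics (t : ℝ) : adelicCorner K ≃⋆ₐ[ℂ] adelicCorner K :=
  cornerEquiv (integralProjection_isStarProjection K) (normDynamics K t)
    (normDynamics_integralProjection t)

theorem isRealAction_cornerDynamics : IsRealAction (cornerDynamics K) :=
  isRealAction_cornerEquiv (integralProjection_isStarProjection K) isRealAction_normDynamics
    normDynamics_integralProjection

theorem normDynamics_heckeElement (ψ : AdelicCharacter K) (t : ℝ) (g : AxbGroup K) :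
    normDynamics K t (heckeElement ψ g) =
      ((modularFunction (integralAxbGroup K) g : ℂ) ^ (-(Complex.I * t))) • heckeElement ψ g := by
  have h : 0 < absoluteNorm K (g.x : Kˣ) := classNorm_pos (g.x : PrincipalGroup K)
  refine (normDynamics_crossedMonomial t _ _).trans (congrArg (· • heckeElement ψ g) ?_)
  rw [coe_normPhase, modularFunction_integralAxbGroup, Complex.ofReal_inv,
    Complex.inv_cpow _ _ (by
      rw [Complex.arg_ofReal_of_nonneg h.le]
      exact Real.pi_pos.ne), Complex.cpow_neg, inv_inv]

/-- The action on the reduced Hecke algebra which corresponds to `cornerDynamics` under `φ`. -/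
def conjDynamics (φ : reducedHeckeAlgebra (integralAxbGroup K) ≃⋆ₐ[ℂ] adelicCorner K) (t : ℝ) :
    reducedHeckeAlgebra (integralAxbGroup K) ≃⋆ₐ[ℂ] reducedHeckeAlgebra (integralAxbGroup K) :=
  (φ.trans (cornerDynamics K t)).trans φ.symm

/-- An isomorphism onto the corner which carries the operators of double cosets to the elements
`heckeElement` intertwines the restriction of `normDynamics` with a Hecke dynamics. -/
theorem isHeckeDynamics_conj {ψ : AdelicCharacter K}
    (φ : reducedHeckeAlgebra (integralAxbGroup K) ≃⋆ₐ[ℂ] adelicCorner K) (hφ : ∀ b, ‖φ b‖ = ‖b‖)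
    (h : ∀ g (b : reducedHeckeAlgebra (integralAxbGroup K)),
      (b : CosetL2 (integralAxbGroup K) →L[ℂ] CosetL2 (integralAxbGroup K)) =
          heckeOp (isHeckePair_integralAxbGroup K) g →
        (φ b : crossedProduct (AdeleQuotient K) (PrincipalGroup K)) = heckeElement ψ g) :
    IsHeckeDynamics (integralAxbGroup K) (conjDynamics φ) where
  isRealAction := isRealAction_cornerDynamics.conj φ
    (@continuous_symm_of_norm_map _ _ _ _ _ _ _ _ _ _ φ hφ)
  apply_doubleCoset t g a ha := by
    have hφa := h g a (ha.unique (isHeckeOperator_heckeOp _ g))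
    have e : cornerDynamics K t (φ a) =
        ((modularFunction (integralAxbGroup K) g : ℂ) ^ (-(Complex.I * t))) • φ a := by
      refine Subtype.ext ?_
      change normDynamics K t (φ a : crossedProduct (AdeleQuotient K) (PrincipalGroup K)) =
        _ • (φ a : crossedProduct (AdeleQuotient K) (PrincipalGroup K))
      rw [hφa, normDynamics_heckeElement]
    exact symm_conj_eq_smul φ (cornerDynamics K t) e

variable (K) in
theorem exists_isHeckeDynamics_conj :
    ∃ φ : reducedHeckeAlgebra (integralAxbGroup K) ≃⋆ₐ[ℂ] adelicCorner K,
      IsHeckeDynamics (integralAxbGroup K) (conjDynamics φ) := by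
  have ψ := (exists_adelic_character K).some
  have h := @exists_starAlgEquiv_of_dense _ _ _ _ (adelicCorner_le_heckeClosure ψ)
  refine h.elim fun φ hφ => Exists.intro φ ?_
  have h' := @isHeckeDynamics_conj _ _ _ ψ φ hφ.1 hφ.2
  exact h'

theorem coe_apply_conj (φ : reducedHeckeAlgebra (integralAxbGroup K) ≃⋆ₐ[ℂ] adelicCorner K)
    (t : ℝ) (a : reducedHeckeAlgebra (integralAxbGroup K)) :
    (φ (conjDynamics φ t a) :
        crossedProduct (AdeleQuotient K) (PrincipalGroup K)) = normDynamics K t (φ a) :=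
  congrArg Subtype.val (φ.apply_symm_apply (cornerDynamics K t (φ a)))

end Norm

end HeckeBC

end

theorem proposition2p2 (K : Type*) [Field K] [NumberField K] :
    HeckeBC.IsHeckePair (HeckeBC.integralAxbGroup K) ∧
    (∀ f : HeckeBC.HeckeAlgebra (HeckeBC.integralAxbGroup K),
      ∃ T, HeckeBC.IsHeckeOperator (HeckeBC.integralAxbGroup K) f T) ∧
    ∃ τ, HeckeBC.IsHeckeDynamics (HeckeBC.integralAxbGroup K) τ ∧
    ∃ σ, HeckeBC.IsNormDynamics K σ ∧
    ∃ φ : HeckeBC.reducedHeckeAlgebra (HeckeBC.integralAxbGroup K) ≃⋆ₐ[ℂ] HeckeBC.adelicCorner K,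
      ∀ (t : ℝ) (a : HeckeBC.reducedHeckeAlgebra (HeckeBC.integralAxbGroup K)),
        (φ (τ t a) : HeckeBC.crossedProduct (HeckeBC.AdeleQuotient K) (HeckeBC.PrincipalGroup K)) =
          σ t (φ a) :=
  ⟨HeckeBC.isHeckePair_integralAxbGroup K,
    fun f => (HeckeBC.exists_isHeckeOperator (HeckeBC.isHeckePair_integralAxbGroup K) f).imp
      fun _ h => h.2,
    (HeckeBC.exists_isHeckeDynamics_conj K).elim fun φ h =>
      ⟨_, h, _, HeckeBC.isNormDynamics_normDynamics, φ, HeckeBC.coe_apply_conj φ⟩⟩
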